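/- Let $G=(V,E)$ be a finite simple graph with nonnegative edge weights $w$, let $S\subseteq V$ be a nonempty set of terminals, and let $\epsilon>0$. Fix a shortest path $P_{uv}=P_{vu}$ for each pair of terminals, and let $W(u,v)$ be the maximum edge weight on $P_{uv}$. A subgraph $X$ of $G$ satisfies the pair $u,v\in S$ if $d_X(u,v)\le d_G(u,v)+\epsilon W(u,v)$, and $X$ is a subsetwise additive $+\epsilon W(\cdot,\cdot)$ spanner if it satisfies all pairs of terminals. For a Steiner tree $R$ with terminal set $S$, let $S'$ consist of $S$ and all vertices on the paths $P_{uv}$ of the pairs $u,v\in S$ that $R$ does not satisfy. The subset-lightness of $X$ (with respect to $R$) is $w(X)$ divided by the weight of a minimum Steiner tree of $G$ with terminal set $S'$ (where $0/0=0$ and $a/0=\infty$ for $a>0$). Greedy construction with approximation factor $\rho$: take a $\rho$-approximate minimum Steiner tree $R$ for $S$, a $\rho$-approximate minimum Steiner tree $T$ for $S'$, and a tree $H$ that contains $R$, is contained in $R\cup T$, and spans $S'$. For each $v\in S'$ that has an incident edge choose a lightest edge $e_v$ of $G$ incident to $v$. Start with the graph formed by $H$ and those edges $e_v$ that have weight less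 than $1$ after all weights are multiplied by $|V_H|/w(H)$, i.e. with $w(e_v)\,|V_H|<w(H)$. Then go through the pairs $(u,v)$ of terminals in nondecreasing order of $W(u,v)$; whenever the current graph does not satisfy the pair, add all edges of $P_{uv}$ to it. The final graph is $\mathcal H$. Theorem. (1) For every $\rho$ there are constants $A,k$, depending only on $\rho$, such that for all $\epsilon>0$, $G$, $w$, $S$ as above and every outcome of the greedy construction with approximation factor $\rho$ (whatever choices are made), $\mathcal H$ is a subsetwise additive $+\epsilon W(\cdot,\cdot)$ spanner of $G$, and its subset-lightness with respect to $R$ is at most $A\,(1+1/\epsilon)^k\,|S|$; that is, it is $O_\epsilon(|S|)$, where $O_\epsilon$ hides a factor polynomial in $1/\epsilon$. (2) For some constant $\rho$, the construction can be carried out by a deterministic algorithm in polynomial time: there are a constant $\rho$, one program for a deterministic unit-cost random access machine (whose only operations on edge weights are addition, multiplication by $\epsilon$, and comparison, and whose only operations on natural numbers are addition, truncated subtraction and comparison) and a polynomial $q$ such that, for all $\epsilon>0$ and every weighted graph $G$ on $n$ vertices and nonempty terminal set $S$ contained in one connected component of $G$, the program stops after at most $q(n)$ steps and outputs the graph $\mathcal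 H$ of an outcome of the greedy construction with approximation factor $\rho$. -/

import Mathlib

open scoped NNReal ENNReal

noncomputable section

namespace SubsetSpanner

/-! ## Weighted graphs: weights, distances, Steiner trees -/

section Graphs

variable {V : Type*}

/-- The total weight of the edges of a walk. -/
def walkWeight (w : Sym2 V → ℝ≥0) {G : SimpleGraph V} {u v : V} (q : G.Walk u v) : ℝ≥0 :=
  (q.edges.map w).sum

open Classical in
/-- The maximum weight of an edge of a walk (`0` if the walk has no edge). -/
def walkMax (w : Sym2 V → ℝ≥0) {G : SimpleGraph V} {u v : V} (q : G.Walk u v) : ℝ≥0 :=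
  q.edges.toFinset.sup w

/-- The weighted distance from `u` to `v` in `X`; it is `⊤` if there is no walk. -/
def wdist (w : Sym2 V → ℝ≥0) (X : SimpleGraph V) (u v : V) : ℝ≥0∞ :=
  ⨅ q : X.Walk u v, (walkWeight w q : ℝ≥0∞)

open Classical in
/-- The total weight of a set of edges. -/
def edgeWeight [Fintype V] (w : Sym2 V → ℝ≥0) (E : Set (Sym2 V)) : ℝ≥0 :=
  ∑ e : Sym2 V with e ∈ E, w e

/-- `q` is a shortest path. -/
def IsShortestPath (w : Sym2 V → ℝ≥0) {G : SimpleGraph V} {u v : V} (q : G.Walk u v) : Prop :=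
  q.IsPath ∧ ∀ q' : G.Walk u v, walkWeight w q ≤ walkWeight w q'

/-- The graph formed by the edges of a walk. -/
def walkGraph {G : SimpleGraph V} {u v : V} (q : G.Walk u v) : SimpleGraph V :=
  SimpleGraph.fromEdgeSet {e | e ∈ q.edges}

/-- A Steiner tree of `G` with terminal set `K`: a subgraph that is a tree and contains `K`. -/
def IsSteinerTree (G : SimpleGraph V) (K : Set V) (T : G.Subgraph) : Prop :=
  T.coe.IsTree ∧ K ⊆ T.verts

/-- A Steiner tree whose weight is at most `ρ` times that of every other one
(for `ρ = 1`: a minimum Steiner tree). -/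
def IsApproxSteinerTree [Fintype V] (ρ : ℝ≥0) (w : Sym2 V → ℝ≥0) (G : SimpleGraph V)
    (K : Set V) (T : G.Subgraph) : Prop :=
  IsSteinerTree G K T ∧
    ∀ T' : G.Subgraph, IsSteinerTree G K T' →
      edgeWeight w T.edgeSet ≤ ρ * edgeWeight w T'.edgeSet

/-- The weight of a minimum Steiner tree with terminal set `K` (`⊤` if there is none). -/
def minSteinerWeight [Fintype V] (w : Sym2 V → ℝ≥0) (G : SimpleGraph V) (K : Set V) : ℝ≥0∞ :=
  ⨅ (T : G.Subgraph) (_ : IsSteinerTree G K T), (edgeWeight w T.edgeSet : ℝ≥0∞)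

/-- A choice of one shortest path for each (unordered) pair of terminals. -/
structure PathSystem (G : SimpleGraph V) (w : Sym2 V → ℝ≥0) (S : Finset V) where
  path : ∀ u v : S, G.Walk (u : V) (v : V)
  shortest : ∀ u v, IsShortestPath w (path u v)
  symm : ∀ u v, path v u = (path u v).reverse

variable {G : SimpleGraph V} {w : Sym2 V → ℝ≥0} {S : Finset V}

/-- `W(u, v)`: the maximum edge weight on the chosen shortest path from `u` to `v`. -/
def PathSystem.W (P : PathSystem G w S) (u v : S) : ℝ≥0 := walkMax w (P.path u v)

/-- The `+ε W(·,·)` condition for the pair `u, v` in the graph `X`. -/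
def PathSystem.Satisfied (P : PathSystem G w S) (ε : ℝ≥0) (X : SimpleGraph V) (u v : S) : Prop :=
  wdist w X u v ≤ wdist w G u v + ((ε * P.W u v : ℝ≥0) : ℝ≥0∞)

/-- `X` is a subsetwise additive `+ε W(·,·)` spanner of `G` for the terminal set `S`. -/
def PathSystem.IsSpanner (P : PathSystem G w S) (ε : ℝ≥0) (X : SimpleGraph V) : Prop :=
  X ≤ G ∧ ∀ u v : S, P.Satisfied ε X u v

/-- The terminals, together with all vertices on the chosen shortest paths of those pairs of
terminals that violate the `+ε W(·,·)` condition in the Steiner tree `R`. -/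
def PathSystem.extendedTerminals (P : PathSystem G w S) (ε : ℝ≥0) (R : G.Subgraph) : Set V :=
  {x | x ∈ S ∨ ∃ u v : S, ¬ P.Satisfied ε R.spanningCoe u v ∧ x ∈ (P.path u v).support}

/-- Subset-lightness of `X`: its weight divided by that of a minimum Steiner tree on the extended
terminal set. In `ℝ≥0∞`, `a / 0 = ⊤` for `a ≠ 0` and `0 / 0 = 0`. -/
def PathSystem.subsetLightness [Fintype V] (P : PathSystem G w S) (ε : ℝ≥0) (R : G.Subgraph)
    (X : SimpleGraph V) : ℝ≥0∞ :=
  (edgeWeight w X.edgeSet : ℝ≥0∞) / minSteinerWeight w G (P.extendedTerminals ε R)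

end Graphs

/-! ## The greedy construction -/

/-- One step of the greedy loop: if the pair is not yet satisfied, add its shortest path. -/
def greedyStep {V : Type*} {G : SimpleGraph V} {w : Sym2 V → ℝ≥0} {S : Finset V}
    (P : PathSystem G w S) (ε : ℝ≥0) (X : SimpleGraph V) (uv : S × S) : SimpleGraph V :=
  open Classical in
  if P.Satisfied ε X uv.1 uv.2 then X else X ⊔ walkGraph (P.path uv.1 uv.2)

/-- A run of the greedy construction, recorded by the choices that it makes: the shortest paths,
the `ρ`-approximate Steiner trees `R` and `T`, the Steiner tree `H` with `R ⊆ H ⊆ R ∪ T`, a lightest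
edge at each extended terminal, and an order of the pairs of terminals by nondecreasing `W`. -/
structure GreedyRun {V : Type*} [Fintype V] (ρ ε : ℝ≥0) (G : SimpleGraph V) (w : Sym2 V → ℝ≥0)
    (S : Finset V) where
  P : PathSystem G w S
  R : G.Subgraph
  R_steiner : IsApproxSteinerTree ρ w G S R
  T : G.Subgraph
  T_steiner : IsApproxSteinerTree ρ w G (P.extendedTerminals ε R) T
  H : G.Subgraph
  H_steiner : IsSteinerTree G (P.extendedTerminals ε R) H
  R_le_H : R ≤ H
  H_le_union : H ≤ R ⊔ T
  nbr : V → V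
  nbr_lightest : ∀ v ∈ P.extendedTerminals ε R, ∀ x, G.Adj v x →
    G.Adj v (nbr v) ∧ w s(v, nbr v) ≤ w s(v, x)
  order : List (S × S)
  order_nodup : order.Nodup
  order_complete : ∀ uv, uv ∈ order
  order_sorted : order.Pairwise fun a b => P.W a.1 a.2 ≤ P.W b.1 b.2

namespace GreedyRun

variable {V : Type*} [Fintype V] {ρ ε : ℝ≥0} {G : SimpleGraph V} {w : Sym2 V → ℝ≥0}
  {S : Finset V}

/-- The chosen lightest edges at the extended terminals whose weight is less than one unit after
scaling all weights by `|V_H| / weight(H)`. -/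
def lightEdges (run : GreedyRun ρ ε G w S) : Set (Sym2 V) :=
  {e | e ∈ G.edgeSet ∧ (∃ v ∈ run.P.extendedTerminals ε run.R, e = s(v, run.nbr v)) ∧
    w e * (run.H.verts.ncard : ℝ≥0) < edgeWeight w run.H.edgeSet}

/-- The initial graph: the Steiner tree `H` together with the light edges. -/
def initial (run : GreedyRun ρ ε G w S) : SimpleGraph V :=
  run.H.spanningCoe ⊔ SimpleGraph.fromEdgeSet run.lightEdges

/-- The result of the construction. -/
def spanner (run : GreedyRun ρ ε G w S) : SimpleGraph V :=
  run.order.foldl (greedyStep run.P ε) run.initial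

end GreedyRun

/-! ## Programs with a step count

A deterministic structured random access machine with unit costs. It has two-dimensional arrays of
natural numbers and two-dimensional arrays of nonnegative reals (the scalar variable `a` is the cell
`a[0,0]`). On naturals it can add, subtract (truncated) and compare. Reals cannot influence the
naturals except through comparisons, and the only operations on them are addition, multiplication by
the parameter `ε`, and comparison. The only loops are counted loops. -/

/-- Memory: `nat a i j` and `real a i j` are the cells `a[i,j]` of the arrays with number `a`. -/
structure Mem where
  nat : ℕ → ℕ → ℕ → ℕ
  real : ℕ → ℕ → ℕ → ℝ≥0

def Mem.setNat (σ : Mem) (a i j k : ℕ) : Mem where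
  nat := fun a' i' j' => if a' = a ∧ i' = i ∧ j' = j then k else σ.nat a' i' j'
  real := σ.real

def Mem.setReal (σ : Mem) (a i j : ℕ) (x : ℝ≥0) : Mem where
  nat := σ.nat
  real := fun a' i' j' => if a' = a ∧ i' = i ∧ j' = j then x else σ.real a' i' j'

/-- Expressions for natural numbers. -/
inductive NExp where
  | const (k : ℕ)
  | get (a : ℕ) (i j : NExp)
  | add (e f : NExp)
  | sub (e f : NExp)

/-- Expressions for reals; `scale e` is `ε * e`. -/
inductive RExp where
  | zero
  | get (a : ℕ) (i j : NExp)
  | add (e f : RExp)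
  | scale (e : RExp)

/-- Conditions. -/
inductive BExp where
  | natLe (e f : NExp)
  | realLe (e f : RExp)
  | not (b : BExp)
  | and (b c : BExp)

/-- Programs. -/
inductive Prog where
  | skip
  | setNat (a : ℕ) (i j : NExp) (e : NExp)
  | setReal (a : ℕ) (i j : NExp) (e : RExp)
  | seq (p q : Prog)
  | ite (b : BExp) (p q : Prog)
  | loop (a : ℕ) (bound : NExp) (body : Prog)

def NExp.eval (σ : Mem) : NExp → ℕ
  | const k => k
  | get a i j => σ.nat a (i.eval σ) (j.eval σ)
  | add e f => e.eval σ + f.eval σ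
  | sub e f => e.eval σ - f.eval σ

def RExp.eval (ε : ℝ≥0) (σ : Mem) : RExp → ℝ≥0
  | zero => 0
  | get a i j => σ.real a (i.eval σ) (j.eval σ)
  | add e f => e.eval ε σ + f.eval ε σ
  | scale e => ε * e.eval ε σ

def BExp.eval (ε : ℝ≥0) (σ : Mem) : BExp → Prop
  | natLe e f => e.eval σ ≤ f.eval σ
  | realLe e f => e.eval ε σ ≤ f.eval ε σ
  | not b => ¬ b.eval ε σ
  | and b c => b.eval ε σ ∧ c.eval ε σ

/-- The cost of evaluating an expression is its number of operations. -/
def NExp.cost : NExp → ℕ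
  | const _ => 1
  | get _ i j => i.cost + j.cost + 1
  | add e f => e.cost + f.cost + 1
  | sub e f => e.cost + f.cost + 1

def RExp.cost : RExp → ℕ
  | zero => 1
  | get _ i j => i.cost + j.cost + 1
  | add e f => e.cost + f.cost + 1
  | scale e => e.cost + 1

def BExp.cost : BExp → ℕ
  | natLe e f => e.cost + f.cost + 1
  | realLe e f => e.cost + f.cost + 1
  | not b => b.cost + 1
  | and b c => b.cost + c.cost + 1

/-- Execution of a program: the final memory and the number of steps. The program `loop a m p`
evaluates `m` once and then executes `p` with `a[0,0]` set to `0, 1, …, m - 1` in turn. -/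
def Prog.exec (ε : ℝ≥0) : Prog → Mem → Mem × ℕ
  | skip, σ => (σ, 1)
  | setNat a i j e, σ =>
      (σ.setNat a (i.eval σ) (j.eval σ) (e.eval σ), i.cost + j.cost + e.cost + 1)
  | setReal a i j e, σ =>
      (σ.setReal a (i.eval σ) (j.eval σ) (e.eval ε σ), i.cost + j.cost + e.cost + 1)
  | seq p q, σ =>
      let r := p.exec ε σ
      let r' := q.exec ε r.1
      (r'.1, r.2 + r'.2 + 1)
  | ite b p q, σ =>
      open Classical in
      let r := if b.eval ε σ then p.exec ε σ else q.exec ε σ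
      (r.1, b.cost + r.2 + 1)
  | loop a m p, σ =>
      (List.range (m.eval σ)).foldl
        (fun r i =>
          let r' := p.exec ε (r.1.setNat a 0 0 i)
          (r'.1, r.2 + r'.2 + 1))
        (σ, m.cost + 1)

open Classical in
/-- The initial memory for the instance `(G, w, S)` on the vertices `0, …, n - 1`: the number of
vertices is in array `0`, the adjacency matrix in array `1`, the indicator of `S` in array `2`, and
the edge weights in the array `0` of reals. All other cells are `0`. -/
def inputMem {n : ℕ} (G : SimpleGraph (Fin n)) (w : Sym2 (Fin n) → ℝ≥0) (S : Finset (Fin n)) :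
    Mem where
  nat := fun a i j =>
    if a = 0 ∧ i = 0 ∧ j = 0 then n
    else if a = 1 ∧ ∃ (hi : i < n) (hj : j < n), G.Adj ⟨i, hi⟩ ⟨j, hj⟩ then 1
    else if a = 2 ∧ j = 0 ∧ ∃ hi : i < n, (⟨i, hi⟩ : Fin n) ∈ S then 1
    else 0
  real := fun a i j =>
    if h : a = 0 ∧ ∃ (hi : i < n) (hj : j < n), G.Adj ⟨i, hi⟩ ⟨j, hj⟩ then
      w s(⟨i, h.2.1⟩, ⟨j, h.2.2.1⟩)
    else 0

open Classical in
/-- The array `3` of naturals holds the adjacency matrix of `X`. -/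
def IsOutput {n : ℕ} (σ : Mem) (X : SimpleGraph (Fin n)) : Prop :=
  ∀ i j : Fin n, σ.nat 3 i j = if X.Adj i j then 1 else 0

end SubsetSpanner

end

open scoped NNReal ENNReal

noncomputable section

namespace SubsetSpanner


/-! ### Walk weights and weighted distances. -/

section Distances

variable {V : Type*} {w : Sym2 V → ℝ≥0} {G X Y : SimpleGraph V} {u v x y : V}

/-! The lightness bound charges the added paths to the tree `H`. Give every vertex as mass the total
weight of the edges of `H` at it. Suppose that the path of the pair u, v is added, and put M =
W(u,v), r = εM/8, θ = εM/4. Since edges of the path weigh at most M, one can choose vertices on it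
whose distances to v differ pairwise by more than 2r, about one per stretch of length M + 2r. Their
balls of radius r in `H` are disjoint, and each has mass at least r because the tree leaves it (if
one ball swallows the tree, the path weighs no more than the tree anyway). Hence the path weighs at
most (M + 2r)/r = 8/ε + 2 times the mass of the set N of vertices within r of it in `H`: this is
`walkWeight_le_mass_near`.

Call a terminal s and a vertex z close if their distance in the current graph exceeds the one in G
by at most θ. For z in N, both (u,z) and (v,z) are close once the path is present. They were not
both close before, as otherwise d_X(u,v) ≤ d_G(u,v) + 3θ and the pair would have been satisfied. So
the total mass of close pairs, `closeMass`, grows by at least the mass of N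
(`edgeWeight_sup_walkGraph_le`). Treating pairs by nondecreasing W makes θ nondecreasing, so moving
to the next pair never lowers this potential, and it is at most 2|S| w(H). All added paths together
therefore weigh at most (8/ε + 2)·2|S| w(H). The tree and the light edges weigh at most 2 w(H), and
w(H) is at most 2ρ times the minimum Steiner weight for S'.

For the algorithm, both Steiner trees come from one procedure: attach the nearest missing terminal
along a shortest path. Its invariant `CompletesWithin` says that the current tree, together with
some links of the metric closure that connect the missing terminals to it, stays within a fixed
budget. Grown from a single terminal this gives R with factor 2; continued from R it gives H with
factor 4, and T = H is admissible. Shortest paths come from Dijkstra's algorithm, whose parent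
pointers also fix the path system. Correctness is proved by loop invariants, together with a
syntactic account of which arrays a program writes. The time bound holds because every loop runs
over the vertices. -/

@[simp] lemma walkWeight_nil : walkWeight w (SimpleGraph.Walk.nil : G.Walk u u) = 0 := rfl

@[simp] lemma walkWeight_cons (h : G.Adj u v) (q : G.Walk v x) :
    walkWeight w (.cons h q) = w s(u, v) + walkWeight w q := by
  simp [walkWeight]

lemma walkWeight_append (p : G.Walk u v) (q : G.Walk v x) :
    walkWeight w (p.append q) = walkWeight w p + walkWeight w q := by
  simp [walkWeight, SimpleGraph.Walk.edges_append]

lemma walkWeight_reverse (p : G.Walk u v) : walkWeight w p.reverse = walkWeight w p := by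
  simp [walkWeight, SimpleGraph.Walk.edges_reverse, List.map_reverse, List.sum_reverse]

lemma walkMax_reverse (p : G.Walk u v) : walkMax w p.reverse = walkMax w p := by
  classical
  simp [walkMax, SimpleGraph.Walk.edges_reverse]

@[simp] lemma walkMax_nil : walkMax w (SimpleGraph.Walk.nil : G.Walk u u) = 0 := by
  simp [walkMax]

lemma walkMax_cons (h : G.Adj u v) (q : G.Walk v x) :
    walkMax w (.cons h q) = max (w s(u, v)) (walkMax w q) := by
  classical
  simp [walkMax]

lemma le_walkMax (p : G.Walk u v) {e : Sym2 V} (he : e ∈ p.edges) : w e ≤ walkMax w p := by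
  classical
  exact Finset.le_sup (f := w) (List.mem_toFinset.2 he)

lemma walkWeight_mapLe (h : X ≤ Y) (p : X.Walk u v) :
    walkWeight w (p.mapLe h) = walkWeight w p := by
  induction p with
  | nil => rfl
  | cons hx q ih => simpa [SimpleGraph.Walk.mapLe] using ih

lemma wdist_le_walk (p : X.Walk u v) : wdist w X u v ≤ walkWeight w p := iInf_le _ p

lemma wdist_mono (h : X ≤ Y) : wdist w Y u v ≤ wdist w X u v :=
  le_iInf fun p => by simpa [walkWeight_mapLe] using wdist_le_walk (w := w) (p.mapLe h)

@[simp] lemma wdist_self : wdist w X u u = 0 :=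
  le_antisymm (by simpa using wdist_le_walk (w := w) (SimpleGraph.Walk.nil : X.Walk u u)) bot_le

lemma wdist_comm_le : wdist w X u v ≤ wdist w X v u :=
  le_iInf fun p => by simpa [walkWeight_reverse] using wdist_le_walk (w := w) p.reverse

lemma wdist_comm : wdist w X u v = wdist w X v u := le_antisymm wdist_comm_le wdist_comm_le

lemma wdist_triangle : wdist w X u x ≤ wdist w X u v + wdist w X v x := by
  unfold wdist
  refine ENNReal.le_iInf_add_iInf fun p q => ?_
  rw [← ENNReal.coe_add, ← walkWeight_append]
  exact wdist_le_walk (w := w) (p.append q)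

lemma wdist_ne_top (h : X.Reachable u v) : wdist w X u v ≠ ⊤ :=
  ((wdist_le_walk (w := w) h.some).trans_lt ENNReal.coe_lt_top).ne

lemma wdist_le_of_adj (h : X.Adj u v) : wdist w X u v ≤ w s(u, v) := by
  simpa using wdist_le_walk (w := w) (SimpleGraph.Walk.cons h .nil)

lemma IsShortestPath.coe_walkWeight {q : G.Walk u v} (hq : IsShortestPath w q) :
    (walkWeight w q : ℝ≥0∞) = wdist w G u v :=
  le_antisymm (le_iInf fun p => by exact_mod_cast hq.2 p) (wdist_le_walk q)

lemma IsShortestPath.reverse {q : G.Walk u v} (hq : IsShortestPath w q) :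
    IsShortestPath w q.reverse :=
  ⟨hq.1.reverse, fun p => by
    rw [walkWeight_reverse, ← walkWeight_reverse p]; exact hq.2 _⟩

lemma wdist_le_of_mem_support (p : X.Walk u v) (hx : x ∈ p.support) :
    wdist w X u x + wdist w X x v ≤ walkWeight w p := by
  classical
  rw [← p.take_spec hx, walkWeight_append, ENNReal.coe_add]
  exact add_le_add (wdist_le_walk _) (wdist_le_walk _)

lemma walkWeight_transfer (p : X.Walk u v) (h : ∀ e ∈ p.edges, e ∈ Y.edgeSet) :
    walkWeight w (p.transfer Y h) = walkWeight w p := by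
  simp [walkWeight, SimpleGraph.Walk.edges_transfer]

lemma walkGraph_le (p : G.Walk u v) : walkGraph p ≤ G := by
  rw [walkGraph, SimpleGraph.fromEdgeSet_le]
  exact fun e he => p.edges_subset_edgeSet he.1

lemma mem_edgeSet_walkGraph (p : G.Walk u v) {e : Sym2 V} :
    e ∈ (walkGraph p).edgeSet ↔ e ∈ p.edges := by
  simp only [walkGraph, SimpleGraph.edgeSet_fromEdgeSet, Set.mem_sdiff, Set.mem_ofPred_eq]
  exact ⟨fun h => h.1, fun h => ⟨h, G.not_isDiag_of_mem_edgeSet (p.edges_subset_edgeSet h)⟩⟩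

lemma wdist_le_of_walkGraph_le (p : G.Walk u v) (h : walkGraph p ≤ X) :
    wdist w X u v ≤ walkWeight w p := by
  rw [← walkWeight_transfer (Y := X) p fun e he =>
    SimpleGraph.edgeSet_mono h ((mem_edgeSet_walkGraph p).2 he)]
  exact wdist_le_walk _

/-- Along a walk whose edges lie in `X`, splitting at a vertex of the walk. -/
lemma wdist_split_of_walkGraph_le (p : G.Walk u v) (h : walkGraph p ≤ X) (hx : x ∈ p.support) :
    wdist w X u x + wdist w X x v ≤ walkWeight w p := by
  have hp : ∀ e ∈ p.edges, e ∈ X.edgeSet := fun e he =>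
    SimpleGraph.edgeSet_mono h ((mem_edgeSet_walkGraph p).2 he)
  rw [← walkWeight_transfer (Y := X) p hp]
  exact wdist_le_of_mem_support _ (by simpa [SimpleGraph.Walk.support_transfer] using hx)

end Distances

/-! ### Total weight of edge sets. -/

section EdgeWeight

variable {V : Type*} [Fintype V] {w : Sym2 V → ℝ≥0} {G X Y : SimpleGraph V} {u v x y : V}

lemma edgeWeight_mono {E F : Set (Sym2 V)} (h : E ⊆ F) : edgeWeight w E ≤ edgeWeight w F := by
  classical
  exact Finset.sum_le_sum_of_subset fun e he => by
    simp only [Finset.mem_filter, Finset.mem_univ, true_and] at he ⊢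
    exact h he

lemma edgeWeight_union_le (E F : Set (Sym2 V)) :
    edgeWeight w (E ∪ F) ≤ edgeWeight w E + edgeWeight w F := by
  classical
  unfold edgeWeight
  rw [← Finset.sum_union_inter]
  refine le_trans (Finset.sum_le_sum_of_subset ?_) le_self_add
  intro e he
  simpa using he

lemma edgeWeight_eq_list_sum {l : List (Sym2 V)} (h : l.Nodup) :
    edgeWeight w {e | e ∈ l} = (l.map w).sum := by
  classical
  rw [← List.sum_toFinset _ h, edgeWeight]
  congr 1
  ext e; simp

lemma edgeWeight_list_le (l : List (Sym2 V)) :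
    edgeWeight w {e | e ∈ l} ≤ (l.map w).sum := by
  classical
  induction l with
  | nil => simp [edgeWeight]
  | cons a l ih =>
    have : {e | e ∈ a :: l} = ({a} : Set (Sym2 V)) ∪ {e | e ∈ l} := by ext; simp
    rw [this, List.map_cons, List.sum_cons]
    refine (edgeWeight_union_le _ _).trans (add_le_add ?_ ih)
    rw [edgeWeight, Finset.sum_filter]
    simp

lemma edgeWeight_walkGraph_le (p : G.Walk u v) :
    edgeWeight w (walkGraph p).edgeSet ≤ walkWeight w p := by
  refine le_trans (edgeWeight_mono ?_) (edgeWeight_list_le p.edges)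
  exact fun e he => (mem_edgeSet_walkGraph p).1 he

end EdgeWeight


/-! ### Separated vertices on a walk. -/

section Packing

variable {V : Type*} {w : Sym2 V → ℝ≥0} {G X Y : SimpleGraph V} {u v x y : V}

/-- The vertices of a walk contain a set whose positions are separated by more than `d`, and which
is large compared to the position of the start of the walk. -/
lemma exists_separated_subset (pos : V → ℝ≥0) (M d : ℝ≥0) (q : G.Walk x v) (hv : pos v = 0)
    (hM : ∀ y z, s(y, z) ∈ q.edges → pos y ≤ pos z + M) :
    ∃ A : Finset V, (∀ a ∈ A, a ∈ q.support) ∧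
      (∀ a ∈ A, ∀ b ∈ A, a ≠ b → pos a + d < pos b ∨ pos b + d < pos a) ∧
      pos x ≤ A.card * (M + d) := by
  classical
  -- The induction goes backwards from the end of the walk and remembers the element `a` of largest
  -- position. A vertex joins only when it lies beyond `pos a + d`, and then by at most `M`, so each
  -- new element accounts for `M + d`. The last clause is `pos a ≤ (A.card - 1) * (M + d)`, written
  -- without subtraction.
  suffices H : ∃ A : Finset V, ∃ a ∈ A, (∀ a ∈ A, a ∈ q.support) ∧
      (∀ a ∈ A, ∀ b ∈ A, a ≠ b → pos a + d < pos b ∨ pos b + d < pos a) ∧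
      (∀ b ∈ A, pos b ≤ pos a) ∧ pos x ≤ pos a + d ∧ pos a + M + d ≤ A.card * (M + d) by
    obtain ⟨A, a, -, h1, h2, -, h4, h5⟩ := H
    refine ⟨A, h1, h2, h4.trans (le_trans ?_ h5)⟩
    gcongr
    exact le_self_add
  induction q with
  | @nil v =>
    refine ⟨{v}, v, Finset.mem_singleton_self v, by simp, ?_, by simp, le_self_add, by simp [hv]⟩
    intro a ha b hb hab
    simp_all
  | @cons y x v h q ih =>
    obtain ⟨A, a, haA, hsub, hsep, hmax, hx, hcard⟩ := ih hv fun y z hyz => hM y z (by simp [hyz])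
    have hyx := hM y x (by simp)
    by_cases hy : pos y ≤ pos a + d
    · exact ⟨A, a, haA, fun b hb => by simp [hsub b hb], hsep, hmax, hy, hcard⟩
    · push Not at hy
      have hyA : y ∉ A := fun hyA => by
        have := (hmax y hyA).trans_lt (le_self_add.trans_lt hy)
        exact lt_irrefl _ this
      refine ⟨insert y A, y, by simp, ?_, ?_, ?_, le_self_add, ?_⟩
      · intro b hb
        rcases Finset.mem_insert.1 hb with rfl | hb
        · simp
        · simp [hsub b hb]
      · have key : ∀ b ∈ A, pos b + d < pos y := fun b hb => by
          refine lt_of_le_of_lt ?_ hy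
          gcongr
          exact hmax b hb
        intro b hb c hc hbc
        rcases Finset.mem_insert.1 hb with hb' | hb' <;>
          rcases Finset.mem_insert.1 hc with hc' | hc'
        · exact absurd (hb'.trans hc'.symm) hbc
        · exact Or.inr (hb' ▸ key c hc')
        · exact Or.inl (hc' ▸ key b hb')
        · exact hsep b hb' c hc' hbc
      · intro b hb
        rcases Finset.mem_insert.1 hb with rfl | hb
        · exact le_rfl
        · exact (hmax b hb).trans (le_self_add.trans hy.le)
      · rw [Finset.card_insert_of_notMem hyA]
        push_cast
        calc pos y + M + d ≤ (pos a + d + M) + M + d := by gcongr; exact hyx.trans (by gcongr)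
          _ = (pos a + M + d) + (M + d) := by ring
          _ ≤ A.card * (M + d) + (M + d) := by gcongr
          _ = _ := by ring

end Packing

/-! ### Vertex masses and the mass of balls. -/

section Mass

variable {V : Type*} [Fintype V] {w : Sym2 V → ℝ≥0} {X : SimpleGraph V}

open Classical in
/-- The total weight of the edges of `X` at the vertex `z`. -/
def vertexMass (w : Sym2 V → ℝ≥0) (X : SimpleGraph V) (z : V) : ℝ≥0 :=
  ∑ e : Sym2 V with e ∈ X.edgeSet ∧ z ∈ e, w e

/-- An edge is counted at most at its two ends. -/
lemma sum_vertexMass_le (A : Finset V) :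
    ∑ z ∈ A, vertexMass w X z ≤ 2 * edgeWeight w X.edgeSet := by
  classical
  have : ∀ z, vertexMass w X z = ∑ e : Sym2 V with e ∈ X.edgeSet, if z ∈ e then w e else 0 := by
    intro z
    rw [vertexMass, ← Finset.sum_filter, Finset.filter_filter]
  simp_rw [this]
  rw [Finset.sum_comm, edgeWeight, Finset.mul_sum]
  refine (Finset.sum_congr (by ext; simp) fun _ _ => rfl).trans_le
    (Finset.sum_le_sum (f := fun e => ∑ x ∈ A, if x ∈ e then w e else 0) fun e _ => ?_)
  rw [← Finset.sum_filter, Finset.sum_const, nsmul_eq_mul]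
  refine mul_le_mul' ?_ le_rfl
  have : (A.filter (· ∈ e)) ⊆ e.toFinset := fun z hz => by simpa using (Finset.mem_filter.1 hz).2
  exact_mod_cast (Finset.card_le_card this).trans (by
    rw [Sym2.card_toFinset]; split_ifs <;> simp)

lemma edgeWeight_touching_le (A : Finset V) :
    edgeWeight w {e | e ∈ X.edgeSet ∧ ∃ z ∈ A, z ∈ e} ≤ ∑ z ∈ A, vertexMass w X z := by
  classical
  have : edgeWeight w {e | e ∈ X.edgeSet ∧ ∃ z ∈ A, z ∈ e} =
      ∑ e ∈ A.biUnion fun z => Finset.univ.filter fun e => e ∈ X.edgeSet ∧ z ∈ e, w e := by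
    rw [edgeWeight]
    congr 1
    ext e
    simp only [Finset.mem_filter, Finset.mem_univ, true_and, Finset.mem_biUnion, Set.mem_ofPred_eq]
    tauto
  rw [this]
  clear this
  induction A using Finset.induction_on with
  | empty => simp
  | insert a A ha ih =>
    rw [Finset.biUnion_insert, Finset.sum_insert ha]
    refine le_trans ?_ (add_le_add (le_refl (vertexMass w X a)) ih)
    rw [vertexMass, ← Finset.sum_union_inter]
    exact le_self_add

open Classical in
/-- The vertices within distance `r` of `a` in `X`. -/
def distBall (w : Sym2 V → ℝ≥0) (X : SimpleGraph V) (r : ℝ≥0) (a : V) : Finset V :=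
  Finset.univ.filter fun z => wdist w X a z ≤ r

lemma mem_distBall {r : ℝ≥0} {a z : V} : z ∈ distBall w X r a ↔ wdist w X a z ≤ r := by
  simp [distBall]

/-- A ball that does not contain all of the component of its center has large mass. -/
lemma le_mass_distBall {r : ℝ≥0} {a y : V} (hy : X.Reachable a y) (hya : y ∉ distBall w X r a) :
    r ≤ ∑ z ∈ distBall w X r a, vertexMass w X z := by
  classical
  set B := distBall w X r a with hB
  refine le_trans ?_ (edgeWeight_touching_le B)
  -- The distance from `a`, truncated at `r`, rises from `0` at `a` to `r` at `y`. Across an edge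
  -- with both ends outside the ball it is constant, so the edges touching the ball, whose weights
  -- `c` keeps, pay for the whole rise.
  let c : Sym2 V → ℝ≥0 := fun e => if ∃ z ∈ B, z ∈ e then w e else 0
  let g : V → ℝ≥0∞ := fun z => min (wdist w X a z) r
  have key : ∀ {x y : V} (q : X.Walk x y), g y ≤ g x + (q.edges.map c).sum := by
    intro x y q
    induction q with
    | nil => simp
    | @cons x z y h q ih =>
      refine ih.trans ?_
      rw [SimpleGraph.Walk.edges_cons, List.map_cons, List.sum_cons, ENNReal.coe_add, ← add_assoc]
      gcongr
      by_cases hc : ∃ b ∈ B, b ∈ s(x, z)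
      · simp only [c, if_pos hc, g]
        rw [min_add]
        refine le_min ?_ ((min_le_right _ _).trans le_self_add)
        refine (min_le_left _ _).trans ((wdist_triangle (v := x)).trans ?_)
        gcongr
        exact wdist_le_of_adj h
      · simp only [c, if_neg hc]
        have hx : x ∉ B := fun hx => hc ⟨x, hx, by simp⟩
        have hz : z ∉ B := fun hx => hc ⟨z, hx, by simp⟩
        rw [hB, mem_distBall, not_le] at hx hz
        simp [g, min_eq_right hx.le]
  -- A path repeats no edge, so its list sum of `c` is bounded by the weight of a set of edges.
  let q := hy.some.toPath
  have h1 := key (q : X.Walk a y)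
  have hga : g a = 0 := by simp [g]
  rw [mem_distBall, not_le] at hya
  have hgy : g y = r := min_eq_right hya.le
  rw [hga, hgy, zero_add, ENNReal.coe_le_coe] at h1
  refine h1.trans ?_
  rw [← List.sum_toFinset _ q.2.isTrail.edges_nodup, edgeWeight]
  simp only [c]
  rw [← Finset.sum_filter]
  refine Finset.sum_le_sum_of_subset fun e he => ?_
  simp only [Finset.mem_filter, List.mem_toFinset, Finset.mem_univ, true_and] at he ⊢
  exact ⟨(q : X.Walk a y).edges_subset_edgeSet he.1, he.2⟩

open Classical in
/-- The vertices of a connected part of `X` near a walk of `G` have large mass. -/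
lemma walkWeight_le_mass_near {G : SimpleGraph V} (hX : X ≤ G) {u v : V} {q : G.Walk u v}
    (hq : IsShortestPath w q) {K : Finset V} (hK : ∀ a ∈ K, ∀ b ∈ K, X.Reachable a b)
    (hXK : ∀ a b, X.Adj a b → a ∈ K)
    (hqK : ∀ a ∈ q.support, a ∈ K) {r M C : ℝ≥0} (hM : walkMax w q ≤ M) (hC : 1 ≤ C)
    (hrC : M + 2 * r ≤ C * r) :
    walkWeight w q ≤
      C * ∑ z ∈ Finset.univ.filter (fun z => ∃ a ∈ q.support, wdist w X a z ≤ r), vertexMass w X z := by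
  set N := Finset.univ.filter (fun z => ∃ a ∈ q.support, wdist w X a z ≤ r) with hN
  have huK := hqK u q.start_mem_support
  have hvK := hqK v q.end_mem_support
  have hGr : ∀ a ∈ K, ∀ b ∈ K, wdist w G a b ≠ ⊤ := fun a ha b hb =>
    wdist_ne_top ((hK a ha b hb).mono hX)
  -- A ball that contains all of `K` may have mass less than `r`. But then `N` contains `K` and thus
  -- sees every edge of `X`, and `q`, being shortest, weighs at most a path in `X`.
  by_cases hfull : ∃ a ∈ q.support, ∀ z ∈ K, wdist w X a z ≤ r
  · obtain ⟨a, ha, hall⟩ := hfull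
    have hNK : K ⊆ N := fun z hz => Finset.mem_filter.2 ⟨Finset.mem_univ z, a, ha, hall z hz⟩
    have h1 : walkWeight w q ≤ edgeWeight w {e | e ∈ X.edgeSet ∧ ∃ z ∈ K, z ∈ e} := by
      let p := (hK u huK v hvK).some.toPath
      refine (hq.2 ((p : X.Walk u v).mapLe hX)).trans ?_
      rw [walkWeight_mapLe, walkWeight, ← edgeWeight_eq_list_sum p.2.isTrail.edges_nodup]
      refine edgeWeight_mono fun e he => ⟨(p : X.Walk u v).edges_subset_edgeSet he, ?_⟩
      induction e with | _ x y =>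
      exact ⟨x, hXK x y ((p : X.Walk u v).adj_of_mem_edges he), by simp⟩
    refine h1.trans ((edgeWeight_touching_le K).trans ?_)
    refine (Finset.sum_le_sum_of_subset hNK).trans ?_
    exact le_mul_of_one_le_left zero_le hC
  · push Not at hfull
    let pos : V → ℝ≥0 := fun z => (wdist w G z v).toNNReal
    have hpos : ∀ z ∈ K, (pos z : ℝ≥0∞) = wdist w G z v := fun z hz =>
      ENNReal.coe_toNNReal (hGr z hz v hvK)
    obtain ⟨A, hA, hsep, hcard⟩ := exists_separated_subset pos M (2 * r) q (by simp [pos]) (by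
      intro y z hyz
      have hy := hqK y (q.fst_mem_support_of_mem_edges hyz)
      have hz := hqK z (q.snd_mem_support_of_mem_edges hyz)
      rw [← ENNReal.coe_le_coe, ENNReal.coe_add, hpos y hy, hpos z hz, add_comm]
      refine (wdist_triangle (v := z)).trans ?_
      gcongr
      refine (wdist_le_of_adj (q.adj_of_mem_edges hyz)).trans ?_
      exact_mod_cast (le_walkMax q hyz).trans hM)
    -- A common point of two balls would put their centers within `2 * r` in `G`, so their positions
    -- would differ by at most `2 * r`.
    have hdisj : (A : Set V).PairwiseDisjoint (fun a => distBall w X r a) := by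
      intro a ha b hb hab
      rw [Function.onFun, Finset.disjoint_left]
      intro z hza hzb
      rw [mem_distBall] at hza hzb
      have haK := hqK a (hA a ha)
      have hbK := hqK b (hA b hb)
      have key : wdist w G a b ≤ (2 * r : ℝ≥0) := by
        refine (wdist_mono hX).trans ((wdist_triangle (v := z)).trans ?_)
        rw [wdist_comm (u := z), two_mul, ENNReal.coe_add]
        exact add_le_add hza hzb
      have hle : ∀ a b, a ∈ K → b ∈ K → wdist w G a b ≤ (2 * r : ℝ≥0) →
          pos a ≤ pos b + 2 * r := by
        intro a b ha hb hab
        rw [← ENNReal.coe_le_coe, ENNReal.coe_add, hpos a ha, hpos b hb, add_comm]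
        exact wdist_triangle.trans (by gcongr)
      rcases hsep a ha b hb hab with h | h
      · exact absurd (hle b a hbK haK (by rwa [wdist_comm])) (not_le.2 h)
      · exact absurd (hle a b haK hbK key) (not_le.2 h)
    have hposu : walkWeight w q = pos u := by
      rw [← ENNReal.coe_inj, hpos u huK, hq.coe_walkWeight]
    have hmass : ∀ a ∈ A, r ≤ ∑ z ∈ distBall w X r a, vertexMass w X z := by
      intro a ha
      obtain ⟨y, hyK, hy⟩ := hfull a (hA a ha)
      exact le_mass_distBall (hK a (hqK a (hA a ha)) y hyK) (by rwa [mem_distBall, not_le])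
    calc walkWeight w q ≤ A.card * (M + 2 * r) := hposu ▸ hcard
      _ ≤ A.card * (C * r) := by gcongr
      _ = C * ∑ a ∈ A, r := by rw [Finset.sum_const, nsmul_eq_mul]; ring
      _ ≤ C * ∑ a ∈ A, ∑ z ∈ distBall w X r a, vertexMass w X z := by
        gcongr with a ha
        exact hmass a ha
      _ = C * ∑ z ∈ A.biUnion (fun a => distBall w X r a), vertexMass w X z := by
        rw [Finset.sum_biUnion hdisj]
      _ ≤ _ := by
        gcongr
        intro z hz
        rw [Finset.mem_biUnion] at hz
        obtain ⟨a, ha, hz⟩ := hz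
        rw [mem_distBall] at hz
        exact Finset.mem_filter.2 ⟨Finset.mem_univ z, a, hA a ha, hz⟩

end Mass


/-! ### The greedy step and the potential of close pairs. -/

section Greedy

variable {V : Type*} {w : Sym2 V → ℝ≥0} {G X Y : SimpleGraph V} {S : Finset V}

lemma PathSystem.Satisfied.mono {P : PathSystem G w S} {ε : ℝ≥0} {u v : S}
    (h : P.Satisfied ε X u v) (hXY : X ≤ Y) : P.Satisfied ε Y u v :=
  (wdist_mono hXY).trans h

lemma le_greedyStep (P : PathSystem G w S) (ε : ℝ≥0) (X : SimpleGraph V) (p : S × S) :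
    X ≤ greedyStep P ε X p := by
  unfold greedyStep
  split_ifs
  · exact le_rfl
  · exact le_sup_left

lemma greedyStep_le {P : PathSystem G w S} {ε : ℝ≥0} {p : S × S} (hX : X ≤ G) :
    greedyStep P ε X p ≤ G := by
  unfold greedyStep
  split_ifs
  · exact hX
  · exact sup_le hX (walkGraph_le _)

lemma satisfied_greedyStep (P : PathSystem G w S) (ε : ℝ≥0) (X : SimpleGraph V) (p : S × S) :
    P.Satisfied ε (greedyStep P ε X p) p.1 p.2 := by
  unfold greedyStep
  split_ifs with h
  · exact h
  · refine (wdist_le_of_walkGraph_le _ le_sup_right).trans ?_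
    rw [(P.shortest p.1 p.2).coe_walkWeight]
    exact le_self_add

lemma le_foldl_greedyStep (P : PathSystem G w S) (ε : ℝ≥0) (l : List (S × S))
    (X : SimpleGraph V) : X ≤ l.foldl (greedyStep P ε) X := by
  induction l generalizing X with
  | nil => exact le_rfl
  | cons p l ih => exact (le_greedyStep P ε X p).trans (ih _)

lemma foldl_greedyStep_le {P : PathSystem G w S} {ε : ℝ≥0} (l : List (S × S)) (hX : X ≤ G) :
    l.foldl (greedyStep P ε) X ≤ G := by
  induction l generalizing X with
  | nil => exact hX
  | cons p l ih => exact ih (greedyStep_le hX)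

lemma satisfied_foldl_greedyStep (P : PathSystem G w S) (ε : ℝ≥0) (l : List (S × S))
    (X : SimpleGraph V) {p : S × S} (hp : p ∈ l) :
    P.Satisfied ε (l.foldl (greedyStep P ε) X) p.1 p.2 := by
  induction l generalizing X with
  | nil => simp at hp
  | cons a l ih =>
    rcases List.mem_cons.1 hp with rfl | hp
    · exact (satisfied_greedyStep P ε X p).mono (le_foldl_greedyStep P ε l _)
    · exact ih _ hp

variable [Fintype V]

open Classical in
/-- The pairs of a terminal and a vertex whose distance in `X` exceeds the distance in `G` by at
most `θ`. -/
def closePairs (w : Sym2 V → ℝ≥0) (G X : SimpleGraph V) (S : Finset V) (θ : ℝ≥0) :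
    Finset (S × V) :=
  Finset.univ.filter fun p => wdist w X p.1 p.2 ≤ wdist w G p.1 p.2 + θ

/-- The total mass of the close pairs, the potential of the analysis. -/
def closeMass (w : Sym2 V → ℝ≥0) (G X T : SimpleGraph V) (S : Finset V) (θ : ℝ≥0) : ℝ≥0 :=
  ∑ p ∈ closePairs w G X S θ, vertexMass w T p.2

variable {T : SimpleGraph V}

lemma mem_closePairs {θ : ℝ≥0} {p : S × V} :
    p ∈ closePairs w G X S θ ↔ wdist w X p.1 p.2 ≤ wdist w G p.1 p.2 + θ := by
  simp [closePairs]

lemma closeMass_mono {θ θ' : ℝ≥0} (h : θ ≤ θ') :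
    closeMass w G X T S θ ≤ closeMass w G X T S θ' := by
  refine Finset.sum_le_sum_of_subset fun p hp => ?_
  rw [mem_closePairs] at hp ⊢
  exact hp.trans (by gcongr)

lemma closeMass_le {θ : ℝ≥0} :
    closeMass w G X T S θ ≤ S.card * (2 * edgeWeight w T.edgeSet) := by
  refine (Finset.sum_le_univ_sum_of_nonneg fun p => zero_le).trans ?_
  rw [Fintype.sum_prod_type]
  simp only [Finset.sum_const, nsmul_eq_mul, Finset.card_univ, Fintype.card_coe]
  gcongr
  exact sum_vertexMass_le _

open Classical in
-- The amortized cost of adding one path: the weight is paid by the growth of the potential at the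
-- threshold of this very pair. Near the path every vertex gains at least one close pair, with `u`
-- or with `v`.
lemma edgeWeight_sup_walkGraph_le {P : PathSystem G w S} {ε : ℝ≥0} (hε : 0 < ε) (hT : T ≤ X)
    (hXG : X ≤ G) {K : Finset V} (hK : ∀ a ∈ K, ∀ b ∈ K, T.Reachable a b)
    (hTK : ∀ a b, T.Adj a b → a ∈ K) {u v : S} (hq : ∀ a ∈ (P.path u v).support, a ∈ K)
    (hu : ¬ P.Satisfied ε X u v) :
    edgeWeight w (X ⊔ walkGraph (P.path u v)).edgeSet +
        (8 / ε + 2) * closeMass w G X T S (ε * P.W u v / 4) ≤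
      edgeWeight w X.edgeSet + (8 / ε + 2) *
        closeMass w G (X ⊔ walkGraph (P.path u v)) T S (ε * P.W u v / 4) := by
  set q := P.path u v with hqdef
  set M := P.W u v with hM
  set r : ℝ≥0 := ε * M / 8 with hr
  set θ : ℝ≥0 := ε * M / 4 with hθ
  set X' := X ⊔ walkGraph q with hX'
  have hθr : θ = 2 * r := by rw [hθ, hr]; ring
  set N := Finset.univ.filter (fun z => ∃ a ∈ q.support, wdist w T a z ≤ r) with hN
  have hw : walkWeight w q ≤ (8 / ε + 2) * ∑ z ∈ N, vertexMass w T z := by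
    refine walkWeight_le_mass_near (hT.trans hXG) (P.shortest u v) hK hTK hq (M := M) le_rfl ?_ ?_
    · exact le_trans (by norm_num) (le_add_of_nonneg_left zero_le : (2 : ℝ≥0) ≤ 8 / ε + 2)
    -- With `r = ε * M / 8` one has `8 / ε * r = M`.
    · rw [add_mul]
      gcongr
      rw [hr]
      apply le_of_eq
      field_simp
  have hnear : ∀ z ∈ N, wdist w G u z + wdist w G z v ≤ wdist w G u v + θ ∧
      wdist w X' u z ≤ wdist w G u z + θ ∧ wdist w X' v z ≤ wdist w G v z + θ := by
    intro z hz
    obtain ⟨a, ha, haz⟩ := (Finset.mem_filter.1 hz).2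
    have hazG : wdist w G a z ≤ r := (wdist_mono (hT.trans hXG)).trans haz
    have hazX : wdist w X' a z ≤ r := (wdist_mono (hT.trans le_sup_left)).trans haz
    have hsplit : wdist w X' u a + wdist w X' a v ≤ wdist w G u v :=
      (wdist_split_of_walkGraph_le q le_sup_right ha).trans_eq (P.shortest u v).coe_walkWeight
    have hX'G : X' ≤ G := sup_le hXG (walkGraph_le q)
    have hne : wdist w G u v ≠ ⊤ := by
      rw [← (P.shortest u v).coe_walkWeight]; exact ENNReal.coe_ne_top
    -- The path in `X'` realizes the distance from `u` to `v` through `a`. Cancelling the finite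
    -- distance from `a` to `v` shows that its first part is also shortest in `G`.
    have hua : wdist w X' u a ≤ wdist w G u a := by
      have h1 : wdist w X' u a + wdist w X' a v ≤ wdist w G u a + wdist w X' a v :=
        hsplit.trans (wdist_triangle.trans (by gcongr; exact wdist_mono hX'G))
      have : wdist w X' a v ≠ ⊤ := ((le_add_self.trans hsplit).trans_lt hne.lt_top).ne
      exact (ENNReal.add_le_add_iff_right this).1 h1
    have hva : wdist w X' v a ≤ wdist w G v a := by
      have h1 : wdist w X' u a + wdist w X' a v ≤ wdist w X' u a + wdist w G a v :=
        hsplit.trans (wdist_triangle.trans (by gcongr; exact wdist_mono hX'G))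
      have : wdist w X' u a ≠ ⊤ := ((le_self_add.trans hsplit).trans_lt hne.lt_top).ne
      rw [wdist_comm (u := (v : V)), wdist_comm (u := (v : V))]
      exact (ENNReal.add_le_add_iff_left this).1 h1
    have hfar : ∀ x, wdist w X' x a ≤ wdist w G x a → wdist w X' x z ≤ wdist w G x z + θ := by
      intro x hx
      calc wdist w X' x z ≤ wdist w X' x a + wdist w X' a z := wdist_triangle
        _ ≤ wdist w G x a + r := by gcongr
        _ ≤ (wdist w G x z + wdist w G z a) + r := by gcongr; exact wdist_triangle
        _ ≤ (wdist w G x z + r) + r := by gcongr; rwa [wdist_comm]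
        _ = _ := by rw [hθr, add_assoc, two_mul, ENNReal.coe_add]
    refine ⟨?_, hfar u hua, hfar v hva⟩
    calc wdist w G u z + wdist w G z v
        ≤ (wdist w G u a + wdist w G a z) + (wdist w G z a + wdist w G a v) := by
          gcongr <;> exact wdist_triangle
      _ ≤ (wdist w X' u a + r) + (r + wdist w X' a v) := by
          gcongr
          · exact wdist_mono hX'G
          · rwa [wdist_comm]
          · exact wdist_mono hX'G
      _ = (wdist w X' u a + wdist w X' a v) + (r + r) := by ring
      _ ≤ _ := by rw [hθr, two_mul, ENNReal.coe_add]; gcongr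
  have hsub : closePairs w G X S θ ⊆ closePairs w G X' S θ := fun p hp => by
    rw [mem_closePairs] at hp ⊢
    exact (wdist_mono le_sup_left).trans hp
  have hnew : ∑ z ∈ N, vertexMass w T z ≤
      ∑ p ∈ closePairs w G X' S θ \ closePairs w G X S θ, vertexMass w T p.2 := by
    -- Whichever of the two pairs of `z` was not close before. The second coordinate keeps the
    -- choice injective.
    let f : V → S × V := fun z => if (u, z) ∈ closePairs w G X S θ then (v, z) else (u, z)
    have hf2 : ∀ z, (f z).2 = z := fun z => by simp only [f]; split_ifs <;> rfl
    have hinj : Set.InjOn f N := fun a _ b _ hab => by rw [← hf2 a, hab, hf2]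
    calc ∑ z ∈ N, vertexMass w T z = ∑ p ∈ N.image f, vertexMass w T p.2 := by
          rw [Finset.sum_image hinj]; simp only [hf2]
      _ ≤ _ := by
        refine Finset.sum_le_sum_of_subset fun p hp => ?_
        obtain ⟨z, hz, rfl⟩ := Finset.mem_image.1 hp
        obtain ⟨h1, h2, h3⟩ := hnear z hz
        rw [Finset.mem_sdiff]
        simp only [f]
        split_ifs with h
        -- If both pairs had been close, the detour through `z` would exceed the distance by at most
        -- `3 * θ`: one `θ` because `z` is only near the path, and one for each half. This is less
        -- than the allowed `ε * M = 4 * θ`, up to equality at zero.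
        · refine ⟨mem_closePairs.2 h3, fun h' => hu ?_⟩
          rw [mem_closePairs] at h h'
          simp only at h h'
          calc wdist w X u v ≤ wdist w X u z + wdist w X z v := wdist_triangle
            _ ≤ (wdist w G u z + θ) + (wdist w G v z + θ) := by
                gcongr; rwa [wdist_comm]
            _ = (wdist w G u z + wdist w G z v) + (θ + θ) := by rw [wdist_comm (u := (v : V))]; ring
            _ ≤ (wdist w G u v + θ) + (θ + θ) := by gcongr
            _ ≤ wdist w G u v + ((ε * M : ℝ≥0) : ℝ≥0∞) := by
                rw [add_assoc]
                gcongr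
                rw [← ENNReal.coe_add, ← ENNReal.coe_add, ENNReal.coe_le_coe, hθ,
                  ← NNReal.coe_le_coe]
                push_cast
                have := (ε * M).2
                linarith
        · exact ⟨mem_closePairs.2 h2, h⟩
  have hPsi : closeMass w G X T S θ + ∑ z ∈ N, vertexMass w T z ≤ closeMass w G X' T S θ := by
    unfold closeMass
    rw [← Finset.sum_sdiff hsub, add_comm]
    gcongr
  calc edgeWeight w X'.edgeSet + (8 / ε + 2) * closeMass w G X T S θ
      ≤ (edgeWeight w X.edgeSet + (8 / ε + 2) * ∑ z ∈ N, vertexMass w T z) +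
          (8 / ε + 2) * closeMass w G X T S θ := by
        gcongr
        rw [hX', SimpleGraph.edgeSet_sup]
        refine (edgeWeight_union_le _ _).trans ?_
        gcongr
        exact (edgeWeight_walkGraph_le q).trans hw
    _ = edgeWeight w X.edgeSet + (8 / ε + 2) *
          (closeMass w G X T S θ + ∑ z ∈ N, vertexMass w T z) := by ring
    _ ≤ _ := by gcongr

/-- The one-step inequalities telescope. Here `θ` is a threshold not above those of the remaining
pairs; raising it to that of the next pair does not decrease the potential, and this is where the
order by `W` enters. -/
lemma edgeWeight_foldl_greedyStep_le {P : PathSystem G w S} {ε : ℝ≥0} (hε : 0 < ε) {K : Finset V}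
    (hK : ∀ a ∈ K, ∀ b ∈ K, T.Reachable a b) (hTK : ∀ a b, T.Adj a b → a ∈ K)
    (hq : ∀ u v : S, ¬ P.Satisfied ε T u v → ∀ a ∈ (P.path u v).support, a ∈ K)
    (l : List (S × S)) (hl : l.Pairwise fun a b => P.W a.1 a.2 ≤ P.W b.1 b.2) (hT : T ≤ X)
    (hXG : X ≤ G) (θ : ℝ≥0) (hθ : ∀ p ∈ l, θ ≤ ε * P.W p.1 p.2 / 4) :
    edgeWeight w (l.foldl (greedyStep P ε) X).edgeSet + (8 / ε + 2) * closeMass w G X T S θ ≤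
      edgeWeight w X.edgeSet + (8 / ε + 2) * (S.card * (2 * edgeWeight w T.edgeSet)) := by
  induction l generalizing X θ with
  | nil =>
    simp only [List.foldl_nil]
    gcongr
    exact closeMass_le
  | cons p l ih =>
    rw [List.pairwise_cons] at hl
    rw [List.foldl_cons]
    have h1 := ih hl.2 (hT.trans (le_greedyStep P ε X p)) (greedyStep_le hXG)
      (ε * P.W p.1 p.2 / 4) (fun b hb => by gcongr; exact hl.1 b hb)
    have h2 : edgeWeight w (greedyStep P ε X p).edgeSet +
        (8 / ε + 2) * closeMass w G X T S (ε * P.W p.1 p.2 / 4) ≤ edgeWeight w X.edgeSet +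
        (8 / ε + 2) * closeMass w G (greedyStep P ε X p) T S (ε * P.W p.1 p.2 / 4) := by
      by_cases h : P.Satisfied ε X p.1 p.2
      · simp [greedyStep, h]
      · rw [greedyStep, if_neg h]
        exact edgeWeight_sup_walkGraph_le hε hT hXG hK hTK (hq _ _ fun h' => h (h'.mono hT)) h
    have h3 : (8 / ε + 2) * closeMass w G X T S θ ≤
        (8 / ε + 2) * closeMass w G X T S (ε * P.W p.1 p.2 / 4) := by
      gcongr
      exact closeMass_mono (hθ p (by simp))
    rw [← NNReal.coe_le_coe] at h1 h2 h3 ⊢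
    push_cast at h1 h2 h3 ⊢
    linarith

end Greedy

/-! ### The weight of the initial graph and the lightness bound. -/

section Lightness

variable {V : Type*} {w : Sym2 V → ℝ≥0} {G : SimpleGraph V} {S : Finset V}

lemma IsSteinerTree.mono {K K' : Set V} {T : G.Subgraph} (h : IsSteinerTree G K T)
    (hK : K' ⊆ K) : IsSteinerTree G K' T := ⟨h.1, hK.trans h.2⟩

lemma subgraph_reachable_spanningCoe {H : G.Subgraph} (h : H.coe.Connected) {a b : V}
    (ha : a ∈ H.verts) (hb : b ∈ H.verts) : H.spanningCoe.Reachable a b := by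
  have := h.preconnected ⟨a, ha⟩ ⟨b, hb⟩
  exact this.map (⟨fun x => x.1, fun {x y} hxy => hxy⟩ : H.coe →g H.spanningCoe)

variable [Fintype V]

/-- `G` has only finitely many subgraphs, so the infimum is attained. -/
lemma le_mul_minSteinerWeight {ρ : ℝ≥0} {K : Set V} {T : G.Subgraph}
    (hT : IsSteinerTree G K T) {c : ℝ≥0}
    (h : ∀ T' : G.Subgraph, IsSteinerTree G K T' → c ≤ ρ * edgeWeight w T'.edgeSet) :
    (c : ℝ≥0∞) ≤ ρ * minSteinerWeight w G K := by
  obtain ⟨T₀, hT₀, hmin⟩ := Set.exists_min_image {T' : G.Subgraph | IsSteinerTree G K T'}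
    (fun T' => edgeWeight w T'.edgeSet) (Set.toFinite _) ⟨T, hT⟩
  have : minSteinerWeight w G K = edgeWeight w T₀.edgeSet :=
    le_antisymm (iInf₂_le T₀ hT₀) (le_iInf₂ fun T' hT' => by exact_mod_cast hmin T' hT')
  rw [this]
  exact_mod_cast h T₀ hT₀

namespace GreedyRun

variable {ρ ε : ℝ≥0} (run : GreedyRun ρ ε G w S)

lemma subset_extendedTerminals : (S : Set V) ⊆ run.P.extendedTerminals ε run.R :=
  fun _ hx => Or.inl hx

lemma lightEdges_subset : run.lightEdges ⊆ G.edgeSet := fun _ he => he.1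

lemma initial_le : run.initial ≤ G := by
  refine sup_le run.H.spanningCoe_le ?_
  rw [SimpleGraph.fromEdgeSet_le]
  exact fun e he => run.lightEdges_subset he.1

/-- A Steiner tree for the extended terminals is also one for `S`, so `R` and `T` each cost at most
`ρ` times its weight, and `H` lies in their union. -/
lemma edgeWeight_H_le :
    (edgeWeight w run.H.edgeSet : ℝ≥0∞) ≤
      (2 * ρ : ℝ≥0) * minSteinerWeight w G (run.P.extendedTerminals ε run.R) := by
  refine le_mul_minSteinerWeight run.T_steiner.1 fun T' hT' => ?_
  refine (edgeWeight_mono (SimpleGraph.Subgraph.edgeSet_mono run.H_le_union)).trans ?_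
  rw [SimpleGraph.Subgraph.edgeSet_sup, mul_assoc, two_mul]
  refine (edgeWeight_union_le _ _).trans (add_le_add ?_ ?_)
  · exact run.R_steiner.2 T' (hT'.mono run.subset_extendedTerminals)
  · exact run.T_steiner.2 T' hT'

/-- There are at most as many light edges as vertices of `H`, and each weighs less than the average
`w(H) / |V_H|`. -/
lemma edgeWeight_lightEdges_le : edgeWeight w run.lightEdges ≤ edgeWeight w run.H.edgeSet := by
  classical
  set c := edgeWeight w run.H.edgeSet
  set m := run.H.verts.ncard
  let K := run.H.verts.toFinset
  have hKm : K.card = m := (Set.ncard_eq_toFinset_card' _).symm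
  let E : Finset (Sym2 V) := Finset.univ.filter (· ∈ run.lightEdges)
  have hE : E ⊆ K.image fun v => s(v, run.nbr v) := by
    intro e he
    obtain ⟨-, ⟨v, hv, rfl⟩, -⟩ := (Finset.mem_filter.1 he).2
    exact Finset.mem_image_of_mem _ (by simpa [K] using run.H_steiner.2 hv)
  have hcard : E.card ≤ m := (Finset.card_le_card hE).trans (Finset.card_image_le.trans_eq hKm)
  have h1 : edgeWeight w run.lightEdges * m ≤ c * m := by
    calc edgeWeight w run.lightEdges * m = ∑ e ∈ E, w e * m := by
          rw [edgeWeight, Finset.sum_mul]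
      _ ≤ ∑ e ∈ E, c := Finset.sum_le_sum fun e he => (Finset.mem_filter.1 he).2.2.2.le
      _ = E.card * c := by rw [Finset.sum_const, nsmul_eq_mul]
      _ ≤ m * c := by gcongr
      _ = c * m := mul_comm _ _
  rcases Nat.eq_zero_or_pos m with hm | hm
  · have : E = ∅ := Finset.card_eq_zero.1 (by omega)
    have h0 : edgeWeight w run.lightEdges = ∑ e ∈ E, w e := rfl
    rw [h0, this, Finset.sum_empty]
    exact zero_le
  · exact le_of_mul_le_mul_right h1 (by exact_mod_cast hm)

lemma isSpanner : run.P.IsSpanner ε run.spanner :=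
  ⟨foldl_greedyStep_le _ run.initial_le, fun u v =>
    satisfied_foldl_greedyStep _ _ _ _ (run.order_complete (u, v))⟩

lemma edgeWeight_spanner_le (hε : 0 < ε) :
    edgeWeight w run.spanner.edgeSet ≤
      (2 + (8 / ε + 2) * (S.card * 2)) * edgeWeight w run.H.edgeSet := by
  classical
  have h := edgeWeight_foldl_greedyStep_le (P := run.P) (T := run.H.spanningCoe) hε
    (K := run.H.verts.toFinset)
    (fun a ha b hb => subgraph_reachable_spanningCoe run.H_steiner.1.connected
      (by simpa using ha) (by simpa using hb))
    (fun a b hab => by simpa using run.H.edge_vert hab)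
    -- As `H` contains `R`, a pair violated in `H` is violated in `R`. So its path consists of
    -- extended terminals, which `H` spans.
    (fun u v huv a ha => by
      simp only [Set.mem_toFinset]
      refine run.H_steiner.2 (Or.inr ⟨u, v, fun h => huv ?_, ha⟩)
      exact h.mono (SimpleGraph.Subgraph.spanningCoe_le_of_le run.R_le_H))
    run.order run.order_sorted (X := run.initial) le_sup_left run.initial_le 0 (by simp)
  refine le_self_add.trans (h.trans ?_)
  have hinit : edgeWeight w run.initial.edgeSet ≤ 2 * edgeWeight w run.H.edgeSet := by
    rw [initial, SimpleGraph.edgeSet_sup, two_mul]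
    refine (edgeWeight_union_le _ _).trans (add_le_add le_rfl ?_)
    refine le_trans (edgeWeight_mono ?_) run.edgeWeight_lightEdges_le
    rw [SimpleGraph.edgeSet_fromEdgeSet]
    exact Set.sdiff_subset
  have hsp : edgeWeight w run.H.spanningCoe.edgeSet = edgeWeight w run.H.edgeSet := rfl
  rw [hsp]
  refine (add_le_add_left hinit _).trans (le_of_eq (by ring))

lemma subsetLightness_le (hS : S.Nonempty) (hε : 0 < ε) :
    run.P.subsetLightness ε run.R run.spanner ≤
      ((44 * ρ * (1 + 1 / ε) ^ 1 * S.card : ℝ≥0) : ℝ≥0∞) := by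
  -- This form also covers a minimum Steiner weight of zero: the product bound then makes the
  -- spanner weigh zero, and `0 / 0 = 0`.
  refine ENNReal.div_le_of_le_mul ?_
  have h1 : edgeWeight w run.spanner.edgeSet ≤
      (22 * (1 + 1 / ε) * S.card) * edgeWeight w run.H.edgeSet := by
    refine (run.edgeWeight_spanner_le hε).trans ?_
    gcongr
    have hc : (1 : ℝ≥0) ≤ S.card := by exact_mod_cast hS.card_pos
    -- The additive `2` is absorbed using that there is at least one terminal; `22` is a convenient
    -- common upper bound for `6` and `16`.
    calc 2 + (8 / ε + 2) * (S.card * 2) ≤ 2 * S.card + (8 / ε + 2) * (S.card * 2) := by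
          gcongr; exact le_mul_of_one_le_right zero_le hc
      _ = (6 + 16 * (1 / ε)) * S.card := by ring
      _ ≤ (22 + 22 * (1 / ε)) * S.card := by gcongr <;> norm_num
      _ = _ := by ring
  calc (edgeWeight w run.spanner.edgeSet : ℝ≥0∞)
      ≤ ((22 * (1 + 1 / ε) * S.card : ℝ≥0) : ℝ≥0∞) * (edgeWeight w run.H.edgeSet : ℝ≥0∞) := by
        exact_mod_cast h1
    _ ≤ ((22 * (1 + 1 / ε) * S.card : ℝ≥0) : ℝ≥0∞) * ((2 * ρ : ℝ≥0) *
          minSteinerWeight w G (run.P.extendedTerminals ε run.R)) := by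
        gcongr
        exact run.edgeWeight_H_le
    _ = _ := by
        rw [← mul_assoc, ← ENNReal.coe_mul]
        congr 2
        ring

end GreedyRun

end Lightness


/-! ### Enlarging a tree by a path. -/

section TreeGrowth

variable {V : Type*} {G : SimpleGraph V} {x y z : V}

/-- A subgraph that is a tree, expressed through its spanning version. -/
def IsSubtree (T : G.Subgraph) : Prop := T.Connected ∧ T.spanningCoe.IsAcyclic

lemma IsSubtree.isTree {T : G.Subgraph} (h : IsSubtree T) : T.coe.IsTree :=
  ⟨h.1.coe, h.2.comap (⟨fun x => x.1, fun {_ _} hxy => hxy⟩ : T.coe →g T.spanningCoe)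
    Subtype.val_injective⟩

lemma isSubtree_singleton (v : V) : IsSubtree (G.singletonSubgraph v) := by
  refine ⟨SimpleGraph.Subgraph.singletonSubgraph_connected, ?_⟩
  have : (G.singletonSubgraph v).spanningCoe = ⊥ := by ext; simp
  rw [this]
  exact SimpleGraph.isAcyclic_bot

lemma IsSubtree.sup_subgraphOfAdj {T : G.Subgraph} (hT : IsSubtree T) (h : G.Adj y x)
    (hx : x ∈ T.verts) (hy : y ∉ T.verts) : IsSubtree (T ⊔ G.subgraphOfAdj h) := by
  refine ⟨SimpleGraph.Subgraph.connected_sup hT.1.preconnected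
    (SimpleGraph.Subgraph.subgraphOfAdj_connected h).preconnected ⟨x, by simp [hx]⟩, ?_⟩
  have : (T ⊔ G.subgraphOfAdj h).spanningCoe = T.spanningCoe ⊔ SimpleGraph.edge y x := by
    ext a b
    simp only [SimpleGraph.Subgraph.spanningCoe_adj, SimpleGraph.Subgraph.sup_adj,
      SimpleGraph.subgraphOfAdj_adj, SimpleGraph.sup_adj, SimpleGraph.edge_adj, Sym2.eq_iff]
    have := h.ne
    constructor
    · rintro (h | ⟨rfl, rfl⟩ | ⟨rfl, rfl⟩)
      · exact Or.inl h
      · simp [this]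
      · simp [this.symm]
    · rintro (h | ⟨⟨rfl, rfl⟩ | ⟨rfl, rfl⟩, -⟩) <;> simp [*]
  rw [this]
  -- The new vertex `y` has no edge in `T`, so the added edge is pendant and closes no cycle.
  refine hT.2.sup_edge_of_not_reachable fun hr => ?_
  obtain ⟨p⟩ := hr
  cases p with
  | nil => exact hy hx
  | cons h' _ => exact hy (T.edge_vert h')

/-- The path is attached backwards from `z`, one pendant edge at a time. -/
lemma IsSubtree.sup_walk {T : G.Subgraph} (hT : IsSubtree T) (q : G.Walk y z) (hq : q.IsPath)
    (hz : z ∈ T.verts) (hnew : ∀ a ∈ q.support, a ≠ z → a ∉ T.verts) :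
    IsSubtree (T ⊔ q.toSubgraph) := by
  induction q with
  | nil =>
    rwa [SimpleGraph.Walk.toSubgraph, sup_eq_left.2]
    simpa using hz
  | @cons y x z h q ih =>
    rw [SimpleGraph.Walk.cons_isPath_iff] at hq
    have h1 := ih hq.1 hz fun a ha => hnew a (by simp [ha])
    rw [SimpleGraph.Walk.toSubgraph, sup_comm (G.subgraphOfAdj h), ← sup_assoc]
    refine h1.sup_subgraphOfAdj h (by simp) ?_
    have hyz : y ≠ z := fun hyz => hq.2 (hyz ▸ q.end_mem_support)
    simp [hnew y (by simp) hyz, hq.2]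

variable [Fintype V] {w : Sym2 V → ℝ≥0}

lemma edgeWeight_sup_toSubgraph_le (T : G.Subgraph) (q : G.Walk y z) :
    edgeWeight w (T ⊔ q.toSubgraph).edgeSet ≤ edgeWeight w T.edgeSet + walkWeight w q := by
  rw [SimpleGraph.Subgraph.edgeSet_sup]
  refine (edgeWeight_union_le _ _).trans (add_le_add le_rfl ?_)
  refine le_trans (edgeWeight_mono ?_) (edgeWeight_list_le q.edges)
  exact fun e he => (SimpleGraph.Walk.mem_edges_toSubgraph q).1 he

end TreeGrowth

/-! ### Approximate Steiner trees through the metric closure. -/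

section SteinerApproximation

variable {V : Type*} {w : Sym2 V → ℝ≥0} {G X : SimpleGraph V} {x y z : V}

/-- The distance in `G` between the two ends of a link. -/
def linkCost (w : Sym2 V → ℝ≥0) (G : SimpleGraph V) : Sym2 V → ℝ≥0 :=
  Sym2.lift ⟨fun x y => (wdist w G x y).toNNReal, fun x y => by simp only [wdist_comm (u := x)]⟩

lemma linkCost_mk (x y : V) : linkCost w G s(x, y) = (wdist w G x y).toNNReal := rfl

lemma linkCost_le_add_of_adj (h : G.Adj x y) (hyz : G.Reachable y z) :
    linkCost w G s(x, z) ≤ w s(x, y) + linkCost w G s(y, z) := by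
  have hfin := wdist_ne_top (w := w) hyz
  rw [linkCost_mk, linkCost_mk, ← ENNReal.toNNReal_coe (w s(x, y)),
    ← ENNReal.toNNReal_add ENNReal.coe_ne_top hfin]
  refine ENNReal.toNNReal_mono (by simp [hfin]) ((wdist_triangle (v := y)).trans ?_)
  gcongr
  exact wdist_le_of_adj h

/-- Take the first edge of the walk that enters `A`. All earlier edges have both ends outside `A`,
hence differ from it and survive its deletion. -/
lemma exists_adj_boundary_reachable {F : SimpleGraph V} {A : Set V} {a : V} (q : F.Walk x a)
    (hx : x ∉ A) (ha : a ∈ A) :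
    ∃ y b, F.Adj y b ∧ y ∉ A ∧ b ∈ A ∧ (F.deleteEdges {s(y, b)}).Reachable x y := by
  induction q with
  | nil => exact absurd ha hx
  | @cons x x' a h q ih =>
    by_cases hx' : x' ∈ A
    · exact ⟨x, x', h, hx, hx', .refl _⟩
    · obtain ⟨y, b, hyb, hy, hb, hr⟩ := ih hx' ha
      refine ⟨y, b, hyb, hy, hb, SimpleGraph.Reachable.trans (SimpleGraph.Adj.reachable ?_) hr⟩
      rw [SimpleGraph.deleteEdges_adj]
      refine ⟨h, fun heq => ?_⟩
      have : b ∈ s(x, x') := by rw [Set.mem_singleton_iff.1 heq]; simp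
      rcases Sym2.mem_iff.1 this with rfl | rfl
      · exact hx hb
      · exact hx' hb

variable [Fintype V]

lemma edgeWeight_insert {e : Sym2 V} {E : Set (Sym2 V)} (he : e ∉ E) :
    edgeWeight w (insert e E) = w e + edgeWeight w E := by
  classical
  unfold edgeWeight
  rw [← Finset.sum_insert (s := Finset.univ.filter (· ∈ E)) (by simpa using he)]
  congr 1
  ext; simp

lemma edgeWeight_empty : edgeWeight w ∅ = 0 := by simp [edgeWeight]

lemma edgeWeight_singleton (e : Sym2 V) : edgeWeight w {e} = w e := by
  rw [← insert_empty_eq, edgeWeight_insert (by simp), edgeWeight_empty, add_zero]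

/-- The doubling of a connected graph, as a walk. -/
lemma exists_walk_weight_le_two_mul (X : SimpleGraph V) (r : V) :
    ∃ (s : V) (q : X.Walk r s), (∀ x, X.Reachable r x → x ∈ q.support) ∧
      walkWeight w q ≤ 2 * edgeWeight w X.edgeSet := by
  classical
  -- While a reachable vertex is missed, some edge leaves the visited set. Going along it and back
  -- adds twice its weight, and the edge has not been used before because its far end is unvisited.
  have key : ∀ k : ℕ, ∃ (s : V) (q : X.Walk r s),
      walkWeight w q ≤ 2 * edgeWeight w {e | e ∈ q.edges} ∧
      ((∀ x, X.Reachable r x → x ∈ q.support) ∨ k ≤ q.support.toFinset.card) := by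
    intro k
    induction k with
    | zero => exact ⟨r, .nil, by simp, Or.inr (by simp)⟩
    | succ k ih =>
      obtain ⟨s, q, hw, hq⟩ := ih
      by_cases hcov : ∀ x, X.Reachable r x → x ∈ q.support
      · exact ⟨s, q, hw, Or.inl hcov⟩
      have hk := hq.resolve_left hcov
      push Not at hcov
      obtain ⟨t, ⟨p⟩, ht⟩ := hcov
      obtain ⟨d, hd, hx, hy⟩ := p.exists_boundary_dart {x | x ∈ q.support} (by simp) ht
      obtain ⟨⟨x, y⟩, hxy⟩ := d
      simp only [Set.mem_ofPred_eq] at hx hy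
      let q' : X.Walk r s := (q.takeUntil x hx).append
        (.cons hxy (.cons hxy.symm (q.dropUntil x hx)))
      have hmem : ∀ e, e ∈ q'.edges ↔ e = s(x, y) ∨ e ∈ q.edges := by
        intro e
        conv_rhs => rw [← q.take_spec hx]
        simp only [q', SimpleGraph.Walk.edges_append, SimpleGraph.Walk.edges_cons,
          List.mem_append, List.mem_cons, Sym2.eq_swap (a := y)]
        tauto
      have hsupp : insert y q.support.toFinset ⊆ q'.support.toFinset := by
        intro a ha
        rw [Finset.mem_insert, List.mem_toFinset] at ha
        rw [List.mem_toFinset]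
        conv at ha => rw [← q.take_spec hx]
        simp only [q', SimpleGraph.Walk.mem_support_append_iff, SimpleGraph.Walk.support_cons,
          List.mem_cons] at ha ⊢
        tauto
      refine ⟨s, q', ?_, Or.inr ?_⟩
      · have hset : {e | e ∈ q'.edges} = insert s(x, y) {e | e ∈ q.edges} := by
          ext e; simp [hmem]
        rw [hset, edgeWeight_insert (fun h => hy (q.snd_mem_support_of_mem_edges h)), mul_add]
        have hw' : walkWeight w q' = 2 * w s(x, y) + walkWeight w q := by
          conv_rhs => rw [← q.take_spec hx]
          simp only [q', walkWeight_append, walkWeight_cons, Sym2.eq_swap (a := y)]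
          ring
        rw [hw']
        gcongr
      · refine le_trans ?_ (Finset.card_le_card hsupp)
        rw [Finset.card_insert_of_notMem (by simpa using hy)]
        omega
  obtain ⟨s, q, hw, hq⟩ := key (Fintype.card V + 1)
  refine ⟨s, q, hq.resolve_right fun h => ?_, hw.trans ?_⟩
  · exact absurd (h.trans (Finset.card_le_univ _)) (by omega)
  · gcongr
    exact edgeWeight_mono fun e he => q.edges_subset_edgeSet he

/-- The links between consecutive terminals on a walk. -/
lemma exists_links_of_walk (K : Set V) (q : G.Walk x y) (hK : ∃ t ∈ K, t ∈ q.support) :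
    ∃ (F : SimpleGraph V) (t : V), t ∈ K ∧ G.Reachable x t ∧ (∀ a b, F.Adj a b → a ∈ K) ∧
      (∀ k ∈ K, k ∈ q.support → F.Reachable k t) ∧
      linkCost w G s(x, t) + edgeWeight (linkCost w G) F.edgeSet ≤ walkWeight w q := by
  classical
  have hzero : ∀ x, linkCost w G s(x, x) = 0 := fun x => by simp [linkCost_mk]
  -- Read backwards: `t` is the first terminal on the walk so far, and the summand `linkCost w G
  -- s(x, t)` reserves the weight spent since `t`. When `x` is itself a terminal, the reserve buys
  -- the link from `x` to `t` and restarts at zero.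
  induction q with
  | @nil x =>
    obtain ⟨t, htK, ht⟩ := hK
    obtain rfl : t = x := by simpa using ht
    refine ⟨⊥, t, htK, .refl _, by simp, by simp, ?_⟩
    simp [hzero, edgeWeight]
  | @cons x x' y h q ih =>
    by_cases hq : ∃ t ∈ K, t ∈ q.support
    · obtain ⟨F, t, htK, hrt, hFK, hF, hw⟩ := ih hq
      have hstep := linkCost_le_add_of_adj (w := w) h hrt
      by_cases hx : x ∈ K
      · refine ⟨F ⊔ SimpleGraph.edge x t, x, hx, .refl _, ?_, ?_, ?_⟩
        · rintro a b (hab | hab)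
          · exact hFK a b hab
          · rw [SimpleGraph.edge_adj] at hab
            rcases hab.1 with ⟨rfl, rfl⟩ | ⟨rfl, rfl⟩ <;> assumption
        · intro k hk hks
          rw [SimpleGraph.Walk.support_cons, List.mem_cons] at hks
          rcases hks with rfl | hks
          · exact .refl _
          refine ((hF k hk hks).mono le_sup_left).trans ?_
          by_cases hxt : x = t
          · rw [hxt]
          · refine SimpleGraph.Adj.reachable (Or.inr ?_)
            rw [SimpleGraph.edge_adj]
            exact ⟨Or.inr ⟨rfl, rfl⟩, fun h => hxt h.symm⟩
        · rw [hzero, zero_add, walkWeight_cons]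
          calc edgeWeight (linkCost w G) (F ⊔ SimpleGraph.edge x t).edgeSet
              ≤ edgeWeight (linkCost w G) F.edgeSet + edgeWeight (linkCost w G) {s(x, t)} := by
                rw [SimpleGraph.edgeSet_sup]
                refine (edgeWeight_union_le _ _).trans (add_le_add le_rfl (edgeWeight_mono ?_))
                intro e he
                exact (SimpleGraph.edgeSet_fromEdgeSet _ ▸ he).1
            _ = edgeWeight (linkCost w G) F.edgeSet + linkCost w G s(x, t) := by
                rw [edgeWeight_singleton]
            _ ≤ edgeWeight (linkCost w G) F.edgeSet +
                  (w s(x, x') + linkCost w G s(x', t)) := by gcongr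
            _ = w s(x, x') + (linkCost w G s(x', t) + edgeWeight (linkCost w G) F.edgeSet) := by
                ring
            _ ≤ _ := by gcongr
      · refine ⟨F, t, htK, h.reachable.trans hrt, hFK, ?_, ?_⟩
        · intro k hk hks
          rw [SimpleGraph.Walk.support_cons, List.mem_cons] at hks
          rcases hks with rfl | hks
          · exact absurd hk hx
          · exact hF k hk hks
        · rw [walkWeight_cons]
          calc linkCost w G s(x, t) + edgeWeight (linkCost w G) F.edgeSet
              ≤ (w s(x, x') + linkCost w G s(x', t)) + edgeWeight (linkCost w G) F.edgeSet := by
                gcongr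
            _ ≤ _ := by rw [add_assoc]; gcongr
    · obtain ⟨t, htK, ht⟩ := hK
      have : t = x := by
        rw [SimpleGraph.Walk.support_cons, List.mem_cons] at ht
        exact ht.resolve_right fun h => hq ⟨t, htK, h⟩
      subst this
      refine ⟨⊥, t, htK, .refl _, by simp, ?_, ?_⟩
      · intro k hk hks
        rw [SimpleGraph.Walk.support_cons, List.mem_cons] at hks
        rcases hks with rfl | hks
        · exact .refl _
        · exact absurd ⟨k, hk, hks⟩ hq
      · simp [hzero, edgeWeight]

/-- Adding a terminal to the connected side makes one link of at least the minimal cost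
superfluous. -/
lemma exists_links_remove {c : Sym2 V → ℝ≥0} {F : SimpleGraph V} {K A : Set V}
    (hFK : ∀ a b, F.Adj a b → a ∈ K) (hF : ∀ k ∈ K, ∃ a ∈ A, F.Reachable k a) (hxK : x ∈ K)
    (hxA : x ∉ A) {c₀ : ℝ≥0} (hc : ∀ a ∈ A, ∀ z ∈ K, z ∉ A → c₀ ≤ c s(a, z)) :
    ∃ F' : SimpleGraph V, (∀ a b, F'.Adj a b → a ∈ K) ∧
      (∀ k ∈ K, ∃ a ∈ insert x A, F'.Reachable k a) ∧
      c₀ + edgeWeight c F'.edgeSet ≤ edgeWeight c F.edgeSet := by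
  obtain ⟨a, ha, ⟨q⟩⟩ := hF x hxK
  obtain ⟨y, b, hyb, hy, hb, hr⟩ := exists_adj_boundary_reachable q hxA ha
  set F' := F.deleteEdges {s(y, b)} with hF'
  refine ⟨F', fun a b hab => hFK a b (SimpleGraph.deleteEdges_le _ hab), ?_, ?_⟩
  · intro k hk
    obtain ⟨a, ha, ⟨p⟩⟩ := hF k hk
    clear hk
    induction p with
    | nil => exact ⟨_, Set.mem_insert_of_mem _ ha, .refl _⟩
    | @cons k k' a h p ih =>
      by_cases he : s(k, k') = s(y, b)
      · rcases Sym2.eq_iff.1 he with ⟨rfl, rfl⟩ | ⟨rfl, rfl⟩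
        · exact ⟨x, Set.mem_insert _ _, hr.symm⟩
        · exact ⟨k, Set.mem_insert_of_mem _ hb, .refl _⟩
      · obtain ⟨a', ha', hr'⟩ := ih ha
        refine ⟨a', ha', SimpleGraph.Reachable.trans (SimpleGraph.Adj.reachable ?_) hr'⟩
        rw [hF', SimpleGraph.deleteEdges_adj]
        exact ⟨h, he⟩
  · have hE : F.edgeSet = insert s(y, b) F'.edgeSet := by
      rw [hF', SimpleGraph.edgeSet_deleteEdges]
      ext e
      simp only [Set.mem_insert_iff, Set.mem_sdiff, Set.mem_singleton_iff]
      constructor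
      · tauto
      · rintro (rfl | h)
        · exact hyb
        · exact h.1
    have hnot : s(y, b) ∉ F'.edgeSet := by simp [hF']
    rw [hE, edgeWeight_insert hnot]
    gcongr
    rw [Sym2.eq_swap]
    exact hc b hb y (hFK y b hyb) hy

/-- `T` can be completed to a tree containing `K`, by links of the metric closure, at total cost
at most `B`. -/
def CompletesWithin (w : Sym2 V → ℝ≥0) (K : Set V) (T : G.Subgraph) (B : ℝ≥0) : Prop :=
  ∃ F : SimpleGraph V, (∀ a b, F.Adj a b → a ∈ K) ∧ (∀ k ∈ K, ∃ a ∈ T.verts, F.Reachable k a) ∧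
    edgeWeight w T.edgeSet + edgeWeight (linkCost w G) F.edgeSet ≤ B

lemma CompletesWithin.edgeWeight_le {K : Set V} {T : G.Subgraph} {B : ℝ≥0}
    (h : CompletesWithin w K T B) : edgeWeight w T.edgeSet ≤ B := by
  obtain ⟨F, -, -, hF⟩ := h
  exact le_self_add.trans hF

/-- Doubling `T'` gives a walk of weight at most `2 * w(T')` through all of `K`. The links between
its consecutive terminals cost no more and join every terminal to `r`. -/
lemma completesWithin_of_steinerTree {K : Set V} {T T' : G.Subgraph} (hT' : IsSteinerTree G K T')
    {r : V} (hr : r ∈ K) (hrT : r ∈ T.verts) :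
    CompletesWithin w K T (edgeWeight w T.edgeSet + 2 * edgeWeight w T'.edgeSet) := by
  obtain ⟨s, q, hq, hw⟩ := exists_walk_weight_le_two_mul (w := w) T'.spanningCoe r
  have hmem : ∀ k ∈ K, k ∈ q.support := fun k hk =>
    hq k (subgraph_reachable_spanningCoe hT'.1.connected (hT'.2 hr) (hT'.2 hk))
  obtain ⟨F, t, htK, -, hFK, hF, hc⟩ := exists_links_of_walk (w := w) K
    (q.mapLe T'.spanningCoe_le) ⟨r, hr, by simp⟩
  have hF' : ∀ k ∈ K, F.Reachable k t := fun k hk => hF k hk (by simpa using hmem k hk)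
  refine ⟨F, hFK, fun k hk => ⟨r, hrT, (hF' k hk).trans (hF' r hr).symm⟩, ?_⟩
  rw [walkWeight_mapLe] at hc
  gcongr
  exact (le_add_self.trans hc).trans hw

/-- The exchange step of Prim's algorithm: the new path costs no more than any link from the tree to
a missing terminal, and attaching `x` makes one such link superfluous. -/
lemma CompletesWithin.sup_walk {K : Set V} {T : G.Subgraph} {B : ℝ≥0}
    (h : CompletesWithin w K T B) (hxK : x ∈ K) (hxT : x ∉ T.verts) (q : G.Walk x z)
    (hq : ∀ a ∈ T.verts, ∀ k ∈ K, k ∉ T.verts → walkWeight w q ≤ linkCost w G s(a, k)) :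
    CompletesWithin w K (T ⊔ q.toSubgraph) B := by
  obtain ⟨F, hFK, hF, hB⟩ := h
  obtain ⟨F', hFK', hF', hc⟩ := exists_links_remove hFK hF hxK hxT hq
  refine ⟨F', hFK', fun k hk => ?_, le_trans ?_ hB⟩
  · obtain ⟨a, ha, hr⟩ := hF' k hk
    refine ⟨a, ?_, hr⟩
    rcases Set.mem_insert_iff.1 ha with rfl | ha
    · simp
    · simp [ha]
  · calc _ ≤ (edgeWeight w T.edgeSet + walkWeight w q) + edgeWeight (linkCost w G) F'.edgeSet := by
          gcongr
          exact edgeWeight_sup_toSubgraph_le T q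
      _ ≤ _ := by rw [add_assoc]; gcongr

end SteinerApproximation


/-! ## Reasoning about programs -/

section Machine

attribute [simp] NExp.eval RExp.eval BExp.eval

/-- The final memory of a program. -/
def Prog.run (ε : ℝ≥0) (p : Prog) (σ : Mem) : Mem := (p.exec ε σ).1

variable {ε : ℝ≥0} {σ τ : Mem} {p q : Prog}

@[simp] lemma Mem.nat_setNat (σ : Mem) (a i j k a' i' j' : ℕ) :
    (σ.setNat a i j k).nat a' i' j' = if a' = a ∧ i' = i ∧ j' = j then k else σ.nat a' i' j' := rfl

@[simp] lemma Mem.real_setNat (σ : Mem) (a i j k : ℕ) : (σ.setNat a i j k).real = σ.real := rfl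

@[simp] lemma Mem.nat_setReal (σ : Mem) (a i j : ℕ) (x : ℝ≥0) :
    (σ.setReal a i j x).nat = σ.nat := rfl

@[simp] lemma Mem.real_setReal (σ : Mem) (a i j : ℕ) (x : ℝ≥0) (a' i' j' : ℕ) :
    (σ.setReal a i j x).real a' i' j' =
      if a' = a ∧ i' = i ∧ j' = j then x else σ.real a' i' j' := rfl

lemma Mem.nat_setNat_of_ne (σ : Mem) {a i j k a' : ℕ} (h : a' ≠ a) :
    (σ.setNat a i j k).nat a' = σ.nat a' := by
  ext i' j'; simp [h]

lemma Mem.real_setReal_of_ne (σ : Mem) {a i j a' : ℕ} {x : ℝ≥0} (h : a' ≠ a) :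
    (σ.setReal a i j x).real a' = σ.real a' := by
  funext i' j'; simp [h]

@[simp] lemma run_skip : Prog.skip.run ε σ = σ := rfl

@[simp] lemma run_setNat (a : ℕ) (i j e : NExp) :
    (Prog.setNat a i j e).run ε σ = σ.setNat a (i.eval σ) (j.eval σ) (e.eval σ) := rfl

@[simp] lemma run_setReal (a : ℕ) (i j : NExp) (e : RExp) :
    (Prog.setReal a i j e).run ε σ = σ.setReal a (i.eval σ) (j.eval σ) (e.eval ε σ) := rfl

@[simp] lemma run_seq : (Prog.seq p q).run ε σ = q.run ε (p.run ε σ) := rfl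

lemma run_ite_pos {b : BExp} (h : b.eval ε σ) : (Prog.ite b p q).run ε σ = p.run ε σ := by
  simp [Prog.run, Prog.exec, h]

lemma run_ite_neg {b : BExp} (h : ¬ b.eval ε σ) : (Prog.ite b p q).run ε σ = q.run ε σ := by
  simp [Prog.run, Prog.exec, h]

lemma run_loop (a : ℕ) (m : NExp) : (Prog.loop a m p).run ε σ =
    (List.range (m.eval σ)).foldl (fun τ i => p.run ε (τ.setNat a 0 0 i)) σ := by
  have key : ∀ (l : List ℕ) (r : Mem × ℕ),
      (l.foldl (fun (r : Mem × ℕ) i =>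
          let r' := p.exec ε (r.1.setNat a 0 0 i)
          (r'.1, r.2 + r'.2 + 1)) r).1 =
        l.foldl (fun τ i => p.run ε (τ.setNat a 0 0 i)) r.1 := by
    intro l
    induction l with
    | nil => exact fun _ => rfl
    | cons i l ih => exact fun r => ih _
  exact key _ _

lemma run_loop_induction (I : ℕ → Mem → Prop) {a n : ℕ} {m : NExp} (hm : m.eval σ = n)
    (h0 : I 0 σ) (hs : ∀ k < n, ∀ τ, I k τ → I (k + 1) (p.run ε (τ.setNat a 0 0 k))) :
    I n ((Prog.loop a m p).run ε σ) := by
  rw [run_loop, hm]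
  have key : ∀ k ≤ n,
      I k ((List.range k).foldl (fun τ i => p.run ε (τ.setNat a 0 0 i)) σ) := by
    intro k
    induction k with
    | zero => exact fun _ => h0
    | succ k ih =>
      intro hk
      rw [List.range_succ, List.foldl_append]
      exact hs k hk _ (ih (by omega))
  exact key n le_rfl

/-- The arrays of naturals that a program may write. -/
def Prog.natWrites : Prog → List ℕ
  | skip => []
  | setNat a _ _ _ => [a]
  | setReal _ _ _ _ => []
  | seq p q => p.natWrites ++ q.natWrites
  | ite _ p q => p.natWrites ++ q.natWrites
  | loop a _ p => a :: p.natWrites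

/-- The arrays of reals that a program may write. -/
def Prog.realWrites : Prog → List ℕ
  | skip => []
  | setNat _ _ _ _ => []
  | setReal a _ _ _ => [a]
  | seq p q => p.realWrites ++ q.realWrites
  | ite _ p q => p.realWrites ++ q.realWrites
  | loop _ _ p => p.realWrites

/-- Two memories agree outside the given arrays. -/
structure Mem.AgreeOff (A B : List ℕ) (σ τ : Mem) : Prop where
  nat : ∀ a, a ∉ A → τ.nat a = σ.nat a
  real : ∀ a, a ∉ B → τ.real a = σ.real a

namespace Mem.AgreeOff

variable {A B : List ℕ} {υ : Mem}

lemma refl (σ : Mem) : AgreeOff A B σ σ := ⟨fun _ _ => rfl, fun _ _ => rfl⟩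

lemma trans (h : AgreeOff A B σ τ) (h' : AgreeOff A B τ υ) : AgreeOff A B σ υ :=
  ⟨fun a ha => (h'.nat a ha).trans (h.nat a ha), fun a ha => (h'.real a ha).trans (h.real a ha)⟩

lemma setNat (h : AgreeOff A B σ τ) {a i j k : ℕ} (ha : a ∈ A) :
    AgreeOff A B σ (τ.setNat a i j k) :=
  ⟨fun b hb => (τ.nat_setNat_of_ne (by rintro rfl; exact hb ha)).trans (h.nat b hb), h.real⟩

lemma setReal (h : AgreeOff A B σ τ) {a i j : ℕ} {x : ℝ≥0} (ha : a ∈ B) :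
    AgreeOff A B σ (τ.setReal a i j x) :=
  ⟨h.nat, fun b hb => (τ.real_setReal_of_ne (by rintro rfl; exact hb ha)).trans (h.real b hb)⟩

lemma mono {A' B' : List ℕ} (h : AgreeOff A B σ τ) (hA : A ⊆ A') (hB : B ⊆ B') :
    AgreeOff A' B' σ τ :=
  ⟨fun a ha => h.nat a fun h' => ha (hA h'), fun a ha => h.real a fun h' => ha (hB h')⟩

end Mem.AgreeOff

/-- The frame rule. The lists of written arrays are computed from the program text, so for concrete
programs `decide` settles the inclusions. -/
lemma agreeOff_run_of_subset {A B : List ℕ} (σ : Mem) (hA : p.natWrites ⊆ A)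
    (hB : p.realWrites ⊆ B) : σ.AgreeOff A B (p.run ε σ) := by
  induction p generalizing σ with
  | skip => exact .refl σ
  | setNat a i j e => exact (Mem.AgreeOff.refl σ).setNat (hA (by simp [Prog.natWrites]))
  | setReal a i j e => exact (Mem.AgreeOff.refl σ).setReal (hB (by simp [Prog.realWrites]))
  | seq p q ihp ihq =>
    simp only [Prog.natWrites, Prog.realWrites, List.append_subset] at hA hB
    exact (ihp σ hA.1 hB.1).trans (ihq _ hA.2 hB.2)
  | ite b p q ihp ihq =>
    simp only [Prog.natWrites, Prog.realWrites, List.append_subset] at hA hB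
    by_cases h : b.eval ε σ
    · rw [run_ite_pos h]; exact ihp σ hA.1 hB.1
    · rw [run_ite_neg h]; exact ihq σ hA.2 hB.2
  | loop a m p ih =>
    simp only [Prog.natWrites, Prog.realWrites, List.cons_subset] at hA hB
    exact run_loop_induction (fun _ τ => σ.AgreeOff A B τ) rfl (.refl σ) fun k _ τ h =>
      (h.setNat hA.1).trans (ih _ hA.2 hB)

lemma agreeOff_run (p : Prog) (σ : Mem) :
    σ.AgreeOff p.natWrites p.realWrites (p.run ε σ) :=
  agreeOff_run_of_subset σ (fun _ h => h) fun _ h => h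

/-- The number of vertices. -/
abbrev nVerts : NExp := .get 0 (.const 0) (.const 0)

/-- All loops run over the vertices, and the number of vertices is never written. -/
def Prog.VertexLoops : Prog → Prop
  | skip => True
  | setNat a _ _ _ => a ≠ 0
  | setReal _ _ _ _ => True
  | seq p q => p.VertexLoops ∧ q.VertexLoops
  | ite _ p q => p.VertexLoops ∧ q.VertexLoops
  | loop a m p => a ≠ 0 ∧ m = nVerts ∧ p.VertexLoops

/-- A bound for the running time in terms of the number of vertices. -/
def Prog.timeBound : Prog → Polynomial ℕ
  | skip => 1
  | setNat _ i j e => Polynomial.C (i.cost + j.cost + e.cost + 1)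
  | setReal _ i j e => Polynomial.C (i.cost + j.cost + e.cost + 1)
  | seq p q => p.timeBound + q.timeBound + 1
  | ite b p q => Polynomial.C b.cost + (p.timeBound + q.timeBound) + 1
  | loop _ m p => Polynomial.X * (p.timeBound + 1) + Polynomial.C (m.cost + 1)

lemma Prog.VertexLoops.zero_notMem (h : p.VertexLoops) : 0 ∉ p.natWrites := by
  induction p with
  | skip => simp [Prog.natWrites]
  | setNat a i j e => simpa [Prog.natWrites, Prog.VertexLoops, eq_comm] using h
  | setReal a i j e => simp [Prog.natWrites]
  | seq p q ihp ihq => simp [Prog.natWrites, ihp h.1, ihq h.2]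
  | ite b p q ihp ihq => simp [Prog.natWrites, ihp h.1, ihq h.2]
  | loop a m p ih => simp [Prog.natWrites, ih h.2.2, h.1.symm]

/-- Array `0` is never written, so each loop, however deeply nested, makes exactly `n` passes. -/
lemma Prog.VertexLoops.time_le (h : p.VertexLoops) (σ : Mem) {n : ℕ} (hn : σ.nat 0 0 0 = n) :
    (p.exec ε σ).2 ≤ p.timeBound.eval n := by
  have hrun : ∀ (p : Prog) (σ : Mem), p.VertexLoops → σ.nat 0 0 0 = n →
      (p.exec ε σ).1.nat 0 0 0 = n := fun p σ hp hn => by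
    rw [← hn]
    exact congrFun (congrFun ((agreeOff_run (ε := ε) p σ).nat 0 hp.zero_notMem) 0) 0
  induction p generalizing σ with
  | skip => simp [Prog.exec, Prog.timeBound]
  | setNat a i j e => simp [Prog.exec, Prog.timeBound]
  | setReal a i j e => simp [Prog.exec, Prog.timeBound]
  | seq p q ihp ihq =>
    have h1 := ihp h.1 σ hn
    have h2 := ihq h.2 _ (hrun p σ h.1 hn)
    simp only [Prog.exec, Prog.timeBound, Polynomial.eval_add, Polynomial.eval_one]
    omega
  | ite b p q ihp ihq =>
    have h1 := ihp h.1 σ hn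
    have h2 := ihq h.2 σ hn
    simp only [Prog.exec, Prog.timeBound, Polynomial.eval_add, Polynomial.eval_one,
      Polynomial.eval_C]
    split_ifs <;> omega
  | loop a m p ih =>
    obtain ⟨ha, rfl, hp⟩ := h
    have key : ∀ (l : List ℕ) (r : Mem × ℕ), r.1.nat 0 0 0 = n →
        (l.foldl (fun (r : Mem × ℕ) i =>
          let r' := p.exec ε (r.1.setNat a 0 0 i)
          (r'.1, r.2 + r'.2 + 1)) r).2 ≤ r.2 + l.length * (p.timeBound.eval n + 1) := by
      intro l
      induction l with
      | nil => intro r _; simp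
      | cons i l ihl =>
        intro r hr
        have hr' : (r.1.setNat a 0 0 i).nat 0 0 0 = n := by simp [ha.symm, hr]
        have h1 := ih hp _ hr'
        have h2 := ihl (((p.exec ε (r.1.setNat a 0 0 i)).1,
          r.2 + (p.exec ε (r.1.setNat a 0 0 i)).2 + 1)) (hrun p _ hp hr')
        rw [List.foldl_cons]
        refine h2.trans ?_
        simp only [List.length_cons]
        nlinarith
    have := key (List.range (nVerts.eval σ)) (σ, nVerts.cost + 1) hn
    simp only [Prog.exec, Prog.timeBound, Polynomial.eval_add, Polynomial.eval_one,
      Polynomial.eval_C, Polynomial.eval_mul, Polynomial.eval_X]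
    refine this.trans ?_
    simp [hn]
    omega

/-- A scalar. -/
abbrev scalar (a : ℕ) : NExp := .get a (.const 0) (.const 0)

/-- The cell of an array whose indices are given by two scalars. -/
abbrev cell (a i j : ℕ) : NExp := .get a (scalar i) (scalar j)

/-- The cell in column `0` of an array whose row is given by a scalar. -/
abbrev entry (a i : ℕ) : NExp := .get a (scalar i) (.const 0)

/-- A real scalar. -/
abbrev rscalar (a : ℕ) : RExp := .get a (.const 0) (.const 0)

/-- The cell of an array of reals whose indices are given by two scalars. -/
abbrev rcell (a i j : ℕ) : RExp := .get a (scalar i) (scalar j)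

/-- The natural number is nonzero. -/
abbrev nonzero (e : NExp) : BExp := .natLe (.const 1) e

/-- A loop over all pairs of vertices. -/
def loopPairs (i j : ℕ) (p : Prog) : Prog := .loop i nVerts (.loop j nVerts p)

/-- The index `(k, l)` of the invariant is the lexicographic position: the pairs before it are done.
`hnext` identifies the end of a row with the start of the next, and `hset` lets the invariant
survive the update of the outer counter. -/
lemma run_loopPairs_induction (I : ℕ → ℕ → Mem → Prop) {i j n : ℕ}
    (hij : i ≠ j) (hip : i ∉ p.natWrites)
    (hn : ∀ k l τ, I k l τ → τ.nat 0 0 0 = n)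
    (h0 : I 0 0 σ) (hset : ∀ k < n, ∀ τ, I k 0 τ → I k 0 (τ.setNat i 0 0 k))
    (hnext : ∀ k < n, ∀ τ, I k n τ → I (k + 1) 0 τ)
    (hs : ∀ k < n, ∀ l < n, ∀ τ, I k l τ → τ.nat i 0 0 = k →
      I k (l + 1) (p.run ε (τ.setNat j 0 0 l))) :
    I n 0 ((loopPairs i j p).run ε σ) := by
  refine run_loop_induction (fun k τ => I k 0 τ) (hn 0 0 σ h0) h0 fun k hk τ hτ => ?_
  have h1 := hset k hk τ hτ
  refine hnext k hk _ (run_loop_induction (m := nVerts) (fun l τ => I k l τ ∧ τ.nat i 0 0 = k)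
    (hn k 0 _ h1) ⟨h1, by simp⟩ fun l hl υ hυ => ⟨hs k hk l hl υ hυ.1 hυ.2, ?_⟩).1
  rw [(agreeOff_run p _).nat i hip]
  simp [hij, hυ.2]

/-- Set the cell `(i, j)` of an array for all pairs `i, j`. -/
lemma run_loopPairs_fillNat {A B : List ℕ} {n d i j : ℕ} (f : Fin n → Fin n → ℕ)
    (hij : i ≠ j) (hip : i ∉ p.natWrites) (hi : i ∈ A) (hj : j ∈ A) (h0A : 0 ∉ A)
    (hpA : p.natWrites ⊆ A) (hpB : p.realWrites ⊆ B) (hdi : d ≠ i) (hdj : d ≠ j)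
    (hn : σ.nat 0 0 0 = n)
    (hp : ∀ τ, σ.AgreeOff A B τ → ∀ x y : Fin n, τ.nat i 0 0 = x → τ.nat j 0 0 = y →
      τ.nat d x y = σ.nat d x y → ∀ x' y' : ℕ, (p.run ε τ).nat d x' y' =
        if x' = x ∧ y' = y then f x y else τ.nat d x' y') :
    ∀ x y : Fin n, ((loopPairs i j p).run ε σ).nat d x y = f x y := by
  have := run_loopPairs_induction (p := p) (ε := ε) (σ := σ) (n := n) (i := i) (j := j)
    (fun k l τ => σ.AgreeOff A B τ ∧ ∀ x y : Fin n, τ.nat d x y =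
      if (x : ℕ) < k ∨ ((x : ℕ) = k ∧ (y : ℕ) < l) then f x y else σ.nat d x y) hij hip
    (fun k l τ h => by rw [h.1.nat 0 h0A, hn])
    ⟨.refl σ, by simp⟩
    (fun k _ τ h => ⟨h.1.setNat hi, fun x y => by
      rw [τ.nat_setNat_of_ne hdi]; exact h.2 x y⟩)
    (fun k _ τ h => ⟨h.1, fun x y => by
      rw [h.2]
      have hy := y.2
      congr 1
      apply propext
      omega⟩)
    (fun k hk l hl τ h hik => by
      refine ⟨(h.1.setNat hj).trans (agreeOff_run_of_subset _ hpA hpB), fun x y => ?_⟩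
      have hd := τ.nat_setNat_of_ne (i := 0) (j := 0) (k := l) hdj
      rw [hp (τ.setNat j 0 0 l) (h.1.setNat hj) ⟨k, hk⟩ ⟨l, hl⟩ (by simp [hij, hik]) (by simp) (by
        rw [hd, h.2]; simp), hd, h.2]
      simp only
      by_cases hxy : (x : ℕ) = k ∧ (y : ℕ) = l
      · obtain ⟨rfl, rfl⟩ := hxy
        simp
      · rw [if_neg hxy]
        congr 1
        apply propext
        omega)
  intro x y
  rw [this.2]
  simp

/-- Set the cell `(i, j)` of an array of reals for all pairs `i, j`. -/
lemma run_loopPairs_fillReal {A B : List ℕ} {n d i j : ℕ} (f : Fin n → Fin n → ℝ≥0)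
    (hij : i ≠ j) (hip : i ∉ p.natWrites) (hi : i ∈ A) (hj : j ∈ A) (h0A : 0 ∉ A)
    (hpA : p.natWrites ⊆ A) (hpB : p.realWrites ⊆ B) (hn : σ.nat 0 0 0 = n)
    (hp : ∀ τ, σ.AgreeOff A B τ → ∀ x y : Fin n, τ.nat i 0 0 = x → τ.nat j 0 0 = y →
      ∀ x' y' : ℕ, (p.run ε τ).real d x' y' =
        if x' = x ∧ y' = y then f x y else τ.real d x' y') :
    ∀ x y : Fin n, ((loopPairs i j p).run ε σ).real d x y = f x y := by
  have := run_loopPairs_induction (p := p) (ε := ε) (σ := σ) (n := n) (i := i) (j := j)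
    (fun k l τ => σ.AgreeOff A B τ ∧ ∀ x y : Fin n,
      ((x : ℕ) < k ∨ ((x : ℕ) = k ∧ (y : ℕ) < l)) → τ.real d x y = f x y) hij hip
    (fun k l τ h => by rw [h.1.nat 0 h0A, hn])
    ⟨.refl σ, by simp⟩
    (fun k _ τ h => ⟨h.1.setNat hi, h.2⟩)
    (fun k _ τ h => ⟨h.1, fun x y hxy => h.2 x y (by have := y.2; omega)⟩)
    (fun k hk l hl τ h hik => by
      refine ⟨(h.1.setNat hj).trans (agreeOff_run_of_subset _ hpA hpB), fun x y hxy => ?_⟩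
      rw [hp (τ.setNat j 0 0 l) (h.1.setNat hj) ⟨k, hk⟩ ⟨l, hl⟩ (by simp [hij, hik]) (by simp)]
      simp only [Mem.real_setNat]
      split_ifs with heq
      · obtain ⟨rfl, rfl⟩ := heq
        rfl
      · exact h.2 x y (by omega))
  exact fun x y => this.2 x y (by simp)

/-- Find a pair of vertices that satisfies a condition and minimizes a value: the loop variables
are `50` and `51`, the flag `52` tells whether there is such a pair, and the pair is returned in
`53` and `54`, its value in the real `50`. -/
def argmin (c : BExp) (x : RExp) : Prog :=
  .seq (.setNat 52 (.const 0) (.const 0) (.const 0))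
    (loopPairs 50 51
      (.ite (.and c (.not (.and (nonzero (scalar 52)) (.realLe (rscalar 50) x))))
        (.seq (.setNat 52 (.const 0) (.const 0) (.const 1))
          (.seq (.setNat 53 (.const 0) (.const 0) (scalar 50))
            (.seq (.setNat 54 (.const 0) (.const 0) (scalar 51))
              (.setReal 50 (.const 0) (.const 0) x))))
        .skip))

lemma natWrites_argmin (c : BExp) (x : RExp) :
    (argmin c x).natWrites = [52, 50, 51, 52, 53, 54] := rfl

lemma realWrites_argmin (c : BExp) (x : RExp) : (argmin c x).realWrites = [50] := rfl

lemma agreeOff_argmin (c : BExp) (x : RExp) (σ : Mem) :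
    σ.AgreeOff [50, 51, 52, 53, 54] [50] ((argmin c x).run ε σ) :=
  agreeOff_run_of_subset σ (by rw [natWrites_argmin]; decide) (by rw [realWrites_argmin]; decide)

lemma run_argmin {n : ℕ} {c : BExp} {x : RExp} (C : Fin n → Fin n → Prop)
    (f : Fin n → Fin n → ℝ≥0) (hn : σ.nat 0 0 0 = n)
    (hcx : ∀ τ, σ.AgreeOff [50, 51, 52, 53, 54] [50] τ → ∀ i j : Fin n, τ.nat 50 0 0 = i →
      τ.nat 51 0 0 = j → (c.eval ε τ ↔ C i j) ∧ (C i j → x.eval ε τ = f i j)) :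
    (((argmin c x).run ε σ).nat 52 0 0 = 0 ∧ ∀ i j, ¬ C i j) ∨
    (((argmin c x).run ε σ).nat 52 0 0 = 1 ∧ ∃ i j, C i j ∧
      ((argmin c x).run ε σ).nat 53 0 0 = i ∧ ((argmin c x).run ε σ).nat 54 0 0 = j ∧
      ((argmin c x).run ε σ).real 50 0 0 = f i j ∧ ∀ i' j', C i' j' → f i j ≤ f i' j') := by
  set A := [50, 51, 52, 53, 54]
  have := run_loopPairs_induction (ε := ε) (n := n) (i := 50) (j := 51)
    (p := (.ite (.and c (.not (.and (nonzero (scalar 52)) (.realLe (rscalar 50) x))))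
        (.seq (.setNat 52 (.const 0) (.const 0) (.const 1))
          (.seq (.setNat 53 (.const 0) (.const 0) (scalar 50))
            (.seq (.setNat 54 (.const 0) (.const 0) (scalar 51))
              (.setReal 50 (.const 0) (.const 0) x))))
        .skip))
    (σ := σ.setNat 52 0 0 0)
    (fun k l τ => σ.AgreeOff A [50] τ ∧
      ((τ.nat 52 0 0 = 0 ∧ ∀ i j : Fin n, ((i : ℕ) < k ∨ ((i : ℕ) = k ∧ (j : ℕ) < l)) → ¬ C i j) ∨
      (τ.nat 52 0 0 = 1 ∧ ∃ i j, C i j ∧ τ.nat 53 0 0 = i ∧ τ.nat 54 0 0 = j ∧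
        τ.real 50 0 0 = f i j ∧ ∀ i' j' : Fin n, ((i' : ℕ) < k ∨ ((i' : ℕ) = k ∧ (j' : ℕ) < l)) →
          C i' j' → f i j ≤ f i' j')))
    (by decide) (by simp [Prog.natWrites])
    (fun k l τ h => by rw [h.1.nat 0 (by decide), hn])
    ⟨(Mem.AgreeOff.refl σ).setNat (by decide), Or.inl (by simp)⟩
    (fun k _ τ h => ⟨h.1.setNat (by decide), by simpa using h.2⟩)
    (fun k _ τ h => ⟨h.1, by
      have key : ∀ i j : Fin n, ((i : ℕ) < k + 1 ∨ ((i : ℕ) = k + 1 ∧ (j : ℕ) < 0)) →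
          ((i : ℕ) < k ∨ ((i : ℕ) = k ∧ (j : ℕ) < n)) := fun i j h => by
        have := j.2; omega
      rcases h.2 with ⟨h1, h2⟩ | ⟨h1, i, j, hC, hi, hj, hf, hmin⟩
      · exact Or.inl ⟨h1, fun i j hij => h2 i j (key i j hij)⟩
      · exact Or.inr ⟨h1, i, j, hC, hi, hj, hf, fun i' j' hij => hmin i' j' (key i' j' hij)⟩⟩)
    (fun k hk l hl τ h hik => by
      set υ := τ.setNat 51 0 0 l with hυ
      have hυA : σ.AgreeOff A [50] υ := h.1.setNat (by decide)
      refine ⟨hυA.trans (agreeOff_run_of_subset _ (by simp [Prog.natWrites, A])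
        (by simp [Prog.realWrites])), ?_⟩
      obtain ⟨hc, hx⟩ := hcx υ hυA ⟨k, hk⟩ ⟨l, hl⟩ (by simp [hυ, hik]) (by simp [hυ])
      have h52 : υ.nat 52 0 0 = τ.nat 52 0 0 := by simp [hυ]
      have h50 : υ.nat 50 0 0 = k := by simp [hυ, hik]
      have h51 : υ.nat 51 0 0 = l := by simp [hυ]
      have h53 : υ.nat 53 0 0 = τ.nat 53 0 0 := by simp [hυ]
      have h54 : υ.nat 54 0 0 = τ.nat 54 0 0 := by simp [hυ]
      have hr50 : υ.real 50 0 0 = τ.real 50 0 0 := by simp [hυ]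
      have hcase : ∀ i j : Fin n, ((i : ℕ) < k ∨ ((i : ℕ) = k ∧ (j : ℕ) < l + 1)) →
          ((i : ℕ) < k ∨ ((i : ℕ) = k ∧ (j : ℕ) < l)) ∨ (i = ⟨k, hk⟩ ∧ j = ⟨l, hl⟩) := by
        intro i j hij
        simp only [Fin.ext_iff]
        omega
      by_cases hb : (BExp.and c (.not (.and (nonzero (scalar 52))
          (.realLe (rscalar 50) x)))).eval ε υ
      · rw [run_ite_pos hb]
        have hC := hc.1 hb.1
        have hxv := hx hC
        have hb2 := hb.2
        simp only [BExp.eval, NExp.eval, RExp.eval, h52, hr50, hxv] at hb2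
        simp only [run_seq, run_setNat, run_setReal, Mem.real_setReal, Mem.nat_setReal,
          NExp.eval, Mem.nat_setNat, Mem.real_setNat, h50, h51]
        refine Or.inr ⟨by simp, ⟨k, hk⟩, ⟨l, hl⟩, hC, by simp, by simp, ?_, ?_⟩
        · simp only [and_self, if_true]
          -- The value is evaluated after the scalars `52`, `53`, `54` have been overwritten. This
          -- is why `hcx` quantifies over all memories that differ in the scratch arrays.
          refine ((hcx _ ?_ ⟨k, hk⟩ ⟨l, hl⟩ ?_ ?_).2 hC)
          · exact ((hυA.setNat (by decide)).setNat (by decide)).setNat (by decide)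
          · simp [h50]
          · simp [h51]
        · intro i' j' hij hC'
          rcases hcase i' j' hij with hold | ⟨rfl, rfl⟩
          · rcases h.2 with ⟨-, h2⟩ | ⟨h1, i, j, -, -, -, hf, hmin⟩
            · exact absurd hC' (h2 i' j' hold)
            · rw [h1, hf] at hb2
              simp only [le_refl, true_and, not_le] at hb2
              exact hb2.le.trans (hmin i' j' hold hC')
          · exact le_rfl
      · rw [run_ite_neg hb, run_skip, h52, h53, h54, hr50]
        simp only [BExp.eval, NExp.eval, RExp.eval, h52, hr50, hc] at hb
        replace hb := fun hC => not_not.1 (not_and.1 hb hC)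
        rcases h.2 with ⟨h1, h2⟩ | ⟨h1, i, j, hC, hi, hj, hf, hmin⟩
        · refine Or.inl ⟨h1, fun i j hij hC => ?_⟩
          rcases hcase i j hij with hold | ⟨rfl, rfl⟩
          · exact h2 i j hold hC
          · have := (hb hC).1
            omega
        · refine Or.inr ⟨h1, i, j, hC, hi, hj, hf, fun i' j' hij hC' => ?_⟩
          rcases hcase i' j' hij with hold | ⟨rfl, rfl⟩
          · exact hmin i' j' hold hC'
          · have := (hb hC').2
            rwa [hx hC', hf] at this)
  have hrun : (argmin c x).run ε σ = (loopPairs 50 51 (.ite (.and c (.not (.and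
      (nonzero (scalar 52)) (.realLe (rscalar 50) x))))
        (.seq (.setNat 52 (.const 0) (.const 0) (.const 1))
          (.seq (.setNat 53 (.const 0) (.const 0) (scalar 50))
            (.seq (.setNat 54 (.const 0) (.const 0) (scalar 51))
              (.setReal 50 (.const 0) (.const 0) x))))
        .skip)).run ε (σ.setNat 52 0 0 0) := rfl
  rw [hrun]
  rcases this.2 with ⟨h1, h2⟩ | ⟨h1, i, j, hC, hi, hj, hf, hmin⟩
  · exact Or.inl ⟨h1, fun i j => h2 i j (Or.inl i.2)⟩
  · exact Or.inr ⟨h1, i, j, hC, hi, hj, hf, fun i' j' => hmin i' j' (Or.inl i'.2)⟩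

end Machine


/-! ## Shortest paths -/

section ShortestPaths

/-- One round of Dijkstra's algorithm with the source in the scalar `60`, on the graph with
adjacency matrix in array `4`. -/
def dijkstraUpdate : Prog :=
  .seq (.setNat 11 (scalar 60) (scalar 54) (.const 1))
    (.seq (.setNat 10 (scalar 60) (scalar 54) (scalar 53))
      (.seq (.setReal 10 (scalar 60) (scalar 54) (rscalar 50))
        (.ite (.realLe (rcell 0 53 54) (rcell 11 60 53))
          (.setReal 11 (scalar 60) (scalar 54) (rcell 11 60 53))
          (.setReal 11 (scalar 60) (scalar 54) (rcell 0 53 54)))))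

def dijkstraCond : BExp :=
  .and (nonzero (cell 11 60 50)) (.and (.not (nonzero (cell 11 60 51))) (nonzero (cell 4 50 51)))

def dijkstraRound : Prog :=
  .seq (argmin dijkstraCond (.add (rcell 10 60 50) (rcell 0 50 51)))
    (.ite (nonzero (scalar 52)) dijkstraUpdate .skip)

def dijkstraInit : Prog :=
  .seq (.setNat 11 (scalar 60) (scalar 60) (.const 1))
    (.seq (.setReal 10 (scalar 60) (scalar 60) .zero) (.setReal 11 (scalar 60) (scalar 60) .zero))

/-- All pairs shortest paths: the flags of reachability are in array `11`, the parents in array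
`10`, the distances and the maximal edge weights on the paths in the arrays `10` and `11` of
reals. -/
def allShortestPaths : Prog :=
  .seq (loopPairs 63 64 (.setNat 11 (scalar 63) (scalar 64) (.const 0)))
    (.loop 60 nVerts (.seq dijkstraInit (.loop 61 nVerts dijkstraRound)))

variable {n : ℕ} {X : SimpleGraph (Fin n)} {w : Sym2 (Fin n) → ℝ≥0} {ε : ℝ≥0} {σ τ : Mem}

/-- The walk follows the pointers `par`. -/
def Follows (par : ℕ → ℕ) : ∀ {y u : Fin n}, X.Walk y u → Prop
  | _, _, .nil => True
  | y, _, .cons (v := x) _ q => par y = x ∧ Follows par q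

lemma Follows.congr {par par' : ℕ → ℕ} {y u : Fin n} {q : X.Walk y u} (h : Follows par q)
    (hp : ∀ z ∈ q.support, par' z = par z) : Follows par' q := by
  induction q with
  | nil => trivial
  | cons hx q ih =>
    exact ⟨(hp _ (by simp)).trans h.1, ih h.2 fun z hz => hp z (by simp [hz])⟩

/-- The arrays hold a shortest path to the source `u` at the vertex `y`. -/
def HasPathAt (X : SimpleGraph (Fin n)) (w : Sym2 (Fin n) → ℝ≥0) (u : Fin n) (σ : Mem)
    (y : Fin n) : Prop :=
  ∃ q : X.Walk y u, q.IsPath ∧ Follows (σ.nat 10 u) q ∧ σ.real 10 u y = walkWeight w q ∧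
    (σ.real 10 u y : ℝ≥0∞) = wdist w X u y ∧ σ.real 11 u y = walkMax w q ∧
    ∀ z ∈ q.support, 0 < σ.nat 11 u z

/-- The invariant of Dijkstra's algorithm. -/
def RowSound (X : SimpleGraph (Fin n)) (w : Sym2 (Fin n) → ℝ≥0) (u : Fin n) (σ : Mem) : Prop :=
  0 < σ.nat 11 u u ∧ ∀ y : Fin n, 0 < σ.nat 11 u y → HasPathAt X w u σ y

/-- The rows of the source `u` agree. -/
def RowEq (u : ℕ) (σ τ : Mem) : Prop :=
  τ.nat 10 u = σ.nat 10 u ∧ τ.nat 11 u = σ.nat 11 u ∧ τ.real 10 u = σ.real 10 u ∧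
    τ.real 11 u = σ.real 11 u

lemma RowSound.congr {u : Fin n} (h : RowSound X w u σ) (he : RowEq u σ τ) : RowSound X w u τ := by
  obtain ⟨h1, h2, h3, h4⟩ := he
  simpa only [RowSound, HasPathAt, h1, h2, h3, h4] using h

lemma Mem.AgreeOff.rowEq {A B : List ℕ} (h : σ.AgreeOff A B τ) (hA : 10 ∉ A ∧ 11 ∉ A)
    (hB : 10 ∉ B ∧ 11 ∉ B) (u : ℕ) : RowEq u σ τ :=
  ⟨by rw [h.nat 10 hA.1], by rw [h.nat 11 hA.2], by rw [h.real 10 hB.1], by rw [h.real 11 hB.2]⟩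

lemma RowEq.trans {u : ℕ} {υ : Mem} (h : RowEq u σ τ) (h' : RowEq u τ υ) : RowEq u σ υ :=
  ⟨h'.1.trans h.1, h'.2.1.trans h.2.1, h'.2.2.1.trans h.2.2.1, h'.2.2.2.trans h.2.2.2⟩

lemma run_dijkstraUpdate {u i j : ℕ} (hu : σ.nat 60 0 0 = u) (hi : σ.nat 53 0 0 = i)
    (hj : σ.nat 54 0 0 = j) :
    (∀ a b, (dijkstraUpdate.run ε σ).nat 11 a b = if a = u ∧ b = j then 1 else σ.nat 11 a b) ∧
    (∀ a b, (dijkstraUpdate.run ε σ).nat 10 a b = if a = u ∧ b = j then i else σ.nat 10 a b) ∧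
    (∀ a b, (dijkstraUpdate.run ε σ).real 10 a b =
      if a = u ∧ b = j then σ.real 50 0 0 else σ.real 10 a b) ∧
    (∀ a b, (dijkstraUpdate.run ε σ).real 11 a b =
      if a = u ∧ b = j then max (σ.real 0 i j) (σ.real 11 u i) else σ.real 11 a b) := by
  set τ : Mem := ((σ.setNat 11 u j 1).setNat 10 u j i).setReal 10 u j (σ.real 50 0 0) with hτ
  have hrun : dijkstraUpdate.run ε σ =
      τ.setReal 11 u j (max (σ.real 0 i j) (σ.real 11 u i)) := by
    have h0 : dijkstraUpdate.run ε σ =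
        (Prog.ite (.realLe (rcell 0 53 54) (rcell 11 60 53))
          (.setReal 11 (scalar 60) (scalar 54) (rcell 11 60 53))
          (.setReal 11 (scalar 60) (scalar 54) (rcell 0 53 54))).run ε τ := by
      simp [dijkstraUpdate, hτ, hu, hi, hj]
    rw [h0]
    have h60 : τ.nat 60 0 0 = u := by simp [hτ, hu]
    have h53 : τ.nat 53 0 0 = i := by simp [hτ, hi]
    have h54 : τ.nat 54 0 0 = j := by simp [hτ, hj]
    have hr0 : τ.real 0 i j = σ.real 0 i j := by simp [hτ]
    have hr11 : τ.real 11 u i = σ.real 11 u i := by simp [hτ]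
    by_cases hle : σ.real 0 i j ≤ σ.real 11 u i
    · rw [run_ite_pos (by simpa [h60, h53, h54, hr0, hr11] using hle), max_eq_right hle]
      simp [h60, h53, h54, hr11]
    · rw [run_ite_neg (by simpa [h60, h53, h54, hr0, hr11] using hle),
        max_eq_left (not_le.1 hle).le]
      simp [h60, h53, h54, hr0]
  rw [hrun]
  refine ⟨fun a b => ?_, fun a b => ?_, fun a b => ?_, fun a b => ?_⟩ <;> simp [hτ]

/-- Dijkstra's choice: the vertex nearest to the source across the boundary. -/
lemma wdist_eq_of_min_boundary {R : Fin n → Prop} {d : Fin n → ℝ≥0} {u i j : Fin n} (hu : R u)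
    (hd : ∀ x, R x → (d x : ℝ≥0∞) = wdist w X u x) (hi : R i) (hj : ¬ R j) (hij : X.Adj i j)
    (hmin : ∀ x y, R x → ¬ R y → X.Adj x y → d i + w s(i, j) ≤ d x + w s(x, y)) :
    ((d i + w s(i, j) : ℝ≥0) : ℝ≥0∞) = wdist w X u j := by
  apply le_antisymm
  -- Follow a walk from the reached set to its complement. As long as it stays inside, exactness of
  -- `d` absorbs each step; the first crossing edge is bounded below by minimality, and the rest has
  -- nonnegative weight.
  · have key : ∀ {a b : Fin n} (p : X.Walk a b), R a → ¬ R b →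
        d i + w s(i, j) ≤ d a + walkWeight w p := by
      intro a b p
      induction p with
      | nil => exact fun h h' => absurd h h'
      | @cons a x b h p ih =>
        intro ha hb
        rw [walkWeight_cons]
        by_cases hx : R x
        · refine (ih hx hb).trans ?_
          rw [← add_assoc]
          gcongr
          rw [← ENNReal.coe_le_coe, ENNReal.coe_add, hd a ha, hd x hx]
          exact (wdist_triangle (v := a)).trans (by gcongr; exact wdist_le_of_adj h)
        · refine (hmin a x ha hx h).trans ?_
          gcongr
          exact le_self_add
    have hd0 : d u = 0 := by
      have := hd u hu
      rw [wdist_self] at this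
      exact_mod_cast this
    refine le_iInf fun p => ?_
    have := key p hu hj
    rw [hd0, zero_add] at this
    exact_mod_cast this
  · rw [ENNReal.coe_add, hd i hi]
    exact (wdist_triangle (v := i)).trans (by gcongr; exact wdist_le_of_adj hij)

/-- Array `4` holds the graph `X`, and the real array `0` its edge weights. -/
structure HoldsGraph (X : SimpleGraph (Fin n)) (w : Sym2 (Fin n) → ℝ≥0) (σ : Mem) : Prop where
  size : σ.nat 0 0 0 = n
  adj : ∀ i j : Fin n, 0 < σ.nat 4 i j ↔ X.Adj i j
  weight : ∀ i j : Fin n, X.Adj i j → σ.real 0 i j = w s(i, j)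

lemma HoldsGraph.of_agreeOff {A B : List ℕ} (h : HoldsGraph X w σ) (ha : σ.AgreeOff A B τ)
    (hA : 0 ∉ A ∧ 4 ∉ A) (hB : 0 ∉ B) : HoldsGraph X w τ := by
  refine ⟨?_, fun i j => ?_, fun i j => ?_⟩
  · rw [ha.nat 0 hA.1, h.size]
  · rw [ha.nat 4 hA.2, h.adj]
  · rw [ha.real 0 hB]; exact h.weight i j

open Classical in
/-- The number of vertices reached from `u`. -/
def reachedCard (n : ℕ) (u : ℕ) (σ : Mem) : ℕ :=
  (Finset.univ.filter fun y : Fin n => 0 < σ.nat 11 u y).card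

lemma run_dijkstraRound (hX : HoldsGraph X w σ) {u : Fin n} (hu : σ.nat 60 0 0 = u)
    (hs : RowSound X w u σ) :
    RowSound X w u (dijkstraRound.run ε σ) ∧
    (∀ u' : ℕ, u' ≠ u → RowEq u' σ (dijkstraRound.run ε σ)) ∧
    ((RowEq u σ (dijkstraRound.run ε σ) ∧
        ∀ x y : Fin n, X.Adj x y → 0 < σ.nat 11 u x → 0 < σ.nat 11 u y) ∨
      reachedCard n u σ < reachedCard n u (dijkstraRound.run ε σ)) := by
  classical
  set ρ := (argmin dijkstraCond (.add (rcell 10 60 50) (rcell 0 50 51))).run ε σ with hρ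
  have hag : σ.AgreeOff [50, 51, 52, 53, 54] [50] ρ := agreeOff_argmin _ _ _
  have hrow : ∀ u, RowEq u σ ρ := hag.rowEq (by decide) (by decide)
  have hrun : dijkstraRound.run ε σ =
      (Prog.ite (nonzero (scalar 52)) dijkstraUpdate .skip).run ε ρ := rfl
  have harg := run_argmin (ε := ε) (σ := σ) (c := dijkstraCond)
    (x := .add (rcell 10 60 50) (rcell 0 50 51))
    (fun i j : Fin n => 0 < σ.nat 11 u i ∧ ¬ 0 < σ.nat 11 u j ∧ X.Adj i j)
    (fun i j => σ.real 10 u i + w s(i, j)) hX.size (by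
      intro τ hτ i j hi hj
      have h60 : τ.nat 60 0 0 = u := by rw [hτ.nat 60 (by decide), hu]
      constructor
      · simp only [dijkstraCond, BExp.eval, NExp.eval, h60, hi, hj, hτ.nat 11 (by decide),
          hτ.nat 4 (by decide), ← hX.adj i j]
        rfl
      · intro hC
        simp only [RExp.eval, NExp.eval, h60, hi, hj, hτ.real 10 (by decide),
          hτ.real 0 (by decide), hX.weight i j hC.2.2])
  rcases harg with ⟨h52, hnone⟩ | ⟨h52, i, j, ⟨hi, hj, hij⟩, h53, h54, hr50, hmin⟩
  · have : dijkstraRound.run ε σ = ρ := by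
      rw [hrun, run_ite_neg, run_skip]
      simp [hρ, h52]
    rw [this]
    refine ⟨hs.congr (hrow u), fun u' _ => hrow u', Or.inl ⟨hrow u, fun x y hxy hx => ?_⟩⟩
    by_contra hy
    exact hnone x y ⟨hx, hy, hxy⟩
  · rw [← hρ] at h52 h53 h54 hr50
    have : dijkstraRound.run ε σ = dijkstraUpdate.run ε ρ := by
      rw [hrun, run_ite_pos]
      simp [h52]
    rw [this]
    obtain ⟨e1, e2, e3, e4⟩ := run_dijkstraUpdate (ε := ε) (σ := ρ) (u := u)
      (by rw [hag.nat 60 (by decide), hu]) h53 h54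
    set τ := dijkstraUpdate.run ε ρ
    rw [hag.nat 11 (by decide)] at e1
    rw [hag.nat 10 (by decide)] at e2
    rw [hag.real 10 (by decide), hr50] at e3
    rw [hag.real 11 (by decide), hag.real 0 (by decide), hX.weight i j hij] at e4
    have hne : ∀ z : Fin n, 0 < σ.nat 11 u z → z ≠ j := fun z hz h => hj (h ▸ hz)
    have hmono : ∀ z : Fin n, 0 < σ.nat 11 u z → 0 < τ.nat 11 u z := fun z hz => by
      rw [e1]; split_ifs <;> simp [hz]
    refine ⟨⟨hmono u hs.1, fun y hy => ?_⟩, fun u' hu' => ?_, Or.inr ?_⟩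
    · by_cases hyj : y = j
      · subst hyj
        obtain ⟨q, hq, hfol, hw, hd, hm, hsup⟩ := hs.2 i hi
        have hyq : y ∉ q.support := fun h => hj (hsup y h)
        refine ⟨.cons hij.symm q, ?_, ⟨?_, ?_⟩, ?_, ?_, ?_, ?_⟩
        · exact (SimpleGraph.Walk.cons_isPath_iff _ _).2 ⟨hq, hyq⟩
        · simp [e2]
        -- The path from `i` runs through reached vertices only, so writing the pointer of the
        -- unreached vertex `y` does not disturb it.
        · refine hfol.congr fun z hz => ?_
          have : (z : ℕ) ≠ y := fun h => hyq (Fin.ext h ▸ hz)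
          simp [e2, this]
        · rw [e3, if_pos ⟨rfl, rfl⟩, walkWeight_cons, hw, add_comm, Sym2.eq_swap]
        · rw [e3, if_pos ⟨rfl, rfl⟩]
          refine wdist_eq_of_min_boundary (R := fun z => 0 < σ.nat 11 u z)
            (d := fun z => σ.real 10 u z) hs.1 (fun x hx => ?_) hi hj hij
            fun x z hx hz hxz => hmin x z ⟨hx, hz, hxz⟩
          obtain ⟨-, -, -, -, hd, -⟩ := hs.2 x hx
          exact hd
        · rw [e4, if_pos ⟨rfl, rfl⟩, walkMax_cons, hm, Sym2.eq_swap]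
        · intro z hz
          rw [SimpleGraph.Walk.support_cons, List.mem_cons] at hz
          rcases hz with rfl | hz
          · exact hy
          · exact hmono z (hsup z hz)
      · have hyj' : (y : ℕ) ≠ j := fun h => hyj (Fin.ext h)
        rw [e1, if_neg (by simp [hyj'])] at hy
        obtain ⟨q, hq, hfol, hw, hd, hm, hsup⟩ := hs.2 y hy
        refine ⟨q, hq, hfol.congr fun z hz => ?_, ?_, ?_, ?_, fun z hz => hmono z (hsup z hz)⟩
        · have : (z : ℕ) ≠ j := fun h => hne z (hsup z hz) (Fin.ext h)
          simp [e2, this]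
        · simp [e3, hyj', hw]
        · simp [e3, hyj', hd]
        · simp [e4, hyj', hm]
    · refine ⟨?_, ?_, ?_, ?_⟩ <;> ext b <;> simp [e1, e2, e3, e4, hu']
    · refine Finset.card_lt_card ⟨fun z hz => ?_, fun h => ?_⟩
      · simp only [Finset.mem_filter, Finset.mem_univ, true_and] at hz ⊢
        exact hmono z hz
      · have := h (Finset.mem_filter.2 ⟨Finset.mem_univ j, by simp [e1]⟩)
        simp only [Finset.mem_filter, Finset.mem_univ, true_and] at this
        exact hj this

/-- The arrays hold shortest paths to the source `u` at all vertices reachable from `u`. -/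
def RowComplete (X : SimpleGraph (Fin n)) (w : Sym2 (Fin n) → ℝ≥0) (u : Fin n) (σ : Mem) : Prop :=
  ∀ y : Fin n, X.Reachable u y → HasPathAt X w u σ y

lemma RowComplete.congr {u : Fin n} (h : RowComplete X w u σ) (he : RowEq u σ τ) :
    RowComplete X w u τ := by
  obtain ⟨h1, h2, h3, h4⟩ := he
  simpa only [RowComplete, HasPathAt, h1, h2, h3, h4] using h

lemma run_dijkstra (hX : HoldsGraph X w σ) {u : Fin n} (hu : σ.nat 60 0 0 = u)
    (h0 : ∀ y : Fin n, σ.nat 11 u y = 0) :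
    RowComplete X w u ((Prog.seq dijkstraInit (.loop 61 nVerts dijkstraRound)).run ε σ) ∧
    ∀ u' : ℕ, u' ≠ u →
      RowEq u' σ ((Prog.seq dijkstraInit (.loop 61 nVerts dijkstraRound)).run ε σ) := by
  classical
  rw [run_seq]
  set τ₀ := dijkstraInit.run ε σ with hτ₀
  have hag₀ : σ.AgreeOff [11] [10, 11] τ₀ :=
    agreeOff_run_of_subset σ (by decide) (by decide)
  have e1 : ∀ a b, τ₀.nat 11 a b = if a = u ∧ b = u then 1 else σ.nat 11 a b := by
    intro a b; simp [hτ₀, dijkstraInit, hu]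
  have e3 : ∀ a b, τ₀.real 10 a b = if a = u ∧ b = u then 0 else σ.real 10 a b := by
    intro a b; simp [hτ₀, dijkstraInit, hu]
  have e4 : ∀ a b, τ₀.real 11 a b = if a = u ∧ b = u then 0 else σ.real 11 a b := by
    intro a b; simp [hτ₀, dijkstraInit, hu]
  have hrow₀ : ∀ u' : ℕ, u' ≠ u → RowEq u' σ τ₀ := fun u' hu' =>
    ⟨by rw [hag₀.nat 10 (by decide)], by ext b; simp [e1, hu'], by ext b; simp [e3, hu'],
      by ext b; simp [e4, hu']⟩
  have hs₀ : RowSound X w u τ₀ := by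
    refine ⟨by simp [e1], fun y hy => ?_⟩
    have hyu : y = u := by
      by_contra hne
      have : (y : ℕ) ≠ u := fun h => hne (Fin.ext h)
      simp [e1, this, h0] at hy
    subst hyu
    exact ⟨.nil, by simp, trivial, by simp [e3], by simp [e3], by simp [e4], by simp [e1]⟩
  -- Every round either reaches a new vertex or finds the reached set closed under adjacency. One
  -- vertex is reached at the start, so `n` rounds without closure would reach `n + 1` vertices.
  have hI := run_loop_induction (ε := ε) (a := 61) (m := nVerts) (n := n) (σ := τ₀)
    (p := dijkstraRound)
    (fun k τ => σ.AgreeOff [11, 10, 50, 51, 52, 53, 54, 61] [10, 11, 50] τ ∧ RowSound X w u τ ∧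
      (∀ u' : ℕ, u' ≠ u → RowEq u' σ τ) ∧
      ((∀ x y : Fin n, X.Adj x y → 0 < τ.nat 11 u x → 0 < τ.nat 11 u y) ∨
        k + 1 ≤ reachedCard n u τ))
    (hX.of_agreeOff hag₀ (by decide) (by decide)).size
    ⟨hag₀.mono (by decide) (by decide), hs₀, hrow₀, Or.inr (by
      rw [zero_add, reachedCard, Nat.succ_le_iff, Finset.card_pos]
      exact ⟨u, by simpa using hs₀.1⟩)⟩
    (by
      rintro k hk τ ⟨hag, hs, hrow, hc⟩
      have hr : ∀ u' : ℕ, RowEq u' τ (τ.setNat 61 0 0 k) :=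
        ((Mem.AgreeOff.refl τ).setNat (A := [61]) (B := []) (by decide)).rowEq
          (by decide) (by decide)
      have hag' : σ.AgreeOff [11, 10, 50, 51, 52, 53, 54, 61] [10, 11, 50]
          (τ.setNat 61 0 0 k) := hag.setNat (by decide)
      obtain ⟨h1, h2, h3⟩ := run_dijkstraRound (ε := ε)
        (hX.of_agreeOff hag' (by decide) (by decide))
        (by rw [hag'.nat 60 (by decide), hu]) (hs.congr (hr u))
      have hcard : reachedCard n u (τ.setNat 61 0 0 k) = reachedCard n u τ := rfl
      refine ⟨hag'.trans (agreeOff_run_of_subset _ (by decide) (by decide)), h1,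
        fun u' hu' => (hrow u' hu').trans ((hr u').trans (h2 u' hu')), ?_⟩
      rcases h3 with ⟨h3, h4⟩ | h3
      · left
        rw [h3.2.1]
        exact h4
      · rcases hc with hc | hc
        -- A closed reached set already contains the component of `u`, so it cannot grow.
        · exfalso
          rw [hcard] at h3
          have h5 : ∀ x : Fin n, X.Reachable u x → 0 < τ.nat 11 u x := by
            rintro x ⟨p⟩
            have : ∀ {a b : Fin n} (p : X.Walk a b), 0 < τ.nat 11 u a → 0 < τ.nat 11 u b := by
              intro a b p
              induction p with
              | nil => exact id
              | cons h p ih => exact fun ha => ih (hc _ _ h ha)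
            exact this p hs.1
          refine absurd h3 (not_lt.2 (Finset.card_le_card fun z hz => ?_))
          simp only [Finset.mem_filter, Finset.mem_univ, true_and] at hz ⊢
          obtain ⟨q, -⟩ := h1.2 z hz
          exact h5 z q.reachable.symm
        · right
          rw [hcard] at h3
          omega)
  obtain ⟨-, hs, hrow, hc⟩ := hI
  refine ⟨fun y hy => ?_, hrow⟩
  rcases hc with hc | hc
  · refine hs.2 y ?_
    obtain ⟨p⟩ := hy
    have : ∀ {a b : Fin n} (p : X.Walk a b),
        0 < ((Prog.loop 61 nVerts dijkstraRound).run ε τ₀).nat 11 u a →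
        0 < ((Prog.loop 61 nVerts dijkstraRound).run ε τ₀).nat 11 u b := by
      intro a b p
      induction p with
      | nil => exact id
      | cons h p ih => exact fun ha => ih (hc _ _ h ha)
    exact this p hs.1
  · have := hc.trans (Finset.card_le_univ _)
    simp at this

lemma agreeOff_allShortestPaths (σ : Mem) :
    σ.AgreeOff [10, 11, 50, 51, 52, 53, 54, 60, 61, 63, 64] [10, 11, 50]
      (allShortestPaths.run ε σ) :=
  agreeOff_run_of_subset σ (by decide) (by decide)

lemma run_allShortestPaths (hX : HoldsGraph X w σ) (u : Fin n) :
    RowComplete X w u (allShortestPaths.run ε σ) := by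
  rw [allShortestPaths, run_seq]
  set τ₀ := (loopPairs 63 64 (.setNat 11 (scalar 63) (scalar 64) (.const 0))).run ε σ with hτ₀
  have hag₀ : σ.AgreeOff [63, 64, 11] [] τ₀ := agreeOff_run_of_subset σ (by decide) (by decide)
  have h11 : ∀ x y : Fin n, τ₀.nat 11 x y = 0 :=
    run_loopPairs_fillNat (A := [63, 64, 11]) (B := []) (fun _ _ => 0) (by decide) (by decide)
      (by decide) (by decide) (by decide) (by decide) (by decide) (by decide) (by decide) hX.size
      (by intro τ _ x y hx hy _ x' y'; simp [hx, hy])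
  have hI := run_loop_induction (ε := ε) (a := 60) (m := nVerts) (n := n) (σ := τ₀)
    (p := .seq dijkstraInit (.loop 61 nVerts dijkstraRound))
    (fun k τ => σ.AgreeOff [10, 11, 50, 51, 52, 53, 54, 60, 61, 63, 64] [10, 11, 50] τ ∧
      ∀ u : Fin n, ((u : ℕ) < k → RowComplete X w u τ) ∧
        (k ≤ u → ∀ y : Fin n, τ.nat 11 u y = 0))
    (hX.of_agreeOff hag₀ (by decide) (by decide)).size
    ⟨hag₀.mono (by decide) (by decide), fun u => ⟨by simp, fun _ => h11 u⟩⟩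
    (by
      rintro k hk τ ⟨hag, hrows⟩
      have hr : ∀ u' : ℕ, RowEq u' τ (τ.setNat 60 0 0 k) :=
        ((Mem.AgreeOff.refl τ).setNat (A := [60]) (B := []) (by decide)).rowEq
          (by decide) (by decide)
      have hag' : σ.AgreeOff [10, 11, 50, 51, 52, 53, 54, 60, 61, 63, 64] [10, 11, 50]
          (τ.setNat 60 0 0 k) := hag.setNat (by decide)
      obtain ⟨h1, h2⟩ := run_dijkstra (ε := ε) (u := ⟨k, hk⟩)
        (hX.of_agreeOff hag' (by decide) (by decide)) (by simp)
        (by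
          intro y
          rw [(hr _).2.1]
          exact (hrows ⟨k, hk⟩).2 le_rfl y)
      refine ⟨hag'.trans (agreeOff_run_of_subset _ (by decide) (by decide)), fun u => ?_⟩
      by_cases huk : (u : ℕ) = k
      · obtain rfl : u = ⟨k, hk⟩ := Fin.ext huk
        exact ⟨fun _ => h1, fun h => by simp at h⟩
      · have he := (hr u).trans (h2 u huk)
        refine ⟨fun h => ((hrows u).1 (by omega)).congr he, fun h y => ?_⟩
        rw [he.2.1]
        exact (hrows u).2 (by omega) y)
  exact (hI.2 u).1 u.2

end ShortestPaths


/-! ## Tracing paths and growing Steiner trees -/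

section Trace

/-- One step of tracing a path. -/
def traceStep (v e : ℕ) : Prog :=
  .ite (.not (nonzero (entry v 57)))
    (.seq (.setNat v (scalar 57) (.const 0) (.const 1))
      (.seq (.setNat e (scalar 57) (cell 5 58 57) (.const 1))
        (.seq (.setNat e (cell 5 58 57) (scalar 57) (.const 1))
          (.setNat 57 (.const 0) (.const 0) (cell 5 58 57)))))
    .skip

/-- Follow the parents for the root in the scalar `58`, from the vertex in the scalar `57`, up to
the first vertex marked in the array `v`. Mark the vertices in `v` and the edges in `e`. -/
def trace (v e : ℕ) : Prog := .loop 56 nVerts (traceStep v e)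

variable {n : ℕ} {G : SimpleGraph (Fin n)} {w : Sym2 (Fin n) → ℝ≥0} {ε : ℝ≥0} {σ τ : Mem}

lemma run_traceStep_of_unmarked {v e c x r : ℕ} (hv : 58 < v ∨ v < 56 ∧ v ≠ 5)
    (he : 58 < e ∨ e < 56 ∧ e ≠ 5) (hve : v ≠ e) (hc : σ.nat 57 0 0 = c) (hr : σ.nat 58 0 0 = r)
    (hx : σ.nat 5 r c = x) (hm : σ.nat v c 0 = 0) :
    ((traceStep v e).run ε σ).nat 57 0 0 = x ∧
    (∀ a, ((traceStep v e).run ε σ).nat v a 0 = if a = c then 1 else σ.nat v a 0) ∧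
    (∀ a b, ((traceStep v e).run ε σ).nat e a b =
      if (a = c ∧ b = x) ∨ (a = x ∧ b = c) then 1 else σ.nat e a b) := by
  have h5v : 5 ≠ v := by omega
  have h5e : 5 ≠ e := by omega
  have h57v : 57 ≠ v := by omega
  have h57e : 57 ≠ e := by omega
  have h58v : 58 ≠ v := by omega
  have h58e : 58 ≠ e := by omega
  rw [traceStep, run_ite_pos (by simp [hc, hm])]
  have h57v' := h57v.symm
  have h57e' := h57e.symm
  have hev := hve.symm
  refine ⟨?_, fun a => ?_, fun a b => ?_⟩
  · simp [*]
  · simp [*]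
  · simp [*]
    by_cases h1 : a = x ∧ b = c <;> by_cases h2 : a = c ∧ b = x <;> simp [h1, h2]

lemma run_traceStep_of_marked {v e c : ℕ} (hc : σ.nat 57 0 0 = c) (hm : 0 < σ.nat v c 0) :
    (traceStep v e).run ε σ = σ := by
  rw [traceStep, run_ite_neg, run_skip]
  simp [hc, hm.ne']

lemma natWrites_trace (v e : ℕ) : (trace v e).natWrites = [56, v, e, e, 57] := rfl

lemma realWrites_trace (v e : ℕ) : (trace v e).realWrites = [] := rfl

lemma run_trace {v e : ℕ} (hv : 58 < v ∨ v < 56 ∧ v ≠ 5 ∧ v ≠ 0)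
    (he : 58 < e ∨ e < 56 ∧ e ≠ 5 ∧ e ≠ 0) (hve : v ≠ e) (hn : σ.nat 0 0 0 = n) {r y z : Fin n}
    (q : G.Walk y z) (hq : q.IsPath) (hr : σ.nat 58 0 0 = r) (hy : σ.nat 57 0 0 = y)
    (hfol : Follows (σ.nat 5 r) q) (hz : 0 < σ.nat v z 0)
    (hnew : ∀ x ∈ q.support, x ≠ z → σ.nat v x 0 = 0) :
    (∀ x : Fin n, 0 < ((trace v e).run ε σ).nat v x 0 ↔ 0 < σ.nat v x 0 ∨ x ∈ q.support) ∧
    (∀ i j : Fin n, ((trace v e).run ε σ).nat e i j =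
      if s(i, j) ∈ q.edges then 1 else σ.nat e i j) := by
  -- Marks made so far together with the untraced remainder `q'` form an invariant set, for vertices
  -- and for edges. The subtraction in `q.length - k` is truncated: after arrival at the marked
  -- vertex `z` the remaining rounds do nothing.
  have hI := run_loop_induction (ε := ε) (a := 56) (m := nVerts) (n := n) (σ := σ)
    (p := traceStep v e)
    (fun k τ => σ.AgreeOff [v, e, 56, 57] [] τ ∧ ∃ (y' : Fin n) (q' : G.Walk y' z), q'.IsPath ∧
      τ.nat 57 0 0 = y' ∧ Follows (σ.nat 5 r) q' ∧ q'.length ≤ q.length - k ∧ 0 < τ.nat v z 0 ∧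
      (∀ x ∈ q'.support, x ≠ z → τ.nat v x 0 = 0) ∧
      (∀ x : Fin n, (0 < τ.nat v x 0 ∨ x ∈ q'.support) ↔ (0 < σ.nat v x 0 ∨ x ∈ q.support)) ∧
      (∀ i j : Fin n, (if s(i, j) ∈ q'.edges then 1 else τ.nat e i j) =
        if s(i, j) ∈ q.edges then 1 else σ.nat e i j))
    hn ⟨.refl σ, y, q, hq, hy, hfol, by simp, hz, hnew, fun _ => Iff.rfl, fun _ _ => rfl⟩
    (by
      rintro k hk τ ⟨hag, y', q', hq', hy', hfol', hlen, hz', hnew', hV, hE⟩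
      set υ := τ.setNat 56 0 0 k with hυ
      have hagυ : σ.AgreeOff [v, e, 56, 57] [] υ := hag.setNat (by simp)
      have h57 : υ.nat 57 = τ.nat 57 := τ.nat_setNat_of_ne (by decide)
      have hvυ : υ.nat v = τ.nat v := τ.nat_setNat_of_ne (by omega)
      have heυ : υ.nat e = τ.nat e := τ.nat_setNat_of_ne (by omega)
      have h58 : υ.nat 58 0 0 = r := by
        rw [hagυ.nat 58 (by simp; omega), hr]
      have h5 : υ.nat 5 = σ.nat 5 := hagυ.nat 5 (by simp; omega)
      refine ⟨hagυ.trans (agreeOff_run_of_subset _ (by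
        intro a; simp [traceStep, Prog.natWrites]; tauto) (by simp [traceStep, Prog.realWrites])),
        ?_⟩
      cases q' with
      | nil =>
        rw [run_traceStep_of_marked (h57 ▸ hy') (hvυ ▸ hz')]
        rw [← h57] at hy'
        rw [← hvυ] at hz' hV hnew'
        rw [← heυ] at hE
        exact ⟨_, .nil, by simp, hy', trivial, by simp, hz', hnew', hV, hE⟩
      | @cons _ x _ h q' =>
        rw [SimpleGraph.Walk.cons_isPath_iff] at hq'
        have hy'z : y' ≠ z := fun h => hq'.2 (h ▸ q'.end_mem_support)
        obtain ⟨e1, e2, e3⟩ := run_traceStep_of_unmarked (ε := ε) (σ := υ) (v := v) (e := e)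
          (c := y')
          (x := x) (r := r)
          (by omega) (by omega) hve (by rw [h57]; exact hy') h58 (by rw [h5]; exact hfol'.1)
          (by rw [hvυ]; exact hnew' y' (by simp) hy'z)
        rw [hvυ] at e2
        rw [heυ] at e3
        refine ⟨x, q', hq'.1, e1, hfol'.2, ?_, ?_, ?_, ?_, ?_⟩
        · rw [SimpleGraph.Walk.length_cons] at hlen
          omega
        · rw [e2]; split_ifs
          · exact Nat.one_pos
          · exact hz'
        · intro a ha haz
          have : (a : ℕ) ≠ y' := fun h => hq'.2 (Fin.ext h ▸ ha)
          rw [e2, if_neg this]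
          exact hnew' a (by simp [ha]) haz
        · intro a
          rw [← hV a, e2]
          by_cases hay : a = y'
          · simp [hay]
          · have : (a : ℕ) ≠ y' := fun h => hay (Fin.ext h)
            simp [hay, this]
        · intro i j
          rw [← hE i j, e3]
          have hij : s(i, j) = s(y', x) ↔
              ((i : ℕ) = y' ∧ (j : ℕ) = x) ∨ ((i : ℕ) = x ∧ (j : ℕ) = y') := by
            simp [Fin.ext_iff]
          simp only [SimpleGraph.Walk.edges_cons, List.mem_cons, hij]
          by_cases h1 : s(i, j) ∈ q'.edges <;> simp [h1])
  obtain ⟨-, y', q', -, -, -, hlen, hz', -, hV, hE⟩ := hI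
  -- A path has fewer edges than there are vertices, so `n` rounds exhaust it.
  have hlt : q.length < n := by simpa using hq.length_lt
  cases q' with
  | nil =>
    refine ⟨fun x => ?_, fun i j => ?_⟩
    · rw [← hV x]
      refine ⟨Or.inl, ?_⟩
      rintro (h | h)
      · exact h
      · obtain rfl : x = z := by simpa using h
        exact hz'
    · rw [← hE i j]
      simp [trace]
  | cons h q' =>
    rw [SimpleGraph.Walk.length_cons] at hlen
    omega

end Trace

/-! ### Attaching nearest missing terminals. -/

section Extend

variable {n : ℕ} {G : SimpleGraph (Fin n)} {w : Sym2 (Fin n) → ℝ≥0} {ε : ℝ≥0} {σ τ : Mem}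

/-- The arrays `8` and `3` hold the vertices and the edges of the tree `T`. -/
structure HoldsTree (T : G.Subgraph) (σ : Mem) : Prop where
  verts : ∀ x : Fin n, 0 < σ.nat 8 x 0 ↔ x ∈ T.verts
  edges : ∀ i j : Fin n, (T.Adj i j → σ.nat 3 i j = 1) ∧ (¬ T.Adj i j → σ.nat 3 i j = 0)

lemma HoldsTree.of_agreeOff {A B : List ℕ} {T : G.Subgraph} (h : HoldsTree T σ)
    (ha : σ.AgreeOff A B τ) (hA : 3 ∉ A ∧ 8 ∉ A) : HoldsTree T τ := by
  refine ⟨fun x => ?_, fun i j => ?_⟩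
  · rw [ha.nat 8 hA.2]; exact h.verts x
  · rw [ha.nat 3 hA.1]; exact h.edges i j

/-- The parents in array `5` and the distances in the real array `1` describe shortest paths. -/
structure HoldsPaths (G : SimpleGraph (Fin n)) (w : Sym2 (Fin n) → ℝ≥0) (σ : Mem) : Prop where
  size : σ.nat 0 0 0 = n
  path : ∀ u y : Fin n, G.Reachable u y →
    ∃ q : G.Walk y u, q.IsPath ∧ Follows (σ.nat 5 u) q ∧ σ.real 1 u y = walkWeight w q
  dist : ∀ u y : Fin n, G.Reachable u y → (σ.real 1 u y : ℝ≥0∞) = wdist w G u y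

lemma HoldsPaths.of_agreeOff {A B : List ℕ} (h : HoldsPaths G w σ)
    (ha : σ.AgreeOff A B τ) (hA : 0 ∉ A ∧ 5 ∉ A) (hB : 1 ∉ B) : HoldsPaths G w τ := by
  refine ⟨?_, ?_, ?_⟩
  · rw [ha.nat 0 hA.1]; exact h.size
  · rw [ha.nat 5 hA.2, ha.real 1 hB]; exact h.path
  · rw [ha.real 1 hB]; exact h.dist

/-- Connect the nearest missing terminal to the tree. -/
def extendCond : BExp :=
  .and (nonzero (entry 8 50)) (.and (nonzero (entry 6 51)) (.not (nonzero (entry 8 51))))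

def extendAttach : Prog :=
  .seq (.setNat 58 (.const 0) (.const 0) (scalar 53))
    (.seq (.setNat 57 (.const 0) (.const 0) (scalar 54)) (trace 8 3))

def extendRound : Prog :=
  .seq (argmin extendCond (rcell 1 50 51)) (.ite (nonzero (scalar 52)) extendAttach .skip)

/-- Grow the tree until it contains all vertices marked in array `6`. -/
def extend : Prog := .loop 62 nVerts extendRound

/-- Cutting at the first vertex of `A` does not increase the weight and makes all earlier vertices
new, as `IsSubtree.sup_walk` requires. -/
lemma exists_prefix_hitting {par : ℕ → ℕ} {A : Set (Fin n)} {y u : Fin n} (q : G.Walk y u)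
    (hq : q.IsPath) (hfol : Follows par q) (hu : u ∈ A) :
    ∃ (z : Fin n) (q' : G.Walk y z), z ∈ A ∧ q'.IsPath ∧ Follows par q' ∧
      walkWeight w q' ≤ walkWeight w q ∧ (∀ x ∈ q'.support, x ≠ z → x ∉ A) ∧
      q'.support ⊆ q.support := by
  induction q with
  | nil => exact ⟨_, .nil, hu, by simp, trivial, le_rfl, by simp, by simp⟩
  | @cons y x u h q ih =>
    by_cases hy : y ∈ A
    · exact ⟨y, .nil, hy, by simp, trivial, by simp, by simp, by simp⟩
    · rw [SimpleGraph.Walk.cons_isPath_iff] at hq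
      obtain ⟨z, q', hz, hq', hfol', hw, hnew, hsub⟩ := ih hq.1 hfol.2 hu
      refine ⟨z, .cons h q', hz, ?_, ⟨hfol.1, hfol'⟩, ?_, ?_, ?_⟩
      · exact (SimpleGraph.Walk.cons_isPath_iff _ _).2 ⟨hq', fun h => hq.2 (hsub h)⟩
      · rw [walkWeight_cons, walkWeight_cons]; gcongr
      · intro a ha haz
        rw [SimpleGraph.Walk.support_cons, List.mem_cons] at ha
        rcases ha with rfl | ha
        · exact hy
        · exact hnew a ha haz
      · rw [SimpleGraph.Walk.support_cons, SimpleGraph.Walk.support_cons]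
        exact List.cons_subset_cons _ hsub

lemma subgraph_reachable {T : G.Subgraph} (hT : IsSubtree T) {a b : Fin n} (ha : a ∈ T.verts)
    (hb : b ∈ T.verts) : G.Reachable a b :=
  (subgraph_reachable_spanningCoe hT.1.coe ha hb).mono T.spanningCoe_le

/-- The attached path is the part of a shortest path, traced from the missing terminal, up to its
first tree vertex. It weighs no more than the distance from the tree to any missing terminal, which
is what `CompletesWithin.sup_walk` needs. -/
lemma run_extendRound (hP : HoldsPaths G w σ) {K : Set (Fin n)}
    (hK : ∀ x : Fin n, 0 < σ.nat 6 x 0 ↔ x ∈ K) {T : G.Subgraph} (hT : IsSubtree T)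
    (hTσ : HoldsTree T σ) {r : Fin n} (hr : r ∈ T.verts) (hrK : ∀ k ∈ K, G.Reachable r k) :
    (K ⊆ T.verts ∧ HoldsTree T (extendRound.run ε σ)) ∨
    ∃ T' : G.Subgraph, T ≤ T' ∧ T.verts ⊂ T'.verts ∧ IsSubtree T' ∧
      HoldsTree T' (extendRound.run ε σ) ∧
      ∀ B, CompletesWithin w K T B → CompletesWithin w K T' B := by
  set ρ := (argmin extendCond (rcell 1 50 51)).run ε σ with hρ
  have hag : σ.AgreeOff [50, 51, 52, 53, 54] [50] ρ := agreeOff_argmin _ _ _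
  have hrun : extendRound.run ε σ =
      (Prog.ite (nonzero (scalar 52)) extendAttach .skip).run ε ρ := rfl
  have harg := run_argmin (ε := ε) (σ := σ) (c := extendCond) (x := rcell 1 50 51)
    (fun i j : Fin n => i ∈ T.verts ∧ j ∈ K ∧ j ∉ T.verts) (fun i j => σ.real 1 i j) hP.size (by
      intro τ hτ i j hi hj
      constructor
      · simp only [extendCond, BExp.eval, NExp.eval, hi, hj, hτ.nat 8 (by decide),
          hτ.nat 6 (by decide), ← hK, ← hTσ.verts]
        rfl
      · intro _
        simp only [RExp.eval, NExp.eval, hi, hj, hτ.real 1 (by decide)])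
  rcases harg with ⟨h52, hnone⟩ | ⟨h52, i, j, ⟨hi, hjK, hj⟩, h53, h54, -, hmin⟩
  · left
    have : extendRound.run ε σ = ρ := by
      rw [hrun, run_ite_neg, run_skip]
      simp [hρ, h52]
    rw [this]
    refine ⟨fun k hk => ?_, hTσ.of_agreeOff hag (by decide)⟩
    by_contra hkT
    exact hnone r k ⟨hr, hk, hkT⟩
  · right
    rw [← hρ] at h52 h53 h54
    have hreach : ∀ a ∈ T.verts, ∀ k ∈ K, G.Reachable a k := fun a ha k hk =>
      (subgraph_reachable hT ha hr).trans (hrK k hk)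
    obtain ⟨q₀, hq₀, hfol₀, hw₀⟩ := hP.path i j (hreach i hi j hjK)
    obtain ⟨z, q, hz, hq, hfol, hw, hnew, -⟩ := exists_prefix_hitting (w := w) q₀ hq₀ hfol₀ hi
    set ρ' := (ρ.setNat 58 0 0 i).setNat 57 0 0 j with hρ'
    have hagρ' : ρ.AgreeOff [57, 58] [] ρ' :=
      ((Mem.AgreeOff.refl ρ).setNat (by decide)).setNat (by decide)
    have hag' := (hag.mono (A' := [50, 51, 52, 53, 54, 57, 58]) (by decide) (fun _ h => h)).trans
      (hagρ'.mono (B' := [50]) (by decide) (by decide))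
    have : extendRound.run ε σ = (trace 8 3).run ε ρ' := by
      rw [hrun, run_ite_pos (by simp [h52])]
      simp [extendAttach, hρ', h53, h54]
    rw [this]
    have h8 := hag'.nat 8 (by decide)
    have h3 := hag'.nat 3 (by decide)
    obtain ⟨hV, hE⟩ := run_trace (ε := ε) (v := 8) (e := 3) (σ := ρ') (r := i) (by decide)
      (by decide) (by decide) (by rw [hag'.nat 0 (by decide)]; exact hP.size) q hq
      (by simp [hρ']) (by simp [hρ']) (by rw [hag'.nat 5 (by decide)]; exact hfol)
      (by rw [h8, hTσ.verts]; exact hz)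
      (fun x hx hxz => by
        have := (hTσ.verts x).not.2 (hnew x hx hxz)
        rw [h8]; omega)
    refine ⟨T ⊔ q.toSubgraph, le_sup_left, ⟨?_, fun h => hj (h (by simp))⟩,
      hT.sup_walk q hq hz hnew, ⟨fun x => ?_, fun a b => ?_⟩, fun B hB => ?_⟩
    · exact fun x hx => by simp [hx]
    · rw [hV, h8, hTσ.verts]
      simp
    · rw [hE, h3, SimpleGraph.Subgraph.sup_adj, SimpleGraph.Walk.adj_toSubgraph_iff_mem_edges]
      have := hTσ.edges a b
      by_cases hab : s(a, b) ∈ q.edges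
      · simp [hab]
      · simpa [hab] using this
    · refine hB.sup_walk hjK hj q fun a ha k hk hkT => hw.trans ?_
      -- `linkCost` turns an infinite distance into `0`, which would spoil the lower bound;
      -- reachability of the terminals excludes this case.
      rw [← hw₀, linkCost_mk, ← hP.dist a k (hreach a ha k hk), ENNReal.toNNReal_coe]
      exact hmin a k ⟨ha, hk, hkT⟩

lemma agreeOff_extend (σ : Mem) :
    σ.AgreeOff [3, 8, 50, 51, 52, 53, 54, 56, 57, 58, 62] [50] (extend.run ε σ) :=
  agreeOff_run_of_subset σ (by decide) (by decide)

lemma run_extend (hP : HoldsPaths G w σ) {K : Set (Fin n)}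
    (hK : ∀ x : Fin n, 0 < σ.nat 6 x 0 ↔ x ∈ K) {T : G.Subgraph} (hT : IsSubtree T)
    (hTσ : HoldsTree T σ) {r : Fin n} (hr : r ∈ T.verts) (hrK : ∀ k ∈ K, G.Reachable r k) :
    ∃ T' : G.Subgraph, T ≤ T' ∧ K ⊆ T'.verts ∧ IsSubtree T' ∧ HoldsTree T' (extend.run ε σ) ∧
      ∀ B, CompletesWithin w K T B → CompletesWithin w K T' B := by
  -- Each round that does not finish adds a vertex, and a tree with `n + 1` vertices is impossible.
  have hI := run_loop_induction (ε := ε) (a := 62) (m := nVerts) (n := n) (σ := σ)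
    (p := extendRound)
    (fun k τ => σ.AgreeOff [3, 8, 50, 51, 52, 53, 54, 56, 57, 58, 62] [50] τ ∧
      ∃ T' : G.Subgraph, T ≤ T' ∧ (K ⊆ T'.verts ∨ k + 1 ≤ T'.verts.ncard) ∧ IsSubtree T' ∧
        HoldsTree T' τ ∧ ∀ B, CompletesWithin w K T B → CompletesWithin w K T' B)
    hP.size ⟨.refl σ, T, le_rfl, Or.inr ((Set.ncard_pos (Set.toFinite _)).2 ⟨r, hr⟩), hT, hTσ,
      fun _ h => h⟩
    (by
      rintro k hk τ ⟨hag, T', hTT', hcard, hT', hT'τ, hB⟩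
      have hag' : σ.AgreeOff [3, 8, 50, 51, 52, 53, 54, 56, 57, 58, 62] [50]
        (τ.setNat 62 0 0 k) := hag.setNat (by decide)
      refine ⟨hag'.trans (agreeOff_run_of_subset _ (by decide) (by decide)), ?_⟩
      have h62 : τ.AgreeOff [62] [] (τ.setNat 62 0 0 k) := (Mem.AgreeOff.refl τ).setNat (by decide)
      rcases run_extendRound (ε := ε) (hP.of_agreeOff hag' (by decide) (by decide))
        (K := K) (by rw [hag'.nat 6 (by decide)]; exact hK) hT'
        (hT'τ.of_agreeOff h62 (by decide)) (hTT'.1 hr) hrK with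
        ⟨hsub, hres⟩ | ⟨T'', hle, hlt, hT'', hres, hB'⟩
      · exact ⟨T', hTT', Or.inl hsub, hT', hres, hB⟩
      · refine ⟨T'', hTT'.trans hle, ?_, hT'', hres, fun B h => hB' B (hB B h)⟩
        have := Set.ncard_lt_ncard hlt (Set.toFinite _)
        rcases hcard with h | h
        · exact Or.inl (h.trans hlt.1)
        · exact Or.inr (by omega))
  obtain ⟨-, T', hTT', hcard, hT', hT'τ, hB⟩ := hI
  refine ⟨T', hTT', hcard.resolve_right fun h => ?_, hT', hT'τ, hB⟩
  have := Set.ncard_le_card T'.verts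
  simp at this
  omega

end Extend


/-! ## The tables of shortest paths -/

section Tables

variable {n : ℕ} {G X : SimpleGraph (Fin n)} {w : Sym2 (Fin n) → ℝ≥0} {S : Finset (Fin n)}
  {ε : ℝ≥0} {σ τ : Mem}

/-- The memory holds the instance. -/
structure HoldsInput (G : SimpleGraph (Fin n)) (w : Sym2 (Fin n) → ℝ≥0) (S : Finset (Fin n))
    (σ : Mem) : Prop where
  size : σ.nat 0 0 0 = n
  adj : ∀ i j : Fin n, 0 < σ.nat 1 i j ↔ G.Adj i j
  terminal : ∀ i : Fin n, 0 < σ.nat 2 i 0 ↔ i ∈ S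
  weight : ∀ i j : Fin n, G.Adj i j → σ.real 0 i j = w s(i, j)

lemma HoldsInput.of_agreeOff {A B : List ℕ} (h : HoldsInput G w S σ)
    (ha : σ.AgreeOff A B τ) (hA : 0 ∉ A ∧ 1 ∉ A ∧ 2 ∉ A) (hB : 0 ∉ B) : HoldsInput G w S τ := by
  refine ⟨?_, ?_, ?_, ?_⟩
  · rw [ha.nat 0 hA.1]; exact h.size
  · rw [ha.nat 1 hA.2.1]; exact h.adj
  · rw [ha.nat 2 hA.2.2]; exact h.terminal
  · rw [ha.real 0 hB]; exact h.weight

lemma holdsInput_inputMem (G : SimpleGraph (Fin n)) (w : Sym2 (Fin n) → ℝ≥0)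
    (S : Finset (Fin n)) : HoldsInput G w S (inputMem G w S) := by
  refine ⟨by simp [inputMem], fun i j => ?_, fun i => ?_, fun i j h => ?_⟩
  · by_cases h : G.Adj i j <;> simp [inputMem, h]
  · by_cases h : i ∈ S <;> simp [inputMem, h]
  · simp [inputMem, h]

/-- The memory holds the instance, the tables of shortest paths, and the path system `P`. -/
structure Ready (P : PathSystem G w S) (σ : Mem) : Prop where
  input : HoldsInput G w S σ
  paths : HoldsPaths G w σ
  follows : ∀ u v : S, (v : Fin n) ≤ u → Follows (σ.nat 5 (v : Fin n)) (P.path u v)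
  maxWeight : ∀ u v : S, σ.real 3 (u : Fin n) (v : Fin n) = P.W u v

lemma Ready.of_agreeOff {P : PathSystem G w S} {A B : List ℕ} (h : Ready P σ)
    (ha : σ.AgreeOff A B τ) (hA : 0 ∉ A ∧ 1 ∉ A ∧ 2 ∉ A ∧ 5 ∉ A) (hB : 0 ∉ B ∧ 1 ∉ B ∧ 3 ∉ B) :
    Ready P τ := by
  refine ⟨h.input.of_agreeOff ha ⟨hA.1, hA.2.1, hA.2.2.1⟩ hB.1,
    h.paths.of_agreeOff ha ⟨hA.1, hA.2.2.2⟩ hB.2.1, ?_, ?_⟩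
  · rw [ha.nat 5 hA.2.2.2]; exact h.follows
  · rw [ha.real 3 hB.2.2]; exact h.maxWeight

/-- Copy an array of naturals. -/
def copyNat (s d : ℕ) : Prog :=
  loopPairs 63 64 (.setNat d (scalar 63) (scalar 64) (cell s 63 64))

lemma agreeOff_copyNat (s d : ℕ) (σ : Mem) :
    σ.AgreeOff [63, 64, d] [] ((copyNat s d).run ε σ) :=
  agreeOff_run_of_subset σ (fun _ h => h) fun _ h => h

lemma run_copyNat {s d : ℕ} (hs : 0 < s ∧ s < 63) (hd : 0 < d ∧ d < 63) (hsd : s ≠ d)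
    (hn : σ.nat 0 0 0 = n) (x y : Fin n) : ((copyNat s d).run ε σ).nat d x y = σ.nat s x y := by
  refine run_loopPairs_fillNat (A := [63, 64, d]) (B := []) (fun x y => σ.nat s x y) (by decide)
    ?_ (by simp) (by simp) ?_ (by simp [Prog.natWrites]) (by simp [Prog.realWrites]) (by omega)
    (by omega) hn ?_ x y
  · simp [Prog.natWrites]; omega
  · simp; omega
  · intro τ hτ x y hx hy _ x' y'
    simp [hx, hy, hτ.nat s (by simp; omega)]

/-- The distances in the graph in array `3`. -/
def distances : Prog := .seq (copyNat 3 4) allShortestPaths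

/-- Array `3` holds the adjacency matrix of `X`. -/
def HoldsEdges (X : SimpleGraph (Fin n)) (σ : Mem) : Prop :=
  ∀ i j : Fin n, (X.Adj i j → σ.nat 3 i j = 1) ∧ (¬ X.Adj i j → σ.nat 3 i j = 0)

lemma HoldsEdges.pos_iff (h : HoldsEdges X σ) (i j : Fin n) : 0 < σ.nat 3 i j ↔ X.Adj i j := by
  by_cases hij : X.Adj i j
  · simp [hij, (h i j).1 hij]
  · simp [hij, (h i j).2 hij]

lemma HoldsEdges.of_agreeOff {A B : List ℕ} (h : HoldsEdges X σ) (ha : σ.AgreeOff A B τ)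
    (hA : 3 ∉ A) : HoldsEdges X τ := by
  rw [HoldsEdges, ha.nat 3 hA]; exact h

lemma agreeOff_distances (σ : Mem) :
    σ.AgreeOff [4, 10, 11, 50, 51, 52, 53, 54, 60, 61, 63, 64] [10, 11, 50]
      (distances.run ε σ) :=
  agreeOff_run_of_subset σ (by decide) (by decide)

lemma holdsGraph_copyNat {s : ℕ} (hs : 0 < s ∧ s < 63) (hs4 : s ≠ 4) (hI : HoldsInput G w S σ)
    (hX : ∀ i j : Fin n, 0 < σ.nat s i j ↔ X.Adj i j) (hXG : X ≤ G) :
    HoldsGraph X w ((copyNat s 4).run ε σ) := by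
  have hag := agreeOff_copyNat (ε := ε) s 4 σ
  refine ⟨?_, fun i j => ?_, fun i j hij => ?_⟩
  · rw [hag.nat 0 (by decide)]; exact hI.size
  · rw [run_copyNat hs (by decide) hs4 hI.size]; exact hX i j
  · rw [hag.real 0 (by decide)]; exact hI.weight i j (hXG hij)

lemma run_distances (hI : HoldsInput G w S σ) (hX : HoldsEdges X σ) (hXG : X ≤ G) {u y : Fin n}
    (h : X.Reachable u y) : ((distances.run ε σ).real 10 u y : ℝ≥0∞) = wdist w X u y := by
  obtain ⟨q, -, -, -, hd, -⟩ := run_allShortestPaths (ε := ε)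
    (holdsGraph_copyNat (ε := ε) (s := 3) (by decide) (by decide) hI hX.pos_iff hXG) u y h
  exact hd

/-- The condition that the pair in the scalars `a`, `b` is satisfied. -/
def satisfiedCond (a b : ℕ) : BExp :=
  .realLe (rcell 10 a b) (.add (rcell 1 a b) (.scale (rcell 3 a b)))

/-- The pair is connected in `G` by its path, and `hd` makes its distance in `X` finite, so the
machine's comparison of finite reals decides the condition on extended ones. -/
lemma eval_satisfiedCond {P : PathSystem G w S} (hP : Ready P σ) {a b : ℕ} {u v : S}
    (ha : σ.nat a 0 0 = (u : Fin n)) (hb : σ.nat b 0 0 = (v : Fin n))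
    (hd : (σ.real 10 (u : Fin n) (v : Fin n) : ℝ≥0∞) = wdist w X u v) :
    (satisfiedCond a b).eval ε σ ↔ P.Satisfied ε X u v := by
  have huv : G.Reachable (u : Fin n) v := (P.path u v).reachable
  simp only [satisfiedCond, BExp.eval, RExp.eval, NExp.eval, ha, hb, PathSystem.Satisfied]
  rw [← ENNReal.coe_le_coe, hd, ENNReal.coe_add, hP.paths.dist _ _ huv, hP.maxWeight]

/-- Mark the vertices of the chosen path for the pair in the scalars `a`, `b` in array `9`, and
its edges in array `e`. -/
def pathTrace (a b e : ℕ) : Prog :=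
  .seq (loopPairs 63 64 (.setNat 9 (scalar 63) (scalar 64) (.const 0)))
    (.seq (.ite (.natLe (scalar a) (scalar b))
        (.seq (.setNat 58 (.const 0) (.const 0) (scalar a))
          (.setNat 57 (.const 0) (.const 0) (scalar b)))
        (.seq (.setNat 58 (.const 0) (.const 0) (scalar b))
          (.setNat 57 (.const 0) (.const 0) (scalar a))))
      (.seq (.setNat 9 (scalar 58) (.const 0) (.const 1)) (trace 9 e)))

lemma agreeOff_pathTrace (a b e : ℕ) (σ : Mem) :
    σ.AgreeOff [e, 9, 56, 57, 58, 63, 64] [] ((pathTrace a b e).run ε σ) := by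
  refine agreeOff_run_of_subset σ ?_ ?_
  · intro x
    simp [pathTrace, Prog.natWrites, loopPairs, natWrites_trace]
    tauto
  · simp [pathTrace, Prog.realWrites, loopPairs, realWrites_trace]

lemma run_pathTrace {P : PathSystem G w S} (hP : Ready P σ) {a b e : ℕ} (he : e = 3 ∨ e = 7)
    (ha : a ∉ [9, 57, 58, 63, 64]) (hb : b ∉ [9, 57, 58, 63, 64]) {u v : S}
    (hu : σ.nat a 0 0 = (u : Fin n)) (hv : σ.nat b 0 0 = (v : Fin n)) :
    (∀ x : Fin n, 0 < ((pathTrace a b e).run ε σ).nat 9 x 0 ↔ x ∈ (P.path u v).support) ∧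
    (∀ i j : Fin n, ((pathTrace a b e).run ε σ).nat e i j =
      if s(i, j) ∈ (P.path u v).edges then 1 else σ.nat e i j) := by
  set τ₁ := (loopPairs 63 64 (.setNat 9 (scalar 63) (scalar 64) (.const 0))).run ε σ with hτ₁
  have hag₁ : σ.AgreeOff [63, 64, 9] [] τ₁ := agreeOff_run_of_subset σ (by decide) (by decide)
  have h9 : ∀ x : Fin n, τ₁.nat 9 x 0 = 0 := fun x =>
    run_loopPairs_fillNat (A := [63, 64, 9]) (B := []) (fun _ _ => 0) (by decide) (by decide)
      (by decide) (by decide) (by decide) (by decide) (by decide) (by decide) (by decide)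
      hP.input.size (by intro τ _ x y hx hy _ x' y'; simp [hx, hy]) x ⟨0, x.pos⟩
  have ha₁ : τ₁.nat a 0 0 = (u : Fin n) := by rw [hag₁.nat a (by simp at ha ⊢; omega), hu]
  have hb₁ : τ₁.nat b 0 0 = (v : Fin n) := by rw [hag₁.nat b (by simp at hb ⊢; omega), hv]
  have key : ∀ (r y : S) (q : G.Walk (y : Fin n) (r : Fin n)), q.IsPath →
      Follows (σ.nat 5 (r : Fin n)) q →
      (pathTrace a b e).run ε σ = (trace 9 e).run ε (((τ₁.setNat 58 0 0 (r : Fin n)).setNat 57 0 0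
        (y : Fin n)).setNat 9 (r : Fin n) 0 1) →
      (∀ x : Fin n, 0 < ((pathTrace a b e).run ε σ).nat 9 x 0 ↔ x ∈ q.support) ∧
      (∀ i j : Fin n, ((pathTrace a b e).run ε σ).nat e i j =
        if s(i, j) ∈ q.edges then 1 else σ.nat e i j) := by
    intro r y q hq hfol hrun
    rw [hrun]
    set τ₂ := ((τ₁.setNat 58 0 0 (r : Fin n)).setNat 57 0 0
        (y : Fin n)).setNat 9 (r : Fin n) 0 1 with hτ₂
    have hag₂ : σ.AgreeOff [63, 64, 9, 58, 57] [] τ₂ :=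
      (((hag₁.mono (by decide) (by decide)).setNat (by decide)).setNat (by decide)).setNat
        (by decide)
    have h9' : ∀ x : Fin n, τ₂.nat 9 x 0 = if x = (r : Fin n) then 1 else 0 := by
      intro x
      simp [hτ₂, h9, Fin.ext_iff]
    obtain ⟨h1, h2⟩ := run_trace (ε := ε) (v := 9) (e := e) (σ := τ₂) (r := (r : Fin n))
      (by decide) (by rcases he with rfl | rfl <;> decide)
      (by rcases he with rfl | rfl <;> decide)
      (by rw [hag₂.nat 0 (by decide)]; exact hP.input.size) q hq (by simp [hτ₂]) (by simp [hτ₂])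
      (by rw [hag₂.nat 5 (by decide)]; exact hfol) (by simp [h9'])
      (fun x _ hx => by simp [h9', hx])
    have hee : τ₂.nat e = σ.nat e := hag₂.nat e (by rcases he with rfl | rfl <;> decide)
    refine ⟨fun x => ?_, fun i j => ?_⟩
    · rw [h1, h9']
      constructor
      · rintro (h | h)
        · by_cases hx : x = (r : Fin n)
          · rw [hx]; exact q.end_mem_support
          · simp [hx] at h
        · exact h
      · exact Or.inr
    · rw [h2, hee]
  simp only [List.mem_cons, List.not_mem_nil, or_false, not_or] at ha hb
  -- The root is always the smaller end, so both orders of a pair trace the same pointers and give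
  -- the same path.
  rcases le_or_gt (u : Fin n) (v : Fin n) with huv | huv
  · have := key u v (P.path v u) (P.shortest v u).1 (hP.follows v u huv) (by
      have h0 : (pathTrace a b e).run ε σ = (Prog.seq (.setNat 9 (scalar 58) (.const 0) (.const 1))
          (trace 9 e)).run ε ((Prog.ite (.natLe (scalar a) (scalar b))
        (.seq (.setNat 58 (.const 0) (.const 0) (scalar a))
          (.setNat 57 (.const 0) (.const 0) (scalar b)))
        (.seq (.setNat 58 (.const 0) (.const 0) (scalar b))
          (.setNat 57 (.const 0) (.const 0) (scalar a)))).run ε τ₁) := rfl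
      rw [h0, run_ite_pos (by simpa [ha₁, hb₁] using huv)]
      simp [ha₁, hb₁, hb])
    rw [P.symm u v] at this
    simpa using this
  · refine key v u (P.path u v) (P.shortest u v).1 (hP.follows u v huv.le) ?_
    have h0 : (pathTrace a b e).run ε σ = (Prog.seq (.setNat 9 (scalar 58) (.const 0) (.const 1))
        (trace 9 e)).run ε ((Prog.ite (.natLe (scalar a) (scalar b))
      (.seq (.setNat 58 (.const 0) (.const 0) (scalar a))
        (.setNat 57 (.const 0) (.const 0) (scalar b)))
      (.seq (.setNat 58 (.const 0) (.const 0) (scalar b))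
        (.setNat 57 (.const 0) (.const 0) (scalar a)))).run ε τ₁) := rfl
    rw [h0, run_ite_neg (by simpa [ha₁, hb₁] using huv)]
    simp [ha₁, hb₁, ha]

/-- Compute the tables of shortest paths. -/
def setup : Prog :=
  .seq (copyNat 1 4)
    (.seq allShortestPaths
      (.seq (copyNat 10 5)
        (.seq (loopPairs 63 64 (.setReal 1 (scalar 63) (scalar 64) (rcell 10 63 64)))
          (loopPairs 63 64 (.ite (.natLe (scalar 63) (scalar 64))
            (.setReal 3 (scalar 63) (scalar 64) (rcell 11 63 64))
            (.setReal 3 (scalar 63) (scalar 64) (rcell 11 64 63)))))))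

lemma agreeOff_setup (σ : Mem) :
    σ.AgreeOff [4, 5, 10, 11, 50, 51, 52, 53, 54, 60, 61, 63, 64] [1, 3, 10, 11, 50]
      (setup.run ε σ) :=
  agreeOff_run_of_subset σ (by decide) (by decide)

lemma exists_ready_setup (hI : HoldsInput G w S σ) (hS : ∀ u ∈ S, ∀ v ∈ S, G.Reachable u v) :
    ∃ P : PathSystem G w S, Ready P (setup.run ε σ) := by
  classical
  have hagAll := agreeOff_setup (ε := ε) σ
  obtain ⟨τ₁, hτ₁⟩ : ∃ τ, τ = (copyNat 1 4).run ε σ := ⟨_, rfl⟩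
  obtain ⟨τ₂, hτ₂⟩ : ∃ τ, τ = allShortestPaths.run ε τ₁ := ⟨_, rfl⟩
  obtain ⟨τ₃, hτ₃⟩ : ∃ τ, τ = (copyNat 10 5).run ε τ₂ := ⟨_, rfl⟩
  obtain ⟨τ₄, hτ₄⟩ : ∃ τ, τ = (loopPairs 63 64
    (.setReal 1 (scalar 63) (scalar 64) (rcell 10 63 64))).run ε τ₃ := ⟨_, rfl⟩
  obtain ⟨τ₅, hτ₅⟩ : ∃ τ, τ = (loopPairs 63 64 (.ite (.natLe (scalar 63) (scalar 64))
      (.setReal 3 (scalar 63) (scalar 64) (rcell 11 63 64))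
      (.setReal 3 (scalar 63) (scalar 64) (rcell 11 64 63)))).run ε τ₄ := ⟨_, rfl⟩
  have hrun : setup.run ε σ = τ₅ := by
    simp only [setup, run_seq, ← hτ₁, ← hτ₂, ← hτ₃, ← hτ₄, ← hτ₅]
  rw [hrun] at hagAll ⊢
  have hX : HoldsGraph G w τ₁ :=
    hτ₁ ▸ holdsGraph_copyNat (s := 1) (by decide) (by decide) hI hI.adj le_rfl
  have hrow : ∀ u, RowComplete G w u τ₂ :=
    hτ₂ ▸ run_allShortestPaths hX
  have hag₂ := agreeOff_allShortestPaths (ε := ε) τ₁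
  rw [← hτ₂] at hag₂
  have hag₃ := agreeOff_copyNat (ε := ε) 10 5 τ₂
  rw [← hτ₃] at hag₃
  have hag₄ : τ₃.AgreeOff [63, 64] [1] τ₄ :=
    hτ₄ ▸ agreeOff_run_of_subset _ (by decide) (by decide)
  have hag₅ : τ₄.AgreeOff [63, 64] [3] τ₅ :=
    hτ₅ ▸ agreeOff_run_of_subset _ (by decide) (by decide)
  have hn₂ : τ₂.nat 0 0 0 = n := by rw [hag₂.nat 0 (by decide)]; exact hX.size
  have hn₃ : τ₃.nat 0 0 0 = n := by rw [hag₃.nat 0 (by decide)]; exact hn₂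
  have hn₄ : τ₄.nat 0 0 0 = n := by rw [hag₄.nat 0 (by decide)]; exact hn₃
  have h5 : ∀ x y : Fin n, τ₅.nat 5 x y = τ₂.nat 10 x y := by
    rw [hag₅.nat 5 (by decide), hag₄.nat 5 (by decide), hτ₃]
    exact run_copyNat (by decide) (by decide) (by decide) hn₂
  have h1 : ∀ x y : Fin n, τ₅.real 1 x y = τ₂.real 10 x y := by
    rw [hag₅.real 1 (by decide), hτ₄]
    refine run_loopPairs_fillReal (A := [63, 64]) (B := [1]) (fun x y => τ₂.real 10 x y)
      (by decide) (by decide) (by decide) (by decide) (by decide) (by decide) (by decide) hn₃ ?_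
    intro τ hτ x y hx hy x' y'
    simp [hx, hy, hτ.real 10 (by decide), hag₃.real 10 (by decide)]
  have h3 : ∀ x y : Fin n, τ₅.real 3 x y = if x ≤ y then τ₂.real 11 x y else τ₂.real 11 y x := by
    rw [hτ₅]
    refine run_loopPairs_fillReal (A := [63, 64]) (B := [3])
      (fun x y => if x ≤ y then τ₂.real 11 x y else τ₂.real 11 y x)
      (by decide) (by decide) (by decide) (by decide) (by decide) (by decide) (by decide) hn₄ ?_
    intro τ hτ x y hx hy x' y'
    have h11 : τ.real 11 = τ₂.real 11 := by
      rw [hτ.real 11 (by decide), hag₄.real 11 (by decide), hag₃.real 11 (by decide)]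
    by_cases hxy : x ≤ y
    · rw [run_ite_pos (by simpa [hx, hy] using hxy)]
      simp [hx, hy, h11, hxy]
    · rw [run_ite_neg (by simpa [hx, hy] using hxy)]
      simp [hx, hy, h11, hxy]
  choose q hqpath hqfol hqw hqd hqm _ using hrow
  have hfol : ∀ u y (h : G.Reachable u y), Follows (τ₅.nat 5 u) (q u y h) := fun u y h =>
    (hqfol u y h).congr fun z _ => h5 u z
  have hshort : ∀ u y (h : G.Reachable u y), IsShortestPath w (q u y h) := fun u y h =>
    ⟨hqpath u y h, fun q' => by
      rw [← hqw u y h, ← ENNReal.coe_le_coe, hqd u y h, wdist_comm]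
      exact wdist_le_walk q'⟩
  have hSr : ∀ u v : S, G.Reachable (u : Fin n) v := fun u v => hS u u.2 v v.2
  -- The searches from `u` and from `v` may find different shortest paths. Using the one rooted at
  -- the smaller end, reversed if necessary, makes the system symmetric.
  have hpw : ∀ u v : S, ∃ p : G.Walk (u : Fin n) v,
      (∀ h : (v : Fin n) ≤ u, p = q v u (hSr v u)) ∧
      (∀ h : ¬ (v : Fin n) ≤ u, p = (q u v (hSr u v)).reverse) := by
    intro u v
    by_cases h : (v : Fin n) ≤ u
    · exact ⟨q v u (hSr v u), fun _ => rfl, fun h' => absurd h h'⟩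
    · exact ⟨(q u v (hSr u v)).reverse, fun h' => absurd h' h, fun _ => rfl⟩
  choose p hp1 hp2 using hpw
  let P : PathSystem G w S :=
    { path := p
      shortest := fun u v => by
        by_cases h : (v : Fin n) ≤ u
        · rw [hp1 u v h]; exact hshort _ _ _
        · rw [hp2 u v h]; exact (hshort _ _ _).reverse
      symm := fun u v => by
        rcases lt_trichotomy (u : Fin n) v with h | h | h
        · rw [hp1 v u h.le, hp2 u v (not_le.2 h), SimpleGraph.Walk.reverse_reverse]
        · obtain rfl : u = v := Subtype.ext h
          -- On the diagonal the path is empty, hence its own reverse.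
          rw [hp1 u u le_rfl]
          have := (SimpleGraph.Walk.isPath_iff_nil.1 (hqpath u u (hSr u u))).eq_nil
          rw [this, SimpleGraph.Walk.reverse_nil]
        · rw [hp2 v u (not_le.2 h), hp1 u v h.le] }
  refine ⟨P, hI.of_agreeOff hagAll (by decide) (by decide), ⟨?_, fun u y h => ?_, fun u y h => ?_⟩,
    fun u v h => ?_, fun u v => ?_⟩
  · rw [hag₅.nat 0 (by decide)]; exact hn₄
  · exact ⟨q u y h, hqpath u y h, hfol u y h, by rw [h1]; exact hqw u y h⟩
  · rw [h1]; exact hqd u y h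
  · change Follows _ (p u v)
    rw [hp1 u v h]
    exact hfol _ _ _
  · change _ = walkMax w (p u v)
    rw [h3]
    by_cases h : (v : Fin n) ≤ u
    · rw [hp1 u v h]
      split_ifs with h'
      · have huv : (u : Fin n) = v := le_antisymm h' h
        obtain rfl : u = v := Subtype.ext huv
        exact hqm _ _ _
      · exact hqm _ _ _
    · rw [hp2 u v h, walkMax_reverse, if_pos (not_le.1 h).le]
      exact hqm _ _ _

end Tables


/-! ## The extended terminals -/

section Marking

variable {n : ℕ} {G : SimpleGraph (Fin n)} {w : Sym2 (Fin n) → ℝ≥0} {S : Finset (Fin n)}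
  {ε : ℝ≥0} {σ τ : Mem}

/-- Mark in array `6` what is marked in array `9`. -/
def mergeMarks : Prog :=
  loopPairs 63 64 (.setNat 6 (scalar 63) (scalar 64)
    (.sub (.const 1) (.sub (.const 1) (.add (cell 6 63 64) (cell 9 63 64)))))

/-- With truncated subtraction `1 - (1 - m)` is the indicator of `m ≠ 0`. -/
lemma run_mergeMarks (hn : σ.nat 0 0 0 = n) (x : Fin n) :
    0 < (mergeMarks.run ε σ).nat 6 x 0 ↔ 0 < σ.nat 6 x 0 ∨ 0 < σ.nat 9 x 0 := by
  have : (mergeMarks.run ε σ).nat 6 x (⟨0, x.pos⟩ : Fin n) =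
      1 - (1 - (σ.nat 6 x 0 + σ.nat 9 x 0)) :=
    run_loopPairs_fillNat (A := [63, 64, 6]) (B := [])
      (fun x y => 1 - (1 - (σ.nat 6 x y + σ.nat 9 x y))) (by decide) (by decide)
      (by decide) (by decide) (by decide) (by decide) (by decide) (by decide) (by decide)
      -- The program reads the cell that it overwrites; `h6` says that this cell still has its
      -- original value, since each pair is visited once.
      hn (by intro τ hτ x y hx hy h6 x' y'; simp [hx, hy, hτ.nat 9 (by decide), h6]) x ⟨0, x.pos⟩
  rw [this]
  omega

def markCond : BExp :=
  .and (nonzero (entry 2 65)) (.and (nonzero (entry 2 66)) (.not (satisfiedCond 65 66)))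

def markBody : Prog := .ite markCond (.seq (pathTrace 65 66 7) mergeMarks) .skip

/-- Mark the vertices on the paths of the pairs that are not satisfied. -/
def markTerminals : Prog := loopPairs 65 66 markBody

lemma agreeOff_markTerminals (σ : Mem) :
    σ.AgreeOff [6, 7, 9, 56, 57, 58, 63, 64, 65, 66] [] (markTerminals.run ε σ) :=
  agreeOff_run_of_subset σ (by decide) (by decide)

lemma run_markTerminals {P : PathSystem G w S} (hP : Ready P σ)
    (h6 : ∀ x : Fin n, 0 < σ.nat 6 x 0 ↔ x ∈ S) {R : G.Subgraph}
    (hd : ∀ u v : S, (σ.real 10 (u : Fin n) (v : Fin n) : ℝ≥0∞) = wdist w R.spanningCoe u v)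
    (x : Fin n) :
    0 < (markTerminals.run ε σ).nat 6 x 0 ↔ x ∈ P.extendedTerminals ε R := by
  have hI := run_loopPairs_induction (ε := ε) (n := n) (i := 65) (j := 66) (p := markBody) (σ := σ)
    (fun k l τ => σ.AgreeOff [6, 7, 9, 56, 57, 58, 63, 64, 65, 66] [] τ ∧
      ∀ x : Fin n, 0 < τ.nat 6 x 0 ↔ x ∈ S ∨ ∃ u v : S,
        (((u : Fin n) : ℕ) < k ∨ (((u : Fin n) : ℕ) = k ∧ ((v : Fin n) : ℕ) < l)) ∧
        ¬ P.Satisfied ε R.spanningCoe u v ∧ x ∈ (P.path u v).support)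
    (by decide) (by decide)
    (fun k l τ h => by rw [h.1.nat 0 (by decide)]; exact hP.input.size)
    ⟨.refl σ, fun x => by rw [h6]; simp⟩
    (fun k _ τ h => ⟨h.1.setNat (by decide), fun x => by
      rw [τ.nat_setNat_of_ne (by decide)]; exact h.2 x⟩)
    (fun k _ τ h => ⟨h.1, fun x => by
      rw [h.2]
      refine or_congr_right (exists_congr fun u => exists_congr fun v => and_congr_left fun _ => ?_)
      have := (v : Fin n).2
      omega⟩)
    (by
      rintro k hk l hl τ ⟨hag, h⟩ h65
      obtain ⟨υ, hυ⟩ : ∃ υ, υ = τ.setNat 66 0 0 l := ⟨_, rfl⟩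
      rw [← hυ]
      have hagυ : σ.AgreeOff [6, 7, 9, 56, 57, 58, 63, 64, 65, 66] [] υ :=
        hυ ▸ hag.setNat (by decide)
      have e65 : υ.nat 65 0 0 = (⟨k, hk⟩ : Fin n) := by simp [hυ, h65]
      have e66 : υ.nat 66 0 0 = (⟨l, hl⟩ : Fin n) := by simp [hυ]
      have e6 : υ.nat 6 = τ.nat 6 := hυ ▸ τ.nat_setNat_of_ne (by decide)
      have hPυ : Ready P υ := hP.of_agreeOff hagυ (by decide) (by decide)
      refine ⟨hagυ.trans (agreeOff_run_of_subset _ (by decide) (by decide)), ?_⟩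
      have hcond : markCond.eval ε υ ↔ ∃ u v : S, ((u : Fin n) : ℕ) = k ∧ ((v : Fin n) : ℕ) = l ∧
          ¬ P.Satisfied ε R.spanningCoe u v := by
        have h1 : markCond.eval ε υ ↔ (⟨k, hk⟩ : Fin n) ∈ S ∧ (⟨l, hl⟩ : Fin n) ∈ S ∧
            ¬ (satisfiedCond 65 66).eval ε υ := by
          rw [← hPυ.input.terminal, ← hPυ.input.terminal]
          simp only [markCond, BExp.eval, NExp.eval, e65, e66]
          rfl
        rw [h1]
        constructor
        · rintro ⟨hu, hv, hsat⟩
          refine ⟨⟨_, hu⟩, ⟨_, hv⟩, rfl, rfl, ?_⟩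
          rwa [eval_satisfiedCond (X := R.spanningCoe) hPυ (u := ⟨_, hu⟩) (v := ⟨_, hv⟩) e65 e66
            (by rw [hagυ.real 10 (by decide)]; exact hd ⟨_, hu⟩ ⟨_, hv⟩)] at hsat
        · rintro ⟨u, v, hu, hv, hsat⟩
          have hu' : (u : Fin n) = ⟨k, hk⟩ := Fin.ext hu
          have hv' : (v : Fin n) = ⟨l, hl⟩ := Fin.ext hv
          rw [← hu'] at e65 ⊢
          rw [← hv'] at e66 ⊢
          refine ⟨u.2, v.2, ?_⟩
          rwa [eval_satisfiedCond (X := R.spanningCoe) hPυ (u := u) (v := v) e65 e66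
            (by rw [hagυ.real 10 (by decide)]; exact hd u v)]
      by_cases hc : markCond.eval ε υ
      · obtain ⟨u, v, hu, hv, hsat⟩ := hcond.1 hc
        have hrun : markBody.run ε υ = mergeMarks.run ε ((pathTrace 65 66 7).run ε υ) := by
          rw [markBody, run_ite_pos hc, run_seq]
        -- Only the vertices are needed here; the edges go to array `7`, which is never read.
        obtain ⟨h9, -⟩ := run_pathTrace (ε := ε) hPυ (a := 65) (b := 66) (e := 7) (Or.inr rfl)
          (by decide) (by decide) (u := u) (v := v) (by rw [e65]; exact hu.symm)
          (by rw [e66]; exact hv.symm)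
        have hagp := agreeOff_pathTrace (ε := ε) 65 66 7 υ
        intro x
        rw [hrun, run_mergeMarks (by rw [hagp.nat 0 (by decide)]; exact hPυ.input.size), h9,
          hagp.nat 6 (by decide), e6, h x]
        constructor
        · rintro ((hx | ⟨u', v', hlt, hs⟩) | hx)
          · exact Or.inl hx
          · exact Or.inr ⟨u', v', by omega, hs⟩
          · exact Or.inr ⟨u, v, by omega, hsat, hx⟩
        · rintro (hx | ⟨u', v', hlt, hs⟩)
          · exact Or.inl (Or.inl hx)
          · by_cases heq : ((u' : Fin n) : ℕ) = k ∧ ((v' : Fin n) : ℕ) = l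
            · obtain rfl : u' = u := Subtype.ext (Fin.ext (heq.1.trans hu.symm))
              obtain rfl : v' = v := Subtype.ext (Fin.ext (heq.2.trans hv.symm))
              exact Or.inr hs.2
            · exact Or.inl (Or.inr ⟨u', v', by omega, hs⟩)
      · intro x
        rw [markBody, run_ite_neg hc, run_skip, e6, h x]
        refine or_congr_right (exists_congr fun u => exists_congr fun v => ?_)
        constructor
        · rintro ⟨hlt, hs⟩
          exact ⟨by omega, hs⟩
        · rintro ⟨hlt, hs⟩
          refine ⟨?_, hs⟩
          by_cases heq : ((u : Fin n) : ℕ) = k ∧ ((v : Fin n) : ℕ) = l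
          · exact absurd (hcond.2 ⟨u, v, heq.1, heq.2, hs.1⟩) hc
          · omega)
  have hx := hI.2 x
  refine Iff.trans hx ?_
  refine or_congr Iff.rfl (exists_congr fun u => exists_congr fun v => ?_)
  have := (u : Fin n).2
  simp

end Marking

/-! ## The light edges -/

section LightEdges

variable {n : ℕ} {G X : SimpleGraph (Fin n)} {w : Sym2 (Fin n) → ℝ≥0} {S : Finset (Fin n)}
  {ε : ℝ≥0} {σ τ : Mem}

open Classical in
-- An adjacency matrix lists each edge as two ordered pairs. The other side of the test for light
-- edges is doubled to match.
lemma sum_adj_eq_two_mul_edgeWeight (X : SimpleGraph (Fin n)) :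
    ∑ p : Fin n × Fin n, (if X.Adj p.1 p.2 then w s(p.1, p.2) else 0) =
      2 * edgeWeight w X.edgeSet := by
  rw [← Finset.sum_filter, edgeWeight, Finset.mul_sum,
    ← Finset.sum_fiberwise_of_maps_to (g := fun p : Fin n × Fin n => s(p.1, p.2))
      (t := Finset.univ.filter (· ∈ X.edgeSet)) (fun p hp => by simpa using hp)]
  refine Finset.sum_congr (by ext; simp) fun e he => ?_
  have he' : e ∈ X.edgeSet := by simpa using he
  induction e with | _ a b =>
  have hab : X.Adj a b := he'
  have hset : ((Finset.univ.filter fun p : Fin n × Fin n => X.Adj p.1 p.2).filter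
      fun p => s(p.1, p.2) = s(a, b)) = {(a, b), (b, a)} := by
    ext ⟨x, y⟩
    simp only [Finset.mem_filter, Finset.mem_univ, true_and, Sym2.eq_iff, Finset.mem_insert,
      Finset.mem_singleton, Prod.mk.injEq]
    constructor
    · exact fun h => h.2
    · rintro (⟨rfl, rfl⟩ | ⟨rfl, rfl⟩)
      · exact ⟨hab, Or.inl ⟨rfl, rfl⟩⟩
      · exact ⟨hab.symm, Or.inr ⟨rfl, rfl⟩⟩
  rw [hset, Finset.sum_pair (fun h => hab.ne (Prod.mk.inj h).1), Sym2.eq_swap (a := b), two_mul]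

def sumEdgesBody : Prog :=
  .ite (nonzero (cell 3 63 64))
    (.setReal 60 (.const 0) (.const 0) (.add (rscalar 60) (rcell 0 63 64))) .skip

/-- Twice the weight of the graph in array `3`, in the real scalar `60`. -/
def sumEdges : Prog :=
  .seq (.setReal 60 (.const 0) (.const 0) .zero) (loopPairs 63 64 sumEdgesBody)

lemma agreeOff_sumEdges (σ : Mem) : σ.AgreeOff [63, 64] [60] (sumEdges.run ε σ) :=
  agreeOff_run_of_subset σ (by decide) (by decide)

lemma run_sumEdges (hI : HoldsInput G w S σ) (hX : HoldsEdges X σ) (hXG : X ≤ G) :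
    (sumEdges.run ε σ).real 60 0 0 = 2 * edgeWeight w X.edgeSet := by
  classical
  have h := run_loopPairs_induction (ε := ε) (n := n) (i := 63) (j := 64) (p := sumEdgesBody)
    (σ := σ.setReal 60 0 0 0)
    (fun k l τ => σ.AgreeOff [63, 64] [60] τ ∧ τ.real 60 0 0 =
      ∑ p : Fin n × Fin n with (p.1 : ℕ) < k ∨ ((p.1 : ℕ) = k ∧ (p.2 : ℕ) < l),
        if X.Adj p.1 p.2 then w s(p.1, p.2) else 0)
    (by decide) (by decide)
    (fun k l τ h => by rw [h.1.nat 0 (by decide)]; exact hI.size)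
    ⟨(Mem.AgreeOff.refl σ).setReal (by decide), by simp⟩
    (fun k _ τ h => ⟨h.1.setNat (by decide), h.2⟩)
    (fun k _ τ h => ⟨h.1, by
      rw [h.2]
      congr 1
      ext p
      have := p.2.2
      simp only [Finset.mem_filter, Finset.mem_univ, true_and]
      omega⟩)
    (by
      rintro k hk l hl τ ⟨hag, h⟩ h63
      obtain ⟨υ, hυ⟩ : ∃ υ, υ = τ.setNat 64 0 0 l := ⟨_, rfl⟩
      rw [← hυ]
      have hagυ : σ.AgreeOff [63, 64] [60] υ := hυ ▸ hag.setNat (by decide)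
      have e63 : υ.nat 63 0 0 = (⟨k, hk⟩ : Fin n) := by simp [hυ, h63]
      have e64 : υ.nat 64 0 0 = (⟨l, hl⟩ : Fin n) := by simp [hυ]
      have e60 : υ.real 60 0 0 = τ.real 60 0 0 := by rw [hυ]; rfl
      refine ⟨hagυ.trans (agreeOff_run_of_subset _ (by decide) (by decide)), ?_⟩
      have hset : (Finset.univ.filter fun p : Fin n × Fin n =>
          (p.1 : ℕ) < k ∨ ((p.1 : ℕ) = k ∧ (p.2 : ℕ) < l + 1)) =
          insert (⟨k, hk⟩, ⟨l, hl⟩) (Finset.univ.filter fun p : Fin n × Fin n =>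
          (p.1 : ℕ) < k ∨ ((p.1 : ℕ) = k ∧ (p.2 : ℕ) < l)) := by
        ext p
        simp only [Finset.mem_filter, Finset.mem_univ, true_and, Finset.mem_insert, Prod.ext_iff,
          Fin.ext_iff]
        omega
      rw [hset, Finset.sum_insert (by simp), ← h, ← e60]
      have hpos := hX.pos_iff ⟨k, hk⟩ ⟨l, hl⟩
      rw [← hagυ.nat 3 (by decide)] at hpos
      by_cases hadj : X.Adj ⟨k, hk⟩ ⟨l, hl⟩
      · have hc : (nonzero (cell 3 63 64)).eval ε υ := by
          simp only [BExp.eval, NExp.eval, e63, e64]; exact hpos.2 hadj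
        rw [sumEdgesBody, run_ite_pos hc, if_pos hadj]
        simp [e63, e64, hagυ.real 0 (by decide)]
        rw [add_comm, ← hI.weight _ _ (hXG hadj)]
      · have hc : ¬ (nonzero (cell 3 63 64)).eval ε υ := by
          simp only [BExp.eval, NExp.eval, e63, e64]; exact fun h => hadj (hpos.1 h)
        rw [sumEdgesBody, run_ite_neg hc, if_neg hadj, zero_add, run_skip])
  have hrun : sumEdges.run ε σ =
      (loopPairs 63 64 sumEdgesBody).run ε (σ.setReal 60 0 0 0) := by
    simp [sumEdges]
  rw [hrun, h.2, ← sum_adj_eq_two_mul_edgeWeight]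
  congr 1
  ext p
  simp

/-- Twice the value in the real scalar `50`, times the number of vertices marked in array `8`. -/
def scaleByVerts : Prog :=
  .seq (.setReal 61 (.const 0) (.const 0) .zero)
    (.loop 63 nVerts (.ite (nonzero (entry 8 63))
      (.setReal 61 (.const 0) (.const 0) (.add (rscalar 61) (.add (rscalar 50) (rscalar 50))))
      .skip))

lemma agreeOff_scaleByVerts (σ : Mem) : σ.AgreeOff [63] [61] (scaleByVerts.run ε σ) :=
  agreeOff_run_of_subset σ (by decide) (by decide)

/-- The product with the number of vertices is formed by repeated addition, as the machine cannot
multiply; the factor `2` matches the sum over ordered pairs. -/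
lemma run_scaleByVerts (hn : σ.nat 0 0 0 = n) {A : Set (Fin n)}
    (hA : ∀ x : Fin n, 0 < σ.nat 8 x 0 ↔ x ∈ A) :
    (scaleByVerts.run ε σ).real 61 0 0 = 2 * (σ.real 50 0 0 * A.ncard) := by
  classical
  have h := run_loop_induction (ε := ε) (a := 63) (m := nVerts) (n := n)
    (σ := σ.setReal 61 0 0 0)
    (p := .ite (nonzero (entry 8 63))
      (.setReal 61 (.const 0) (.const 0) (.add (rscalar 61) (.add (rscalar 50) (rscalar 50))))
      .skip)
    (fun k τ => σ.AgreeOff [63] [61] τ ∧ τ.real 61 0 0 =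
      2 * (σ.real 50 0 0 * ((Finset.univ.filter fun x : Fin n => x ∈ A ∧ (x : ℕ) < k).card : ℝ≥0)))
    hn ⟨(Mem.AgreeOff.refl σ).setReal (by decide), by simp⟩
    (by
      rintro k hk τ ⟨hag, h⟩
      obtain ⟨υ, hυ⟩ : ∃ υ, υ = τ.setNat 63 0 0 k := ⟨_, rfl⟩
      rw [← hυ]
      have hagυ : σ.AgreeOff [63] [61] υ := hυ ▸ hag.setNat (by decide)
      have e63 : υ.nat 63 0 0 = (⟨k, hk⟩ : Fin n) := by simp [hυ]
      have e61 : υ.real 61 0 0 = τ.real 61 0 0 := by rw [hυ]; rfl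
      refine ⟨hagυ.trans (agreeOff_run_of_subset _ (by decide) (by decide)), ?_⟩
      have hpos := hA ⟨k, hk⟩
      rw [← hagυ.nat 8 (by decide)] at hpos
      by_cases hk' : (⟨k, hk⟩ : Fin n) ∈ A
      · have hset : (Finset.univ.filter fun x : Fin n => x ∈ A ∧ (x : ℕ) < k + 1) =
            insert ⟨k, hk⟩ (Finset.univ.filter fun x : Fin n => x ∈ A ∧ (x : ℕ) < k) := by
          ext x
          simp only [Finset.mem_filter, Finset.mem_univ, true_and, Finset.mem_insert]
          constructor
          · rintro ⟨hx, hxk⟩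
            by_cases hxk' : (x : ℕ) = k
            · exact Or.inl (Fin.ext hxk')
            · exact Or.inr ⟨hx, by omega⟩
          · rintro (rfl | ⟨hx, hxk⟩)
            · exact ⟨hk', by simp⟩
            · exact ⟨hx, by omega⟩
        rw [hset, Finset.card_insert_of_notMem (by simp)]
        have hc : (nonzero (entry 8 63)).eval ε υ := by
          simp only [BExp.eval, NExp.eval, e63]; exact hpos.2 hk'
        rw [run_ite_pos hc]
        simp only [run_setReal, NExp.eval, Mem.real_setReal, RExp.eval, and_self, if_true, e61, h,
          hagυ.real 50 (by decide)]
        push_cast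
        ring
      · have hset : (Finset.univ.filter fun x : Fin n => x ∈ A ∧ (x : ℕ) < k + 1) =
            (Finset.univ.filter fun x : Fin n => x ∈ A ∧ (x : ℕ) < k) := by
          ext x
          simp only [Finset.mem_filter, Finset.mem_univ, true_and]
          refine and_congr_right fun hx => ?_
          have : (x : ℕ) ≠ k := fun h => hk' ((Fin.ext h : x = ⟨k, hk⟩) ▸ hx)
          omega
        have hc : ¬ (nonzero (entry 8 63)).eval ε υ := by
          simp only [BExp.eval, NExp.eval, e63]; exact fun h => hk' (hpos.1 h)
        rw [hset, run_ite_neg hc, run_skip, e61, h])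
  have hrun : scaleByVerts.run ε σ = (Prog.loop 63 nVerts (.ite (nonzero (entry 8 63))
      (.setReal 61 (.const 0) (.const 0) (.add (rscalar 61) (.add (rscalar 50) (rscalar 50))))
      .skip)).run ε (σ.setReal 61 0 0 0) := by
    simp [scaleByVerts]
  rw [hrun, h.2]
  congr 3
  rw [Set.ncard_eq_toFinset_card']
  congr 1
  ext x
  simp

/-- The light edges at the vertices of `K` below `k`. -/
def lightSet (G : SimpleGraph (Fin n)) (w : Sym2 (Fin n) → ℝ≥0) (K : Set (Fin n))
    (H : G.Subgraph) (nb : Fin n → Fin n) (k : ℕ) : Set (Sym2 (Fin n)) :=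
  {e | e ∈ G.edgeSet ∧ (∃ v ∈ K, (v : ℕ) < k ∧ e = s(v, nb v)) ∧
    w e * (H.verts.ncard : ℝ≥0) < edgeWeight w H.edgeSet}

def lightestCond : BExp :=
  .and (.natLe (scalar 50) (scalar 69))
    (.and (.natLe (scalar 69) (scalar 50)) (nonzero (cell 1 50 51)))

def lightAdd : Prog :=
  .seq scaleByVerts
    (.ite (.realLe (rscalar 60) (rscalar 61)) .skip
      (.seq (.setNat 3 (scalar 53) (scalar 54) (.const 1))
        (.setNat 3 (scalar 54) (scalar 53) (.const 1))))

def lightRound : Prog :=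
  .ite (nonzero (entry 6 69))
    (.seq (argmin lightestCond (rcell 0 50 51)) (.ite (nonzero (scalar 52)) lightAdd .skip)) .skip

/-- Add the light edges. -/
def addLightEdges : Prog := .seq sumEdges (.loop 69 nVerts lightRound)

lemma agreeOff_lightRound (σ : Mem) :
    σ.AgreeOff [3, 50, 51, 52, 53, 54, 63] [50, 61] (lightRound.run ε σ) :=
  agreeOff_run_of_subset σ (by decide) (by decide)

/-- Both compared quantities carry a factor `2`, which cancels, and the strict test is the negation
of the machine's comparison. -/
lemma HoldsEdges.run_lightAdd (hX : HoldsEdges X σ) (hn : σ.nat 0 0 0 = n) {H : G.Subgraph}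
    (h8 : ∀ x : Fin n, 0 < σ.nat 8 x 0 ↔ x ∈ H.verts)
    (h60 : σ.real 60 0 0 = 2 * edgeWeight w H.edgeSet) {v j : Fin n} (hvj : G.Adj v j)
    (h53 : σ.nat 53 0 0 = v) (h54 : σ.nat 54 0 0 = j) (h50 : σ.real 50 0 0 = w s(v, j)) :
    HoldsEdges (X ⊔ SimpleGraph.fromEdgeSet {e | e = s(v, j) ∧
      w e * (H.verts.ncard : ℝ≥0) < edgeWeight w H.edgeSet}) (lightAdd.run ε σ) := by
  obtain ⟨τ, hτ⟩ : ∃ τ, τ = scaleByVerts.run ε σ := ⟨_, rfl⟩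
  have hag := agreeOff_scaleByVerts (ε := ε) σ
  have h61 := run_scaleByVerts (ε := ε) hn h8
  rw [← hτ] at hag h61
  have h3 : τ.nat 3 = σ.nat 3 := hag.nat 3 (by decide)
  have hcond : (BExp.realLe (rscalar 60) (rscalar 61)).eval ε τ ↔
      ¬ w s(v, j) * (H.verts.ncard : ℝ≥0) < edgeWeight w H.edgeSet := by
    simp only [BExp.eval, RExp.eval, NExp.eval, h61, hag.real 60 (by decide), h60, h50, not_lt]
    exact mul_le_mul_iff_right₀ (by norm_num)
  have hadj : ∀ a b : Fin n, (SimpleGraph.fromEdgeSet {e | e = s(v, j) ∧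
      w e * (H.verts.ncard : ℝ≥0) < edgeWeight w H.edgeSet}).Adj a b ↔
      s(a, b) = s(v, j) ∧ w s(v, j) * (H.verts.ncard : ℝ≥0) < edgeWeight w H.edgeSet := by
    intro a b
    rw [SimpleGraph.fromEdgeSet_adj]
    simp only [Set.mem_ofPred_eq]
    constructor
    · rintro ⟨⟨h1, h2⟩, -⟩
      exact ⟨h1, h1 ▸ h2⟩
    · rintro ⟨h1, h2⟩
      refine ⟨⟨h1, by rw [h1]; exact h2⟩, ?_⟩
      rintro rfl
      have : s(a, a).IsDiag := rfl
      rw [h1] at this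
      exact hvj.ne this
  rw [lightAdd, run_seq, ← hτ]
  by_cases hc : w s(v, j) * (H.verts.ncard : ℝ≥0) < edgeWeight w H.edgeSet
  · rw [run_ite_neg (fun h => hcond.1 h hc)]
    intro a b
    rw [SimpleGraph.sup_adj, hadj]
    have hab : s(a, b) = s(v, j) ↔
        ((a : ℕ) = v ∧ (b : ℕ) = j) ∨ ((a : ℕ) = j ∧ (b : ℕ) = v) := by
      simp [Fin.ext_iff]
    have h53' : τ.nat 53 0 0 = v := by rw [hag.nat 53 (by decide), h53]
    have h54' : τ.nat 54 0 0 = j := by rw [hag.nat 54 (by decide), h54]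
    have hval : ((Prog.seq (.setNat 3 (scalar 53) (scalar 54) (.const 1))
        (.setNat 3 (scalar 54) (scalar 53) (.const 1))).run ε τ).nat 3 a b =
        if (a : ℕ) = j ∧ (b : ℕ) = v then 1 else if (a : ℕ) = v ∧ (b : ℕ) = j then 1
          else σ.nat 3 a b := by
      simp [h53', h54', h3]
    rw [hval, hab]
    have := hX a b
    by_cases h1 : (a : ℕ) = j ∧ (b : ℕ) = v
    · simp [h1, hc]
    · by_cases h2 : (a : ℕ) = v ∧ (b : ℕ) = j
      · simp [h2, hc]
      · simpa [h1, h2] using this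
  · rw [run_ite_pos (hcond.2 hc), run_skip]
    intro a b
    rw [SimpleGraph.sup_adj, hadj, h3]
    simpa [hc] using hX a b

lemma run_addLightEdges (hI : HoldsInput G w S σ) {K : Set (Fin n)}
    (hK : ∀ x : Fin n, 0 < σ.nat 6 x 0 ↔ x ∈ K) {H : G.Subgraph} (hH : HoldsTree H σ) :
    ∃ nb : Fin n → Fin n,
      (∀ v ∈ K, ∀ x, G.Adj v x → G.Adj v (nb v) ∧ w s(v, nb v) ≤ w s(v, x)) ∧
      HoldsEdges (H.spanningCoe ⊔ SimpleGraph.fromEdgeSet (lightSet G w K H nb n))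
        (addLightEdges.run ε σ) := by
  classical
  obtain ⟨τ₀, hτ₀⟩ : ∃ τ, τ = sumEdges.run ε σ := ⟨_, rfl⟩
  have hag₀ := agreeOff_sumEdges (ε := ε) σ
  have hHe : HoldsEdges H.spanningCoe σ := hH.edges
  have h60 := run_sumEdges (ε := ε) hI hHe H.spanningCoe_le
  rw [← hτ₀] at hag₀ h60
  have hI₀ : HoldsInput G w S τ₀ := hI.of_agreeOff hag₀ (by decide) (by decide)
  have hmain := run_loop_induction (ε := ε) (a := 69) (m := nVerts) (n := n) (σ := τ₀)
    (p := lightRound)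
    (fun k τ => τ₀.AgreeOff [3, 50, 51, 52, 53, 54, 63, 69] [50, 61] τ ∧ ∃ nb : Fin n → Fin n,
      (∀ v ∈ K, (v : ℕ) < k → ∀ x, G.Adj v x → G.Adj v (nb v) ∧ w s(v, nb v) ≤ w s(v, x)) ∧
      HoldsEdges (H.spanningCoe ⊔ SimpleGraph.fromEdgeSet (lightSet G w K H nb k)) τ)
    hI₀.size
    ⟨.refl τ₀, id, by simp, by
      have : lightSet G w K H id 0 = ∅ := by ext e; simp [lightSet]
      rw [this, SimpleGraph.fromEdgeSet_empty, sup_bot_eq]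
      exact hHe.of_agreeOff hag₀ (by decide)⟩
    (by
      rintro k hk τ ⟨hag, nb, hnb, hE⟩
      obtain ⟨υ, hυ⟩ : ∃ υ, υ = τ.setNat 69 0 0 k := ⟨_, rfl⟩
      rw [← hυ]
      have hagυ : τ₀.AgreeOff [3, 50, 51, 52, 53, 54, 63, 69] [50, 61] υ :=
        hυ ▸ hag.setNat (by decide)
      have e69 : υ.nat 69 0 0 = (⟨k, hk⟩ : Fin n) := by simp [hυ]
      have hEυ : HoldsEdges (H.spanningCoe ⊔ SimpleGraph.fromEdgeSet (lightSet G w K H nb k)) υ :=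
        hE.of_agreeOff (A := [69]) (B := []) (hυ ▸ (Mem.AgreeOff.refl τ).setNat (by decide))
          (by decide)
      have hKυ : 0 < υ.nat 6 k 0 ↔ (⟨k, hk⟩ : Fin n) ∈ K := by
        rw [hagυ.nat 6 (by decide), hag₀.nat 6 (by decide)]
        exact hK ⟨k, hk⟩
      have hIυ : HoldsInput G w S υ := hI₀.of_agreeOff hagυ (by decide) (by decide)
      refine ⟨hagυ.trans ((agreeOff_lightRound υ).mono (by decide) (by decide)), ?_⟩
      -- A vertex outside `K` or without incident edges contributes nothing. Its value of `nb` may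
      -- be arbitrary, because `lightSet` only admits edges of `G`.
      have hnochange : ((⟨k, hk⟩ : Fin n) ∈ K → ∀ x, ¬ G.Adj ⟨k, hk⟩ x) →
          (∀ v ∈ K, (v : ℕ) < k + 1 → ∀ x, G.Adj v x →
            G.Adj v (nb v) ∧ w s(v, nb v) ≤ w s(v, x)) ∧
          lightSet G w K H nb (k + 1) = lightSet G w K H nb k := by
        intro hno
        refine ⟨fun v hv hvk x hx => ?_, ?_⟩
        · by_cases hvk' : (v : ℕ) = k
          · obtain rfl : v = ⟨k, hk⟩ := Fin.ext hvk'
            exact absurd hx (hno hv x)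
          · exact hnb v hv (by omega) x hx
        · ext e
          refine and_congr_right fun he => and_congr_left fun _ => ?_
          constructor
          · rintro ⟨v, hv, hvk, rfl⟩
            by_cases hvk' : (v : ℕ) = k
            · obtain rfl : v = ⟨k, hk⟩ := Fin.ext hvk'
              exact absurd he (hno hv _)
            · exact ⟨v, hv, by omega, rfl⟩
          · rintro ⟨v, hv, hvk, rfl⟩
            exact ⟨v, hv, by omega, rfl⟩
      by_cases hkK : (⟨k, hk⟩ : Fin n) ∈ K
      · have hc : (nonzero (entry 6 69)).eval ε υ := by
          simp only [BExp.eval, NExp.eval, e69]; exact hKυ.2 hkK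
        rw [lightRound, run_ite_pos hc, run_seq]
        have harg := run_argmin (ε := ε) (σ := υ) (c := lightestCond) (x := rcell 0 50 51)
          (fun i j : Fin n => i = ⟨k, hk⟩ ∧ G.Adj i j) (fun i j => w s(i, j)) hIυ.size (by
            intro τ hτ i j hi hj
            constructor
            · simp only [lightestCond, BExp.eval, NExp.eval, hi, hj, hτ.nat 69 (by decide), e69,
                hτ.nat 1 (by decide), ← hIυ.adj i j, ← and_assoc, ← le_antisymm_iff, Fin.ext_iff]
              rfl
            · intro hC
              simp only [RExp.eval, NExp.eval, hi, hj, hτ.real 0 (by decide),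
                hIυ.weight i j hC.2])
        have hagm := agreeOff_argmin (ε := ε) lightestCond (rcell 0 50 51) υ
        obtain ⟨ρ, hρ⟩ : ∃ ρ, ρ = (argmin lightestCond (rcell 0 50 51)).run ε υ := ⟨_, rfl⟩
        rw [← hρ] at harg hagm ⊢
        have hEρ := hEυ.of_agreeOff hagm (by decide)
        rcases harg with ⟨h52, hnone⟩ | ⟨h52, i, j, ⟨rfl, hij⟩, h53, h54, h50, hmin⟩
        · have hc : ¬ (nonzero (scalar 52)).eval ε ρ := by simp [h52]
          rw [run_ite_neg hc, run_skip]
          obtain ⟨h1, h2⟩ := hnochange fun _ x hx => hnone _ x ⟨rfl, hx⟩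
          exact ⟨nb, h1, by rw [h2]; exact hEρ⟩
        · have hc : (nonzero (scalar 52)).eval ε ρ := by simp [h52]
          rw [run_ite_pos hc]
          have hres := hEρ.run_lightAdd (ε := ε) (w := w) (G := G) (H := H)
            (by rw [hagm.nat 0 (by decide)]; exact hIυ.size)
            (by
              rw [hagm.nat 8 (by decide), hagυ.nat 8 (by decide), hag₀.nat 8 (by decide)]
              exact hH.verts)
            (by rw [hagm.real 60 (by decide), hagυ.real 60 (by decide), h60]; rfl)
            hij h53 h54 h50
          have hupd : ∀ v : Fin n, (v : ℕ) < k →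
              Function.update nb ⟨k, hk⟩ j v = nb v := fun v hv =>
            Function.update_of_ne (fun h => by rw [h] at hv; simp at hv) _ _
          refine ⟨Function.update nb ⟨k, hk⟩ j, fun v hv hvk x hx => ?_, ?_⟩
          · by_cases hvk' : (v : ℕ) = k
            · obtain rfl : v = ⟨k, hk⟩ := Fin.ext hvk'
              rw [Function.update_self]
              exact ⟨hij, hmin _ x ⟨rfl, hx⟩⟩
            · rw [hupd v (by omega)]
              exact hnb v hv (by omega) x hx
          · have hset : lightSet G w K H (Function.update nb ⟨k, hk⟩ j) (k + 1) =
                lightSet G w K H nb k ∪ {e | e = s(⟨k, hk⟩, j) ∧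
                  w e * (H.verts.ncard : ℝ≥0) < edgeWeight w H.edgeSet} := by
              ext e
              constructor
              · rintro ⟨he, ⟨v, hv, hvk, rfl⟩, hw⟩
                by_cases hvk' : (v : ℕ) = k
                · obtain rfl : v = ⟨k, hk⟩ := Fin.ext hvk'
                  rw [Function.update_self] at hw ⊢
                  exact Or.inr ⟨rfl, hw⟩
                · rw [hupd v (by omega)] at hw he ⊢
                  exact Or.inl ⟨he, ⟨v, hv, by omega, rfl⟩, hw⟩
              · rintro (⟨he, ⟨v, hv, hvk, rfl⟩, hw⟩ | ⟨rfl, hw⟩)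
                · exact ⟨he, ⟨v, hv, by omega, by rw [hupd v hvk]⟩, hw⟩
                · exact ⟨hij, ⟨⟨k, hk⟩, hkK, by simp, by rw [Function.update_self]⟩, hw⟩
            rw [hset, SimpleGraph.fromEdgeSet_union, ← sup_assoc]
            exact hres
      · have hc : ¬ (nonzero (entry 6 69)).eval ε υ := by
          simp only [BExp.eval, NExp.eval, e69]; exact fun h => hkK (hKυ.1 h)
        rw [lightRound, run_ite_neg hc, run_skip]
        obtain ⟨h1, h2⟩ := hnochange fun h => absurd h hkK
        exact ⟨nb, h1, by rw [h2]; exact hEυ⟩)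
  obtain ⟨-, nb, hnb, hE⟩ := hmain
  refine ⟨nb, fun v hv => hnb v hv v.2, ?_⟩
  rw [addLightEdges, run_seq, ← hτ₀]
  exact hE

end LightEdges


/-! ## The greedy loop -/

section Greedy

variable {n : ℕ} {G X : SimpleGraph (Fin n)} {w : Sym2 (Fin n) → ℝ≥0} {S : Finset (Fin n)}
  {ε : ℝ≥0} {σ τ : Mem}

def greedyCond : BExp :=
  .and (nonzero (entry 2 50)) (.and (nonzero (entry 2 51)) (.not (nonzero (cell 12 50 51))))

def greedyHandle : Prog :=
  .seq (.setNat 12 (scalar 53) (scalar 54) (.const 1))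
    (.ite (satisfiedCond 53 54) .skip (pathTrace 53 54 3))

def greedyRound : Prog :=
  .seq distances (.seq (argmin greedyCond (rcell 3 50 51))
    (.ite (nonzero (scalar 52)) greedyHandle .skip))

/-- Treat the pairs of terminals in nondecreasing order of the maximum weight on their paths;
array `12` marks the pairs that have been treated. -/
def greedy : Prog := loopPairs 67 68 greedyRound

/-- The memory after the greedy loop has treated the pairs in `l`, starting from `X`. -/
structure GreedyState (P : PathSystem G w S) (ε : ℝ≥0) (X : SimpleGraph (Fin n))
    (l : List (S × S)) (σ : Mem) : Prop where
  ready : Ready P σ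
  nodup : l.Nodup
  sorted : l.Pairwise fun a b => P.W a.1 a.2 ≤ P.W b.1 b.2
  le_rest : ∀ a ∈ l, ∀ b ∉ l, P.W a.1 a.2 ≤ P.W b.1 b.2
  treated : ∀ u v : S, 0 < σ.nat 12 (u : Fin n) (v : Fin n) ↔ (u, v) ∈ l
  edges : HoldsEdges (l.foldl (greedyStep P ε) X) σ

variable {P : PathSystem G w S} {l : List (S × S)}

lemma GreedyState.of_agreeOff {A B : List ℕ} (h : GreedyState P ε X l σ)
    (ha : σ.AgreeOff A B τ) (hA : (0 ∉ A ∧ 1 ∉ A ∧ 2 ∉ A ∧ 5 ∉ A) ∧ 3 ∉ A ∧ 12 ∉ A)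
    (hB : 0 ∉ B ∧ 1 ∉ B ∧ 3 ∉ B) : GreedyState P ε X l τ :=
  ⟨h.ready.of_agreeOff ha hA.1 hB, h.nodup, h.sorted, h.le_rest,
    by rw [ha.nat 12 hA.2.2]; exact h.treated, h.edges.of_agreeOff ha hA.2.1⟩

/-- As `p` is minimal among the untreated pairs and no treated pair exceeds it, appending it keeps
the list sorted. -/
lemma run_greedyHandle (h : GreedyState P ε X l σ) {p : S × S} (hp : p ∉ l)
    (hmin : ∀ b ∉ l, P.W p.1 p.2 ≤ P.W b.1 b.2)
    (hu : σ.nat 53 0 0 = (p.1 : Fin n)) (hv : σ.nat 54 0 0 = (p.2 : Fin n))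
    (hd : (σ.real 10 (p.1 : Fin n) (p.2 : Fin n) : ℝ≥0∞) =
      wdist w (l.foldl (greedyStep P ε) X) p.1 p.2) :
    GreedyState P ε X (l ++ [p]) (greedyHandle.run ε σ) := by
  obtain ⟨τ, hτ⟩ : ∃ τ, τ = σ.setNat 12 (p.1 : Fin n) (p.2 : Fin n) 1 := ⟨_, rfl⟩
  have hag : σ.AgreeOff [12] [] τ := hτ ▸ (Mem.AgreeOff.refl σ).setNat (by simp)
  have hrun : greedyHandle.run ε σ =
      (Prog.ite (satisfiedCond 53 54) .skip (pathTrace 53 54 3)).run ε τ := by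
    simp only [greedyHandle, run_seq, run_setNat, NExp.eval, hu, hv, ← hτ]
  have hPτ : Ready P τ := h.ready.of_agreeOff hag (by decide) (by decide)
  have hu' : τ.nat 53 0 0 = (p.1 : Fin n) := by rw [hag.nat 53 (by decide), hu]
  have hv' : τ.nat 54 0 0 = (p.2 : Fin n) := by rw [hag.nat 54 (by decide), hv]
  have hEτ := h.edges.of_agreeOff hag (by decide)
  have hsat := eval_satisfiedCond (ε := ε) hPτ hu' hv'
    (by rw [hag.real 10 (by decide)]; exact hd)
  have htreated : ∀ u v : S, 0 < τ.nat 12 (u : Fin n) (v : Fin n) ↔ (u, v) ∈ l ++ [p] := by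
    intro u v
    have huv : ((u : Fin n) : ℕ) = (p.1 : Fin n) ∧ ((v : Fin n) : ℕ) = (p.2 : Fin n) ↔
        (u, v) = p := by
      rw [Prod.ext_iff, Subtype.ext_iff, Subtype.ext_iff, Fin.ext_iff, Fin.ext_iff]
    rw [hτ, Mem.nat_setNat, List.mem_append, List.mem_singleton, ← h.treated u v, ← huv]
    by_cases hc : ((u : Fin n) : ℕ) = (p.1 : Fin n) ∧ ((v : Fin n) : ℕ) = (p.2 : Fin n)
    · simp [hc]
    · simp [hc]
  have key : ∀ υ, τ.AgreeOff [3, 9, 56, 57, 58, 63, 64] [] υ →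
      HoldsEdges (greedyStep P ε (l.foldl (greedyStep P ε) X) p) υ →
      GreedyState P ε X (l ++ [p]) υ := fun υ hagυ hE => by
    refine ⟨hPτ.of_agreeOff hagυ (by decide) (by decide), ?_, ?_, ?_, ?_, ?_⟩
    · exact h.nodup.append (by simp) (by simpa using hp)
    · rw [List.pairwise_append]
      refine ⟨h.sorted, by simp, fun a ha b hb => ?_⟩
      rw [List.mem_singleton.1 hb]
      exact h.le_rest a ha p hp
    · intro a ha b hb
      simp only [List.mem_append, List.mem_singleton, not_or] at ha hb
      rcases ha with ha | rfl
      · exact h.le_rest a ha b hb.1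
      · exact hmin b hb.1
    · rw [hagυ.nat 12 (by decide)]; exact htreated
    · rwa [List.foldl_append]
  rw [hrun]
  by_cases hc : (satisfiedCond 53 54).eval ε τ
  · rw [run_ite_pos hc, run_skip]
    refine key τ (.refl τ) ?_
    rw [greedyStep, if_pos (hsat.1 hc)]
    exact hEτ
  · rw [run_ite_neg hc]
    refine key _ (agreeOff_pathTrace 53 54 3 τ) ?_
    rw [greedyStep, if_neg (fun h => hc (hsat.2 h))]
    have h3 := (run_pathTrace (ε := ε) hPτ (a := 53) (b := 54) (e := 3) (Or.inl rfl) (by decide)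
      (by decide) hu' hv').2
    intro i j
    rw [h3, SimpleGraph.sup_adj, ← SimpleGraph.mem_edgeSet (walkGraph _), mem_edgeSet_walkGraph]
    by_cases he : s(i, j) ∈ (P.path p.1 p.2).edges
    · simp [he]
    · simpa [he] using hEτ i j

/-- The distance table is meaningful only for connected pairs; `X` connects all terminals, and the
current graph contains `X`. -/
lemma run_greedyRound (h : GreedyState P ε X l σ) (hXG : X ≤ G)
    (hX : ∀ u v : S, X.Reachable (u : Fin n) v) :
    ((∀ p, p ∈ l) ∧ GreedyState P ε X l (greedyRound.run ε σ)) ∨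
      ∃ p ∉ l, GreedyState P ε X (l ++ [p]) (greedyRound.run ε σ) := by
  obtain ⟨τ, hτ⟩ : ∃ τ, τ = distances.run ε σ := ⟨_, rfl⟩
  obtain ⟨υ, hυ⟩ : ∃ υ, υ = (argmin greedyCond (rcell 3 50 51)).run ε τ := ⟨_, rfl⟩
  have hrun : greedyRound.run ε σ =
      (Prog.ite (nonzero (scalar 52)) greedyHandle .skip).run ε υ := by
    simp only [greedyRound, run_seq, ← hτ, ← hυ]
  have hagτ := agreeOff_distances (ε := ε) σ
  rw [← hτ] at hagτ
  have hagυ := agreeOff_argmin (ε := ε) greedyCond (rcell 3 50 51) τ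
  rw [← hυ] at hagυ
  have hGτ : GreedyState P ε X l τ := h.of_agreeOff hagτ (by decide) (by decide)
  have hGυ : GreedyState P ε X l υ := hGτ.of_agreeOff hagυ (by decide) (by decide)
  have hd : ∀ u v : S, (υ.real 10 (u : Fin n) (v : Fin n) : ℝ≥0∞) =
      wdist w (l.foldl (greedyStep P ε) X) u v := fun u v => by
    rw [hagυ.real 10 (by decide), hτ]
    exact run_distances h.ready.input h.edges (foldl_greedyStep_le l hXG)
      ((hX u v).mono (le_foldl_greedyStep P ε l X))
  have hmin := run_argmin (ε := ε) (σ := τ) (c := greedyCond) (x := rcell 3 50 51)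
    (fun i j => i ∈ S ∧ j ∈ S ∧ ¬ 0 < τ.nat 12 i j) (fun i j => τ.real 3 i j)
    hGτ.ready.input.size (fun μ hμ i j hi hj => by
      constructor
      · rw [← hGτ.ready.input.terminal, ← hGτ.ready.input.terminal]
        simp only [greedyCond, BExp.eval, NExp.eval, hi, hj, hμ.nat 2 (by decide),
          hμ.nat 12 (by decide)]
        rfl
      · intro _
        simp only [RExp.eval, NExp.eval, hi, hj, hμ.real 3 (by decide)])
  rw [← hυ] at hmin
  rw [hrun]
  rcases hmin with ⟨h52, hnone⟩ | ⟨h52, i, j, ⟨hi, hj, hij⟩, h53, h54, -, hle⟩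
  · rw [run_ite_neg (by simp [h52]), run_skip]
    refine Or.inl ⟨fun p => ?_, hGυ⟩
    by_contra hp
    exact hnone p.1 p.2 ⟨p.1.2, p.2.2, fun h' => hp ((hGτ.treated p.1 p.2).1 h')⟩
  · rw [run_ite_pos (by simp [h52])]
    refine Or.inr ⟨(⟨i, hi⟩, ⟨j, hj⟩), fun h' => hij ((hGτ.treated ⟨i, hi⟩ ⟨j, hj⟩).2 h'),
      run_greedyHandle hGυ (fun h' => hij ((hGτ.treated ⟨i, hi⟩ ⟨j, hj⟩).2 h')) (fun b hb => ?_)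
        h53 h54 (hd _ _)⟩
    rw [← hGτ.ready.maxWeight, ← hGτ.ready.maxWeight]
    exact hle b.1 b.2 ⟨b.1.2, b.2.2, fun h' => hb ((hGτ.treated b.1 b.2).1 h')⟩

lemma run_greedy (hP : Ready P σ) (h12 : ∀ i j, σ.nat 12 i j = 0) (hE : HoldsEdges X σ)
    (hXG : X ≤ G) (hX : ∀ u v : S, X.Reachable (u : Fin n) v) :
    ∃ l, (∀ p, p ∈ l) ∧ GreedyState P ε X l (greedy.run ε σ) := by
  have h := run_loopPairs_induction (ε := ε) (n := n) (i := 67) (j := 68) (p := greedyRound)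
    (σ := σ)
    (fun k m τ => ∃ l, ((∀ p, p ∈ l) ∨ k * n + m ≤ l.length) ∧ GreedyState P ε X l τ)
    (by decide) (by decide)
    (fun k m τ ⟨l, _, hl⟩ => hl.ready.input.size)
    ⟨[], by simp, hP, by simp, by simp, by simp, by simp [h12], hE⟩
    (fun k _ τ ⟨l, hlen, hl⟩ => ⟨l, hlen, hl.of_agreeOff (A := [67]) (B := [])
      ((Mem.AgreeOff.refl τ).setNat (by simp)) (by decide) (by decide)⟩)
    (fun k _ τ ⟨l, hlen, hl⟩ => ⟨l, by rwa [add_zero, Nat.succ_mul], hl⟩)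
    (by
      rintro k hk m hm τ ⟨l, hlen, hl⟩ -
      have hl' : GreedyState P ε X l (τ.setNat 68 0 0 m) := hl.of_agreeOff (A := [68]) (B := [])
        ((Mem.AgreeOff.refl τ).setNat (by simp)) (by decide) (by decide)
      rcases run_greedyRound hl' hXG hX with ⟨hall, h⟩ | ⟨p, hp, h⟩
      · exact ⟨l, Or.inl hall, h⟩
      · refine ⟨l ++ [p], Or.inr ?_, h⟩
        have := hlen.resolve_left fun h => hp (h p)
        rw [List.length_append, List.length_singleton]
        omega)
  obtain ⟨l, hlen, hl⟩ := h
  refine ⟨l, fun p => ?_, hl⟩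
  -- There are `n * n` rounds, but an untreated pair would force a repetition-free list of more than
  -- `S.card * S.card` pairs.
  by_contra hp
  have h1 := hlen.resolve_left fun h => hp (h p)
  have h2 := (List.nodup_cons.2 ⟨hp, hl.nodup⟩).length_le_card
  have h3 : S.card ≤ n := by simpa using S.card_le_univ
  have h4 := Nat.mul_le_mul h3 h3
  simp only [List.length_cons, Fintype.card_prod, Fintype.card_coe] at h2
  omega

end Greedy


/-! ## The whole program -/

section Construction

variable {n : ℕ} {G : SimpleGraph (Fin n)} {w : Sym2 (Fin n) → ℝ≥0} {S : Finset (Fin n)}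
  {ε : ℝ≥0} {σ τ : Mem}

/-- Take a terminal as the initial tree. -/
def startTree : Prog :=
  .seq (argmin (nonzero (entry 2 50)) .zero) (.setNat 8 (scalar 53) (.const 0) (.const 1))

lemma run_startTree (hI : HoldsInput G w S σ) (hS : S.Nonempty) (h3 : ∀ i j, σ.nat 3 i j = 0)
    (h8 : ∀ i j, σ.nat 8 i j = 0) :
    ∃ r ∈ S, HoldsTree (G.singletonSubgraph r) (startTree.run ε σ) := by
  obtain ⟨τ, hτ⟩ : ∃ τ, τ = (argmin (nonzero (entry 2 50)) .zero).run ε σ := ⟨_, rfl⟩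
  have hag := agreeOff_argmin (ε := ε) (nonzero (entry 2 50)) .zero σ
  have hmin := run_argmin (ε := ε) (σ := σ) (c := nonzero (entry 2 50)) (x := .zero)
    (fun i _ : Fin n => i ∈ S) (fun _ _ => 0) hI.size (fun μ hμ i j hi _ => by
      refine ⟨?_, fun _ => rfl⟩
      rw [← hI.terminal]
      simp only [BExp.eval, NExp.eval, hi, hμ.nat 2 (by decide)]
      rfl)
  rw [← hτ] at hag hmin
  obtain ⟨x, hx⟩ := hS
  rcases hmin with ⟨-, h⟩ | ⟨-, r, -, hr, h53, -⟩
  · exact absurd hx (h x x)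
  · have hrun : startTree.run ε σ = τ.setNat 8 r 0 1 := by
      simp only [startTree, run_seq, ← hτ, run_setNat, NExp.eval, h53]
    refine ⟨r, hr, fun y => ?_, fun i j => ?_⟩
    · rw [hrun, Mem.nat_setNat, hag.nat 8 (by decide), h8]
      by_cases hyr : (y : ℕ) = r <;> simp [Fin.ext_iff, hyr]
    · rw [hrun, Mem.nat_setNat_of_ne _ (by decide), hag.nat 3 (by decide), h3]
      simp

/-- Compute the shortest paths and a Steiner tree for the terminals. -/
def steinerTree : Prog := .seq setup (.seq startTree (.seq (copyNat 2 6) extend))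

/-- Add the vertices on the paths of the pairs that the tree does not satisfy. -/
def enlargeTree : Prog := .seq distances (.seq markTerminals extend)

/-- The greedy construction. -/
def construction : Prog := .seq steinerTree (.seq enlargeTree (.seq addLightEdges greedy))

lemma isApproxSteinerTree_of_completesWithin {K : Set (Fin n)} {T : G.Subgraph} {ρ : ℝ≥0}
    (hT : IsSubtree T) (hK : K ⊆ T.verts)
    (h : ∀ T', IsSteinerTree G K T' → CompletesWithin w K T (ρ * edgeWeight w T'.edgeSet)) :
    IsApproxSteinerTree ρ w G K T :=
  ⟨⟨hT.isTree, hK⟩, fun T' hT' => (h T' hT').edgeWeight_le⟩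

/-- Growth starts from a single terminal, whose tree has weight `0`, so the budget is exactly twice
the weight of any competing tree. -/
lemma run_steinerTree (hI : HoldsInput G w S σ) (hS : S.Nonempty)
    (hconn : ∀ u ∈ S, ∀ v ∈ S, G.Reachable u v) (h3 : ∀ i j, σ.nat 3 i j = 0)
    (h8 : ∀ i j, σ.nat 8 i j = 0) :
    ∃ (P : PathSystem G w S) (R : G.Subgraph), Ready P (steinerTree.run ε σ) ∧ IsSubtree R ∧
      IsApproxSteinerTree 2 w G S R ∧ HoldsTree R (steinerTree.run ε σ) ∧
      ∀ x : Fin n, 0 < (steinerTree.run ε σ).nat 6 x 0 ↔ x ∈ S := by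
  obtain ⟨τ₁, hτ₁⟩ : ∃ τ, τ = setup.run ε σ := ⟨_, rfl⟩
  obtain ⟨τ₂, hτ₂⟩ : ∃ τ, τ = startTree.run ε τ₁ := ⟨_, rfl⟩
  obtain ⟨τ₃, hτ₃⟩ : ∃ τ, τ = (copyNat 2 6).run ε τ₂ := ⟨_, rfl⟩
  obtain ⟨τ₄, hτ₄⟩ : ∃ τ, τ = extend.run ε τ₃ := ⟨_, rfl⟩
  have hrun : steinerTree.run ε σ = τ₄ := by
    simp only [steinerTree, run_seq, ← hτ₁, ← hτ₂, ← hτ₃, ← hτ₄]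
  rw [hrun]
  obtain ⟨P, hP₁⟩ := exists_ready_setup (ε := ε) hI hconn
  have hag₁ := agreeOff_setup (ε := ε) σ
  rw [← hτ₁] at hP₁ hag₁
  obtain ⟨r, hrS, hr⟩ := run_startTree (ε := ε) hP₁.input hS
    (by rw [hag₁.nat 3 (by decide)]; exact h3) (by rw [hag₁.nat 8 (by decide)]; exact h8)
  have hag₂ : τ₁.AgreeOff [8, 50, 51, 52, 53, 54] [50] τ₂ :=
    hτ₂ ▸ agreeOff_run_of_subset _ (by decide) (by decide)
  have hag₃ := agreeOff_copyNat (ε := ε) 2 6 τ₂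
  have hag₄ := agreeOff_extend (ε := ε) τ₃
  rw [← hτ₂] at hr
  rw [← hτ₃] at hag₃
  rw [← hτ₄] at hag₄
  have hP₂ := hP₁.of_agreeOff hag₂ (by decide) (by decide)
  have hP₃ := hP₂.of_agreeOff hag₃ (by decide) (by decide)
  have h6 : ∀ x : Fin n, 0 < τ₃.nat 6 x 0 ↔ x ∈ (S : Set (Fin n)) := fun x => by
    have := run_copyNat (ε := ε) (s := 2) (d := 6) (by decide) (by decide) (by decide)
      hP₂.input.size x ⟨0, x.pos⟩
    rw [← hτ₃] at this
    rw [Finset.mem_coe, ← hP₂.input.terminal x, ← this]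
  obtain ⟨R, -, hSR, hR, hRτ, hRw⟩ := run_extend (ε := ε) hP₃.paths h6
    (isSubtree_singleton (G := G) r) (hr.of_agreeOff hag₃ (by decide)) (r := r) (by simp)
    (fun k hk => hconn r hrS k hk)
  rw [← hτ₄] at hRτ
  refine ⟨P, R, hP₃.of_agreeOff hag₄ (by decide) (by decide), hR,
    isApproxSteinerTree_of_completesWithin hR hSR fun T' hT' => ?_, hRτ, ?_⟩
  · have := hRw _ (completesWithin_of_steinerTree (w := w) hT' (r := r) hrS (by simp))
    have h0 : (G.singletonSubgraph r).edgeSet = ∅ := by simp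
    rwa [h0, edgeWeight_empty, zero_add] at this
  · rw [hag₄.nat 6 (by decide)]; exact h6

/-- Growth continues from `R` with the budget `w(R) + 2 * w(T')`. A tree `T'` for the extended
terminals also competes with `R`, so `w(R) ≤ 2 * w(T')` and the factor is `4`. -/
lemma run_enlargeTree {P : PathSystem G w S} (hP : Ready P σ) (hS : S.Nonempty)
    {R : G.Subgraph} (hR : IsSubtree R) (hRS : IsApproxSteinerTree 2 w G S R)
    (hRσ : HoldsTree R σ) (h6 : ∀ x : Fin n, 0 < σ.nat 6 x 0 ↔ x ∈ S) :
    ∃ H : G.Subgraph, R ≤ H ∧ IsApproxSteinerTree 4 w G (P.extendedTerminals ε R) H ∧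
      HoldsTree H (enlargeTree.run ε σ) ∧ Ready P (enlargeTree.run ε σ) ∧
      ∀ x : Fin n, 0 < (enlargeTree.run ε σ).nat 6 x 0 ↔ x ∈ P.extendedTerminals ε R := by
  obtain ⟨r, hrS⟩ := hS
  obtain ⟨τ₁, hτ₁⟩ : ∃ τ, τ = distances.run ε σ := ⟨_, rfl⟩
  obtain ⟨τ₂, hτ₂⟩ : ∃ τ, τ = markTerminals.run ε τ₁ := ⟨_, rfl⟩
  obtain ⟨τ₃, hτ₃⟩ : ∃ τ, τ = extend.run ε τ₂ := ⟨_, rfl⟩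
  have hrun : enlargeTree.run ε σ = τ₃ := by
    simp only [enlargeTree, run_seq, ← hτ₁, ← hτ₂, ← hτ₃]
  rw [hrun]
  have hag₁ := agreeOff_distances (ε := ε) σ
  have hag₂ := agreeOff_markTerminals (ε := ε) τ₁
  have hag₃ := agreeOff_extend (ε := ε) τ₂
  rw [← hτ₁] at hag₁
  rw [← hτ₂] at hag₂
  rw [← hτ₃] at hag₃
  have hP₁ := hP.of_agreeOff hag₁ (by decide) (by decide)
  have hP₂ := hP₁.of_agreeOff hag₂ (by decide) (by decide)
  have hRt : ∀ u ∈ S, ∀ v ∈ S, R.spanningCoe.Reachable u v := fun u hu v hv =>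
    subgraph_reachable_spanningCoe hR.1.coe (hRS.1.2 hu) (hRS.1.2 hv)
  have h6₂ : ∀ x : Fin n, 0 < τ₂.nat 6 x 0 ↔ x ∈ P.extendedTerminals ε R := by
    rw [hτ₂]
    refine run_markTerminals hP₁ (by rw [hag₁.nat 6 (by decide)]; exact h6) fun u v => ?_
    rw [hτ₁]
    exact run_distances hP.input (X := R.spanningCoe) hRσ.edges R.spanningCoe_le
      (hRt u u.2 v v.2)
  have hSK : (S : Set (Fin n)) ⊆ P.extendedTerminals ε R := fun x hx => Or.inl hx
  have hreach : ∀ k ∈ P.extendedTerminals ε R, G.Reachable r k := by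
    rintro k (hk | ⟨u, v, -, hk⟩)
    · exact (hRt r hrS k hk).mono R.spanningCoe_le
    · exact ((hRt r hrS u u.2).mono R.spanningCoe_le).trans
        ((P.path u v).takeUntil k hk).reachable
  obtain ⟨H, hRH, hKH, hH, hHτ, hHw⟩ := run_extend (ε := ε) hP₂.paths h6₂ hR
    ((hRσ.of_agreeOff hag₁ (by decide)).of_agreeOff hag₂ (by decide)) (hRS.1.2 hrS) hreach
  rw [← hτ₃] at hHτ
  refine ⟨H, hRH, ⟨⟨hH.isTree, hKH⟩, fun T' hT' => ?_⟩, hHτ,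
    hP₂.of_agreeOff hag₃ (by decide) (by decide), by rw [hag₃.nat 6 (by decide)]; exact h6₂⟩
  have h1 := (hHw _ (completesWithin_of_steinerTree (w := w) hT' (hSK hrS)
    (hRS.1.2 hrS))).edgeWeight_le
  have h2 := hRS.2 T' (hT'.mono hSK)
  calc edgeWeight w H.edgeSet
      ≤ edgeWeight w R.edgeSet + 2 * edgeWeight w T'.edgeSet := h1
    _ ≤ 2 * edgeWeight w T'.edgeSet + 2 * edgeWeight w T'.edgeSet := by gcongr
    _ = 4 * edgeWeight w T'.edgeSet := by ring

lemma run_construction (hI : HoldsInput G w S σ) (hS : S.Nonempty)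
    (hconn : ∀ u ∈ S, ∀ v ∈ S, G.Reachable u v) (h3 : ∀ i j, σ.nat 3 i j = 0)
    (h8 : ∀ i j, σ.nat 8 i j = 0) (h12 : ∀ i j, σ.nat 12 i j = 0) :
    ∃ run : GreedyRun 4 ε G w S, IsOutput (construction.run ε σ) run.spanner := by
  obtain ⟨τ₁, hτ₁⟩ : ∃ τ, τ = steinerTree.run ε σ := ⟨_, rfl⟩
  obtain ⟨τ₂, hτ₂⟩ : ∃ τ, τ = enlargeTree.run ε τ₁ := ⟨_, rfl⟩
  obtain ⟨τ₃, hτ₃⟩ : ∃ τ, τ = addLightEdges.run ε τ₂ := ⟨_, rfl⟩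
  have hrun : construction.run ε σ = greedy.run ε τ₃ := by
    simp only [construction, run_seq, ← hτ₁, ← hτ₂, ← hτ₃]
  obtain ⟨P, R, hP₁, hR, hRS, hRτ, h6₁⟩ := run_steinerTree (ε := ε) hI hS hconn h3 h8
  rw [← hτ₁] at hP₁ hRτ h6₁
  obtain ⟨H, hRH, hHS, hHτ, hP₂, h6₂⟩ := run_enlargeTree (ε := ε) hP₁ hS hR hRS hRτ h6₁
  rw [← hτ₂] at hHτ hP₂ h6₂
  obtain ⟨nb, hnb, hE⟩ := run_addLightEdges (ε := ε) hP₂.input h6₂ hHτ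
  have hag₁ : σ.AgreeOff [3, 4, 5, 6, 8, 10, 11, 50, 51, 52, 53, 54, 56, 57, 58, 60, 61, 62, 63, 64]
      [1, 3, 10, 11, 50] τ₁ := hτ₁ ▸ agreeOff_run_of_subset _ (by decide) (by decide)
  have hag₂ : τ₁.AgreeOff [3, 4, 6, 7, 8, 9, 10, 11, 50, 51, 52, 53, 54, 56, 57, 58, 60, 61, 62,
      63, 64, 65, 66] [10, 11, 50] τ₂ := hτ₂ ▸ agreeOff_run_of_subset _ (by decide) (by decide)
  have hag₃ : τ₂.AgreeOff [3, 50, 51, 52, 53, 54, 63, 64, 69] [50, 60, 61] τ₃ :=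
    hτ₃ ▸ agreeOff_run_of_subset _ (by decide) (by decide)
  rw [← hτ₃] at hE
  have hSH : (S : Set (Fin n)) ⊆ H.verts := hRS.1.2.trans hRH.1
  obtain ⟨l, hall, hl⟩ := run_greedy (ε := ε)
    (hP₂.of_agreeOff hag₃ (by decide) (by decide))
    (by rw [hag₃.nat 12 (by decide), hag₂.nat 12 (by decide), hag₁.nat 12 (by decide)]; exact h12)
    hE
    (sup_le H.spanningCoe_le fun a b hab => by
      rw [SimpleGraph.fromEdgeSet_adj] at hab
      exact hab.1.1)
    (fun u v => (subgraph_reachable_spanningCoe hHS.1.1.connected (hSH u.2)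
      (hSH v.2)).mono le_sup_left)
  let run : GreedyRun 4 ε G w S :=
    { P := P
      R := R
      R_steiner := ⟨hRS.1, fun T' hT' => (hRS.2 T' hT').trans (by gcongr; norm_num)⟩
      -- `H` is itself a 4-approximation, so it serves as `T` and lies trivially in `R ⊔ T`.
      T := H
      T_steiner := hHS
      H := H
      H_steiner := hHS.1
      R_le_H := hRH
      H_le_union := le_sup_right
      nbr := nb
      nbr_lightest := hnb
      order := l
      order_nodup := hl.nodup
      order_complete := hall
      order_sorted := hl.sorted }
  have hlight : run.lightEdges = lightSet G w (P.extendedTerminals ε R) H nb n := by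
    ext e
    simp [GreedyRun.lightEdges, lightSet, run]
  have hspanner : run.spanner = l.foldl (greedyStep P ε) (H.spanningCoe ⊔
      SimpleGraph.fromEdgeSet (lightSet G w (P.extendedTerminals ε R) H nb n)) := by
    rw [← hlight]; rfl
  refine ⟨run, fun i j => ?_⟩
  rw [hrun, hspanner]
  have := hl.edges i j
  split_ifs with h
  · exact this.1 h
  · exact this.2 h

lemma vertexLoops_construction : construction.VertexLoops := by
  simp [construction, steinerTree, enlargeTree, setup, startTree, copyNat, extend, extendRound,
    extendAttach, distances, markTerminals, markBody, mergeMarks, addLightEdges, sumEdges,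
    sumEdgesBody, lightRound, lightAdd, scaleByVerts, greedy, greedyRound, greedyHandle, pathTrace,
    trace, traceStep, allShortestPaths, dijkstraInit, dijkstraRound, dijkstraUpdate, argmin,
    loopPairs, Prog.VertexLoops]

end Construction

end SubsetSpanner

end

theorem theorem1 :
    (∀ ρ : ℝ≥0, ∃ (A : ℝ≥0) (k : ℕ),
      ∀ (ε : ℝ≥0), 0 < ε →
      ∀ (n : ℕ) (G : SimpleGraph (Fin n)) (w : Sym2 (Fin n) → ℝ≥0) (S : Finset (Fin n)),
      S.Nonempty →
      ∀ run : SubsetSpanner.GreedyRun ρ ε G w S,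
        run.P.IsSpanner ε run.spanner ∧
        run.P.subsetLightness ε run.R run.spanner
          ≤ ((A * (1 + 1 / ε) ^ k * (S.card : ℝ≥0) : ℝ≥0) : ℝ≥0∞)) ∧
    (∃ (ρ : ℝ≥0) (prog : SubsetSpanner.Prog) (time : Polynomial ℕ),
      ∀ (ε : ℝ≥0), 0 < ε →
      ∀ (n : ℕ) (G : SimpleGraph (Fin n)) (w : Sym2 (Fin n) → ℝ≥0) (S : Finset (Fin n)),
      S.Nonempty → (∀ u ∈ S, ∀ v ∈ S, G.Reachable u v) →
      (prog.exec ε (SubsetSpanner.inputMem G w S)).2 ≤ time.eval n ∧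
      ∃ run : SubsetSpanner.GreedyRun ρ ε G w S,
        SubsetSpanner.IsOutput (prog.exec ε (SubsetSpanner.inputMem G w S)).1 run.spanner) := by
  -- The constant is `22 * 2ρ`: `22` from the potential argument and `2ρ` from the weight of `H`.
  -- The dependence on `1 / ε` is linear.
  refine ⟨fun ρ => ⟨44 * ρ, 1, fun ε hε n G w S hS run =>
    ⟨run.isSpanner, run.subsetLightness_le hS hε⟩⟩, 4, SubsetSpanner.construction,
    SubsetSpanner.construction.timeBound, fun ε _ n G w S hS hconn => ⟨?_, ?_⟩⟩
  · exact SubsetSpanner.vertexLoops_construction.time_le _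
      (SubsetSpanner.holdsInput_inputMem G w S).size
  · exact SubsetSpanner.run_construction (SubsetSpanner.holdsInput_inputMem G w S) hS hconn
      (by simp [SubsetSpanner.inputMem]) (by simp [SubsetSpanner.inputMem])
      (by simp [SubsetSpanner.inputMem])
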